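/- **Theorem.** Let $G$ be an undirected, unweighted, simple graph on the vertex set $\{0,\dots,n-1\}$ ($n\ge 1$) with $m$ edges and without isolated vertices, given by adjacency lists (degree and neighbour queries in constant time). Let $d_v$ be the degree of $v$, let $P=AD^{-1}$ be the transition matrix of the random walk, and for an integer $L\ge 1$ put $p_{L,u}=\frac12\sum_{l=0}^{L}\left(\frac12 I+\frac12 P\right)^l e_u$. Let $\epsilon\in(0,1)$, and let $K>0$ be the constant factor in the numbers of sampled walks. Consider the following randomized algorithm. Put $r_{\max}=L\epsilon\sqrt{n/m}$. For every vertex $u$: 1. Run $n_1=\lceil K L^2\log n/\epsilon\rceil$ lazy random walks of length $L$ from $u$. Let $p'_u(w)$ be $\frac{1}{2n_1}$ times the number of pairs (walk, step $k$ with $0\le k\le L$) in which the walk is at $w$ at step $k$. The candidate set is $S'_u=\{w: p'_u(w)>\epsilon/2\}$. 2. For every $v\in S'_u$ run coordinate gradient descent $\mathrm{CGD}(G,v,L,R)$ with $R=r_{\max}/(2p'_u(v))$. It starts from $q_v=0$, $r_{0,v}=\frac12 e_v$ and $r_{i,v}=0$ for $i\geq 1$. For $i=0,\dots,L$, as long as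 some $w$ has $r_{i,v}(w)>\frac{R}{L^2}d_w$, with $x=r_{i,v}(w)$ it adds $x$ to $q_v(w)$, adds $\frac{x}{2d_w}$ to $r_{i+1,v}(z)$ for every neighbour $z$ of $w$, adds $\frac x2$ to $r_{i+1,v}(w)$, and sets $r_{i,v}(w)=0$. 3. Run $n_3=\lceil K L\, r_{\max} d_u\log n/\epsilon^2\rceil$ lazy random walks of length $L$ from $u$, shared by all candidates. Let $N_{w,k}$ be the number of these walks that are at $w$ at step $k$. For every $v\in S'_u$ with $d_v\le d_u$ output $$\hat p_{L,u}(v)=\frac{q_v(u)\,d_v}{d_u}+\frac{d_v}{n_3}\sum_{k=0}^{L}\sum_{w}\Big(\sum_{i=0}^{L-k}\frac{r_{i,v}(w)}{d_w}\Big)N_{w,k};$$ every other value $\hat p_{L,u}(v)$ is $0$ and is not stored. The algorithm is implemented on a unit-cost random access machine with real-valued memory cells. One step is a memory access, a degree or neighbour query, a uniform draw from $\{0,\dots,k-1\}$, the evaluation of a fixed arithmetic expression, a branch or a loop iteration. The space of a run is the number of memory cells that it ever accesses, the stored output included. Then: * (Accuracy) For every $c>0$ there is a constant $K_0>0$ that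 depends only on $c$ such that, if $KL\ge K_0$, then with probability at least $1-n^{-c}$, $$|\hat p_{L,u}(v)-p_{L,u}(v)|\le\epsilon\qquad\text{for all vertices } u,v \text{ with } d_v\le d_u .$$ * (Complexity) There is an absolute constant $C$ such that every run, whatever the outcomes of its random draws, makes at most $C(1+K)\,L^4\log n\cdot\frac{\sqrt{nm}}{\epsilon}$ steps and uses at most $C L^2\cdot\frac n\epsilon$ memory cells. In particular, for constant $K$ and $L$ polylogarithmic in $n$ and $1/\epsilon$, the time is $\tilde O(\sqrt{nm}/\epsilon)$ and the space is $\tilde O(n/\epsilon)$. -/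

import Mathlib

noncomputable section

namespace ERSketch

/-! ## The vectors that are approximated -/

/-- The transition matrix `P = A D⁻¹` of the simple random walk on `G`. -/
def transition {n : ℕ} (G : SimpleGraph (Fin n)) [DecidableRel G.Adj] :
    Matrix (Fin n) (Fin n) ℝ :=
  G.adjMatrix ℝ * Matrix.diagonal (fun v => ((G.degree v : ℝ))⁻¹)

/-- `p_{L,u} = 1/2 * ∑_{l=0}^{L} (1/2 I + 1/2 P)^l e_u`. -/
def pVec {n : ℕ} (G : SimpleGraph (Fin n)) [DecidableRel G.Adj] (L : ℕ) (u : Fin n) :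
    Fin n → ℝ :=
  (1 / 2 : ℝ) • ∑ l ∈ Finset.range (L + 1),
    Matrix.mulVec (((1 / 2 : ℝ) • (1 : Matrix (Fin n) (Fin n) ℝ)
      + (1 / 2 : ℝ) • transition G) ^ l) (Pi.single u 1)

/-! ## The machine

A unit-cost random access machine with memory cells that hold reals, vertices or natural
numbers, with random draws, and with degree and neighbour queries to the input graph. The cells
are grouped in arrays; the arrays used by the algorithm are listed below. All cells are `0`
at the start. A program is an element of `M n α`. The variables bound in a program are its
registers (a constant number of them). Every memory access, query, random draw, evaluation of a
fixed arithmetic expression, conditional branch and loop iteration costs one step. -/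

/-- Adjacency lists of `G`: the input graph as the queries see it, the order of the neighbours
of a vertex being arbitrary. -/
structure AdjList {n : ℕ} (G : SimpleGraph (Fin n)) where
  nbrs : Fin n → List (Fin n)
  nodup : ∀ v, (nbrs v).Nodup
  mem_iff : ∀ v w, w ∈ nbrs v ↔ G.Adj v w

/-- Cells that hold real numbers. -/
inductive RealCell (n : ℕ)
  /-- `p'_{L,u}(w)` for the current vertex `u` -/
  | visit (w : Fin n)
  /-- `q_{L,v}(w)` for the `j`-th candidate `v` -/
  | approx (j : ℕ) (w : Fin n)
  /-- `r_{i,v}(w)` for the `j`-th candidate `v` -/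
  | resid (j i : ℕ) (w : Fin n)
  /-- output: the approximate value in the `o`-th output entry -/
  | outValue (o : ℕ)
  deriving DecidableEq

/-- Cells that hold vertices. -/
inductive VertCell
  /-- the `t`-th vertex met by the walks of the first stage -/
  | seen (t : ℕ)
  /-- the `j`-th candidate -/
  | cand (j : ℕ)
  /-- the `t`-th vertex that received residual on level `i`, for the `j`-th candidate -/
  | level (j i t : ℕ)
  /-- the vertex of the `t`-th (step, vertex) pair met by the walks of the third stage -/
  | hitVertex (t : ℕ)
  /-- output: the vertex in the `o`-th output entry -/
  | outVertex (o : ℕ)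
  deriving DecidableEq

/-- Cells that hold natural numbers. -/
inductive WordCell (n : ℕ)
  /-- the lengths of the lists `seen`, `cand`, `level j i`, `hit` and of the output -/
  | seenLen
  | candLen
  | levelLen (j i : ℕ)
  | hitLen
  | outLen
  /-- the step of the `t`-th (step, vertex) pair met by the walks of the third stage -/
  | hitStep (t : ℕ)
  /-- `N_{u,w,k}`: how many walks of the third stage are at `w` at step `k` -/
  | count (k : ℕ) (w : Fin n)
  /-- output: the entries `offset u, …, offset (u + 1) - 1` belong to the vertex `u` -/
  | offset (t : ℕ)
  deriving DecidableEq

/-- The configuration of the machine: the memory, the set of the cells that have been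
read or written so far, and the number of steps made so far. -/
structure Config (n : ℕ) where
  real : RealCell n → ℝ
  vert : VertCell → Fin n
  word : WordCell n → ℕ
  used : Finset (RealCell n ⊕ VertCell ⊕ WordCell n)
  time : ℕ

/-- The space used so far: the number of memory cells ever accessed. -/
def Config.space {n : ℕ} (s : Config n) : ℕ := s.used.card

/-- The initial configuration. -/
def Config.init (n : ℕ) [NeZero n] : Config n where
  real := fun _ => 0
  vert := fun _ => 0
  word := fun _ => 0
  used := ∅
  time := 0

/-- Randomized programs: a configuration is mapped to a probability distribution on results
and new configurations. -/
abbrev M (n : ℕ) (α : Type) : Type := StateT (Config n) PMF α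

section Instructions

variable {n : ℕ} {α β : Type}

/-- Charge one step. -/
def tick : M n Unit := fun s => pure ((), { s with time := s.time + 1 })

/-- Evaluate an arithmetic expression in the registers: one step. -/
def arith (x : α) : M n α := do
  tick
  pure x

/-- Conditional branch: one step, and the chosen program. -/
def branch (p : Prop) [Decidable p] (a b : M n α) : M n α := do
  tick
  if p then a else b

/-- A uniform draw from `{0, …, k - 1}`: one step (the result is `0` if `k = 0`). -/
def draw (k : ℕ) : M n ℕ := do
  tick
  match k with
  | 0 => pure 0
  | k + 1 => fun s => (PMF.uniformOfFintype (Fin (k + 1))).bind fun i => pure ((i : ℕ), s)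

/-- Run the body for `i = 0, …, k - 1`, passing on a register: one step per iteration, and
the steps of the body. -/
def loop (k : ℕ) (b : β) (body : ℕ → β → M n β) : M n β :=
  match k with
  | 0 => pure b
  | k + 1 => do
    let c ← loop k b body
    tick
    body k c

def readReal (a : RealCell n) : M n ℝ := do
  tick
  fun s => pure (s.real a, { s with used := insert (Sum.inl a) s.used })

def writeReal (a : RealCell n) (x : ℝ) : M n Unit := do
  tick
  fun s => pure ((), { s with
    real := Function.update s.real a x
    used := insert (Sum.inl a) s.used })

def readVert (a : VertCell) : M n (Fin n) := do
  tick
  fun s => pure (s.vert a, { s with used := insert (Sum.inr (Sum.inl a)) s.used })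

def writeVert (a : VertCell) (x : Fin n) : M n Unit := do
  tick
  fun s => pure ((), { s with
    vert := Function.update s.vert a x
    used := insert (Sum.inr (Sum.inl a)) s.used })

def readWord (a : WordCell n) : M n ℕ := do
  tick
  fun s => pure (s.word a, { s with used := insert (Sum.inr (Sum.inr a)) s.used })

def writeWord (a : WordCell n) (x : ℕ) : M n Unit := do
  tick
  fun s => pure ((), { s with
    word := Function.update s.word a x
    used := insert (Sum.inr (Sum.inr a)) s.used })

/-- Degree query: one step. -/
def deg {G : SimpleGraph (Fin n)} (A : AdjList G) (w : Fin n) : M n ℕ := do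
  tick
  pure (A.nbrs w).length

/-- Neighbour query: one step (the answer is `w` itself if there is no `i`-th neighbour). -/
def neigh {G : SimpleGraph (Fin n)} (A : AdjList G) (w : Fin n) (i : ℕ) : M n (Fin n) := do
  tick
  pure ((A.nbrs w).getD i w)

end Instructions

/-! ## The algorithm -/

section Algorithm

variable {n : ℕ} {G : SimpleGraph (Fin n)}

/-- One step of the lazy random walk from `w`. -/
def lazyStep (A : AdjList G) (w : Fin n) : M n (Fin n) := do
  let b ← draw 2
  branch (b = 1)
    (do
      let d ← deg A w
      let i ← draw d
      neigh A w i)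
    (pure w)

/-- A lazy random walk `v_0 = u, v_1, …, v_L`; the program `visit k v_k` is run for every
`k ≤ L` when the walk arrives at `v_k`. -/
def lazyWalk (A : AdjList G) (L : ℕ) (u : Fin n) (visit : ℕ → Fin n → M n Unit) : M n Unit := do
  let _ ← loop (L + 1) u fun k w => do
    let w' ← branch (k = 0) (pure w) (lazyStep A w)
    visit k w'
    pure w'
  pure ()

/-- First stage: `N` lazy walks from `u`, and the candidates `{w | p'_{L,u}(w) > ε / 2}`. -/
def stageOne (A : AdjList G) (L : ℕ) (ε : ℝ) (u : Fin n) (N : ℕ) : M n Unit := do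
  loop N () fun _ _ =>
    lazyWalk A L u fun _ w => do
      let x ← readReal (.visit w)
      branch (x = 0)
        (do
          let t ← readWord .seenLen
          writeVert (.seen t) w
          writeWord .seenLen (t + 1))
        (pure ())
      let y ← arith (x + 1 / (2 * (N : ℝ)))
      writeReal (.visit w) y
  let l ← readWord .seenLen
  loop l () fun t _ => do
    let w ← readVert (.seen t)
    let x ← readReal (.visit w)
    branch (ε / 2 < x)
      (do
        let j ← readWord .candLen
        writeVert (.cand j) w
        writeWord .candLen (j + 1))
      (pure ())

/-- `r_i(w) ← r_i(w) + y` in the data of the `j`-th candidate. -/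
def addResid (j i : ℕ) (w : Fin n) (y : ℝ) : M n Unit := do
  let x ← readReal (.resid j i w)
  branch (x = 0)
    (do
      let t ← readWord (.levelLen j i)
      writeVert (.level j i t) w
      writeWord (.levelLen j i) (t + 1))
    (pure ())
  let z ← arith (x + y)
  writeReal (.resid j i w) z

/-- Coordinate gradient descent `CGD(G, v, L, R)`, run in the data of the `j`-th candidate.
Residual is only ever added to the next level, so one pass over the list of the vertices
with residual on level `i` finds all `w` with `r_i(w) > R / L² * d_w`. -/
def cgd (A : AdjList G) (L : ℕ) (R : ℝ) (j : ℕ) (v : Fin n) : M n Unit := do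
  addResid j 0 v (1 / 2)
  loop (L + 1) () fun i _ => do
    let l ← readWord (.levelLen j i)
    loop l () fun t _ => do
      let w ← readVert (.level j i t)
      let x ← readReal (.resid j i w)
      let d ← deg A w
      branch (R / (L : ℝ) ^ 2 * (d : ℝ) < x)
        (do
          let q ← readReal (.approx j w)
          writeReal (.approx j w) (q + x)
          loop d () fun s _ => do
            let z ← neigh A w s
            let y ← arith (1 / (2 * (d : ℝ)) * x)
            addResid j (i + 1) z y
          let y ← arith (1 / 2 * x)
          addResid j (i + 1) w y
          writeReal (.resid j i w) 0)
        (pure ())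

/-- Second stage: `CGD` from every candidate `v`, with threshold `rmax / (2 p'_{L,u}(v))`. -/
def stageTwo (A : AdjList G) (L : ℕ) (rmax : ℝ) : M n Unit := do
  let c ← readWord .candLen
  loop c () fun j _ => do
    let v ← readVert (.cand j)
    let x ← readReal (.visit v)
    let R ← arith (rmax / (2 * x))
    cgd A L R j v

/-- Third stage: `N` lazy walks from `u`, shared by all candidates. -/
def stageThree (A : AdjList G) (L : ℕ) (u : Fin n) (N : ℕ) : M n Unit :=
  loop N () fun _ _ =>
    lazyWalk A L u fun k w => do
      let x ← readWord (.count k w)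
      branch (x = 0)
        (do
          let t ← readWord .hitLen
          writeWord (.hitStep t) k
          writeVert (.hitVertex t) w
          writeWord .hitLen (t + 1))
        (pure ())
      writeWord (.count k w) (x + 1)

/-- The sum of `r_{i,v}(w) / d_w * N_{u,w,k}` over all `w` and all `i + k ≤ L`, where `v` is the
`j`-th candidate. -/
def residSum (A : AdjList G) (L : ℕ) (j : ℕ) : M n ℝ :=
  loop (L + 1) (0 : ℝ) fun i a => do
    let l ← readWord (.levelLen j i)
    loop l a fun t a => do
      let w ← readVert (.level j i t)
      let x ← readReal (.resid j i w)
      let d ← deg A w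
      loop (L + 1 - i) a fun k a => do
        let y ← readWord (.count k w)
        arith (a + x / (d : ℝ) * (y : ℝ))

/-- Append the entries `(v, p̂_{L,u}(v))`, for all candidates `v` with `d_v ≤ d_u`, to the
output. -/
def combine (A : AdjList G) (L : ℕ) (u : Fin n) (N : ℕ) : M n Unit := do
  let du ← deg A u
  let c ← readWord .candLen
  loop c () fun j _ => do
    let v ← readVert (.cand j)
    let dv ← deg A v
    branch (dv ≤ du)
      (do
        let a ← residSum A L j
        let q ← readReal (.approx j u)
        let x ← arith (q * (dv : ℝ) / (du : ℝ) + (dv : ℝ) / (N : ℝ) * a)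
        let o ← readWord .outLen
        writeVert (.outVertex o) v
        writeReal (.outValue o) x
        writeWord .outLen (o + 1))
      (pure ())

/-- Reset the working memory to `0` before the next vertex is treated. -/
def cleanUp (n L : ℕ) : M n Unit := do
  let l ← readWord .seenLen
  loop l () fun t _ => do
    let w ← readVert (.seen t)
    writeReal (.visit w) 0
  writeWord .seenLen 0
  let h ← readWord .hitLen
  loop h () fun t _ => do
    let k ← readWord (.hitStep t)
    let w ← readVert (.hitVertex t)
    writeWord (.count k w) 0
  writeWord .hitLen 0
  let c ← readWord .candLen
  loop c () fun j _ =>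
    loop (L + 2) () fun i _ => do
      let l ← readWord (.levelLen j i)
      loop l () fun t _ => do
        let w ← readVert (.level j i t)
        writeReal (.resid j i w) 0
        writeReal (.approx j w) 0
      writeWord (.levelLen j i) 0
  writeWord .candLen 0

/-- The algorithm that builds the index. The numbers of walks of the first and third stage are
`K L² log n / ε` and `K L r_max d_u log n / ε²`, rounded up, with `r_max = L ε √(n / m)`. The
number `m` of edges is computed from the degrees. -/
def buildIndex [NeZero n] (A : AdjList G) (L : ℕ) (K ε : ℝ) : M n Unit := do
  let e ← loop n 0 fun t e => do
    let d ← deg A (Fin.ofNat n t)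
    arith (e + d)
  let m ← arith ((e : ℝ) / 2)
  loop n () fun t _ => do
    let u ← arith (Fin.ofNat n t)
    let N₁ ← arith ⌈K * (L : ℝ) ^ 2 * Real.log (n : ℝ) / ε⌉₊
    stageOne A L ε u N₁
    let rmax ← arith ((L : ℝ) * ε * Real.sqrt ((n : ℝ) / m))
    stageTwo A L rmax
    let du ← deg A u
    let N₃ ← arith ⌈K * (L : ℝ) / ε ^ 2 * rmax * (du : ℝ) * Real.log (n : ℝ)⌉₊
    stageThree A L u N₃
    combine A L u N₃
    let o ← readWord .outLen
    writeWord (.offset (t + 1)) o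
    cleanUp n L

/-- The distribution of the final configuration. -/
def run [NeZero n] (A : AdjList G) (L : ℕ) (K ε : ℝ) : PMF (Config n) :=
  (buildIndex A L K ε (Config.init n)).map Prod.snd

end Algorithm

/-- The output read off the memory: `p̂_{L,u}(v)` is the value stored for `v` among the entries
of `u`, and `0` if there is none. -/
def Config.pHat {n : ℕ} (s : Config n) (u v : Fin n) : ℝ :=
  ∑ o ∈ Finset.Ico (s.word (.offset (u : ℕ))) (s.word (.offset ((u : ℕ) + 1))),
    if s.vert (.outVertex o) = v then s.real (.outValue o) else 0

end ERSketch

end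

/-! Fix u and put W = I/2 + P/2. The accuracy rests on one conserved quantity of the descent. Let
h_i(w) = (1/d_w) ∑_{k ≤ L-i} (W^k)(w,u). Splitting off the term k = 0 and using reversibility,
W(w,z)/d_w = W(z,w)/d_z, gives h_i(w) = 1_{w=u}/d_u + ∑_z W(z,w) h_{i+1}(z) (`harmonic_potential`).
Relaxing w on level i adds x to q_v(w) and distributes x along column w of W over level i+1, so
q_v(u)/d_u + ∑_i ∑_w r_{i,v}(w) h_i(w) keeps its initial value p_{L,u}(v)/d_v (`conserve_push`).
Hence p_{L,u}(v) = q_v(u) d_v/d_u + d_v μ, where μ is the expected total weight ∑_k ∑_{i ≤ L-k}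
r_{i,v}(w_k)/d_{w_k} along a lazy walk from u (`CgdInv.pVec_eq`). The third stage estimates d_v μ by
an average over walks.

After the descent all residuals on levels up to L are at most R d_w/L², so a walk contributes
between 0 and 4R = 2 r_max/p'_u(v) (`weight_le`). Moreover d_v μ ≤ p_{L,u}(v) ≤ 2p'_u(v) for all
candidates, provided that the first stage was good. Range and mean compensate each other: a
Bernstein bound gives failure probability exp(-n_3 ε²/(16 r_max d_v)) per tail, free of p'
(`tail_exponent_le`), and n_3 makes this small because d_v ≤ d_u. The first stage is good by a lower
Chernoff tail: every v with p_{L,u}(v) > ε gets p'_u(v) > p_{L,u}(v)/2. So vertices that are not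
candidates have p_{L,u}(v) ≤ ε, and the answer 0 is accurate for them (`Ready.answer_accurate`). A
union bound over u and v finishes.

Independence is never formalized. On the range of an additive functional the exponential lies below
its chord, which is affine, so its expectation along one walk is computed with the powers of W
(`wp_lazyWalk_exp_le`). Each further walk, whatever the state it starts from, multiplies the
exponential moment by at most a fixed factor (`wp_walks_exp_le`).

The costs are deterministic. The visits of the first stage have total mass (L+1)/2, so there are at
most (L+1)/ε candidates (`candidates_le`). Each relaxation of w takes more than R d_w/L² from a
level of mass at most 1/2, so the degrees relaxed on a level sum to at most L²/(2R) = L²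
p'_u(v)/r_max; summed over the candidates this is at most L²(L+1)/(2 r_max) (`Ready.cost_le`). The
value of r_max balances n/r_max against the order r_max m/ε² of the third stage: both are √(nm)/ε up
to powers of L (`total_cost_le`).

For the machine, `Sat` is a Hoare logic over all outcomes and `wp` computes expectations. Every
round returns to an empty working memory and only appends to the output, so rounds compose
(`sat_finish`). -/

noncomputable section

namespace ERSketch

open scoped ENNReal

/-! ## Program logic -/

section Logic

variable {n : ℕ} {α β : Type}

/-- All memory cells. -/
abbrev Cell (n : ℕ) : Type := RealCell n ⊕ VertCell ⊕ WordCell n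

namespace Config

/-- Let one unit of time pass. -/
def step (s : Config n) : Config n := { s with time := s.time + 1 }

/-- Replace the clock. -/
def setTime (s : Config n) (t : ℕ) : Config n := { s with time := t }

/-- Access a cell without changing it. -/
def touch (s : Config n) (a : Cell n) : Config n :=
  { s with used := insert a s.used, time := s.time + 1 }

/-- Store a real number. -/
def setReal (s : Config n) (a : RealCell n) (x : ℝ) : Config n :=
  { s with
    real := Function.update s.real a x
    used := insert (Sum.inl a) s.used
    time := s.time + 1 }

/-- Store a vertex. -/
def setVert (s : Config n) (a : VertCell) (x : Fin n) : Config n :=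
  { s with
    vert := Function.update s.vert a x
    used := insert (Sum.inr (Sum.inl a)) s.used
    time := s.time + 1 }

/-- Store a natural number. -/
def setWord (s : Config n) (a : WordCell n) (x : ℕ) : Config n :=
  { s with
    word := Function.update s.word a x
    used := insert (Sum.inr (Sum.inr a)) s.used
    time := s.time + 1 }

section Projections

variable (s : Config n) (a : Cell n) (b : RealCell n) (c : VertCell) (d : WordCell n)
  (x : ℝ) (v : Fin n) (k : ℕ)

@[simp] theorem step_real : s.step.real = s.real := rfl
@[simp] theorem step_vert : s.step.vert = s.vert := rfl
@[simp] theorem step_word : s.step.word = s.word := rfl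
@[simp] theorem step_used : s.step.used = s.used := rfl
@[simp] theorem step_time : s.step.time = s.time + 1 := rfl
@[simp] theorem touch_real : (s.touch a).real = s.real := rfl
@[simp] theorem touch_vert : (s.touch a).vert = s.vert := rfl
@[simp] theorem touch_word : (s.touch a).word = s.word := rfl
@[simp] theorem touch_used : (s.touch a).used = insert a s.used := rfl
@[simp] theorem touch_time : (s.touch a).time = s.time + 1 := rfl
@[simp] theorem setReal_real : (s.setReal b x).real = Function.update s.real b x := rfl
@[simp] theorem setReal_vert : (s.setReal b x).vert = s.vert := rfl
@[simp] theorem setReal_word : (s.setReal b x).word = s.word := rfl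
@[simp] theorem setReal_used : (s.setReal b x).used = insert (Sum.inl b) s.used := rfl
@[simp] theorem setReal_time : (s.setReal b x).time = s.time + 1 := rfl
@[simp] theorem setVert_real : (s.setVert c v).real = s.real := rfl
@[simp] theorem setVert_vert : (s.setVert c v).vert = Function.update s.vert c v := rfl
@[simp] theorem setVert_word : (s.setVert c v).word = s.word := rfl
@[simp] theorem setVert_used : (s.setVert c v).used = insert (Sum.inr (Sum.inl c)) s.used := rfl
@[simp] theorem setVert_time : (s.setVert c v).time = s.time + 1 := rfl
@[simp] theorem setWord_real : (s.setWord d k).real = s.real := rfl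
@[simp] theorem setWord_vert : (s.setWord d k).vert = s.vert := rfl
@[simp] theorem setWord_word : (s.setWord d k).word = Function.update s.word d k := rfl
@[simp] theorem setWord_used : (s.setWord d k).used = insert (Sum.inr (Sum.inr d)) s.used := rfl
@[simp] theorem setWord_time : (s.setWord d k).time = s.time + 1 := rfl

end Projections

end Config

/-- Every possible outcome of `m` from `s` satisfies `Q`. -/
def Sat (m : M n α) (s : Config n) (Q : α → Config n → Prop) : Prop :=
  ∀ x ∈ (m s).support, Q x.1 x.2

theorem bind_run (m : M n α) (k : α → M n β) (s : Config n) :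
    (m >>= k) s = (m s).bind fun x => k x.1 x.2 := rfl

@[simp] theorem sat_pure (a : α) (s : Config n) (Q : α → Config n → Prop) :
    Sat (pure a : M n α) s Q ↔ Q a s := by
  have h : (pure a : M n α) s = PMF.pure (a, s) := rfl
  simp [Sat, h]

-- Together with the rules for single instructions, this lets `simp` turn `Sat` of a straight-line
-- program into a statement about an explicit final configuration.
@[simp] theorem sat_bind (m : M n α) (k : α → M n β) (s : Config n)
    (Q : β → Config n → Prop) :
    Sat (m >>= k) s Q ↔ Sat m s fun a s' => Sat (k a) s' Q := by
  unfold Sat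
  rw [bind_run]
  simp only [PMF.mem_support_bind_iff]
  exact ⟨fun h x hx y hy => h y ⟨x, hx, hy⟩, fun h y ⟨x, hx, hy⟩ => h x hx y hy⟩

theorem Sat.mono {m : M n α} {s : Config n} {Q Q' : α → Config n → Prop} (h : Sat m s Q)
    (hQ : ∀ a s', Q a s' → Q' a s') : Sat m s Q' :=
  fun x hx => hQ _ _ (h x hx)

theorem sat_det {m : M n α} {s s' : Config n} {a : α} (h : m s = PMF.pure (a, s'))
    (Q : α → Config n → Prop) : Sat m s Q ↔ Q a s' := by
  simp [Sat, h]

theorem tick_bind_run (m : Unit → M n α) (s : Config n) : (tick >>= m) s = m () s.step := by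
  rw [bind_run]
  exact PMF.pure_bind ((), s.step) _

@[simp] theorem sat_tick (s : Config n) (Q : Unit → Config n → Prop) :
    Sat tick s Q ↔ Q () s.step := sat_det (s' := s.step) rfl Q

@[simp] theorem sat_arith (x : α) (s : Config n) (Q : α → Config n → Prop) :
    Sat (arith x) s Q ↔ Q x s.step := sat_det (tick_bind_run _ s) Q

@[simp] theorem sat_branch (p : Prop) [Decidable p] (a b : M n α) (s : Config n)
    (Q : α → Config n → Prop) :
    Sat (branch p a b) s Q ↔ if p then Sat a s.step Q else Sat b s.step Q := by
  unfold branch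
  simp only [sat_bind, sat_tick]
  split_ifs <;> rfl

@[simp] theorem sat_readReal (a : RealCell n) (s : Config n) (Q : ℝ → Config n → Prop) :
    Sat (readReal a) s Q ↔ Q (s.real a) (s.touch (Sum.inl a)) :=
  sat_det (tick_bind_run _ s) Q

@[simp] theorem sat_readVert (a : VertCell) (s : Config n) (Q : Fin n → Config n → Prop) :
    Sat (readVert a) s Q ↔ Q (s.vert a) (s.touch (Sum.inr (Sum.inl a))) :=
  sat_det (tick_bind_run _ s) Q

@[simp] theorem sat_readWord (a : WordCell n) (s : Config n) (Q : ℕ → Config n → Prop) :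
    Sat (readWord a) s Q ↔ Q (s.word a) (s.touch (Sum.inr (Sum.inr a))) :=
  sat_det (tick_bind_run _ s) Q

@[simp] theorem sat_writeReal (a : RealCell n) (x : ℝ) (s : Config n)
    (Q : Unit → Config n → Prop) : Sat (writeReal a x) s Q ↔ Q () (s.setReal a x) :=
  sat_det (tick_bind_run _ s) Q

@[simp] theorem sat_writeVert (a : VertCell) (x : Fin n) (s : Config n)
    (Q : Unit → Config n → Prop) : Sat (writeVert a x) s Q ↔ Q () (s.setVert a x) :=
  sat_det (tick_bind_run _ s) Q

@[simp] theorem sat_writeWord (a : WordCell n) (x : ℕ) (s : Config n)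
    (Q : Unit → Config n → Prop) : Sat (writeWord a x) s Q ↔ Q () (s.setWord a x) :=
  sat_det (tick_bind_run _ s) Q

@[simp] theorem sat_deg {G : SimpleGraph (Fin n)} (A : AdjList G) (w : Fin n) (s : Config n)
    (Q : ℕ → Config n → Prop) : Sat (deg A w) s Q ↔ Q (A.nbrs w).length s.step :=
  sat_det (tick_bind_run _ s) Q

@[simp] theorem sat_neigh {G : SimpleGraph (Fin n)} (A : AdjList G) (w : Fin n) (i : ℕ)
    (s : Config n) (Q : Fin n → Config n → Prop) :
    Sat (neigh A w i) s Q ↔ Q ((A.nbrs w).getD i w) s.step :=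
  sat_det (tick_bind_run _ s) Q

/-- The hypothesis covers all `i`, not only `i < k`: the bounds on time and memory hold for every
continuation, so the range of a draw is not needed for them. -/
theorem sat_draw (k : ℕ) (s : Config n) (Q : ℕ → Config n → Prop) (h : ∀ i, Q i s.step) :
    Sat (draw k) s Q := by
  unfold draw
  rw [sat_bind, sat_tick]
  match k with
  | 0 => exact (sat_pure _ _ _).2 (h 0)
  | k + 1 =>
    intro x hx
    simp only [PMF.mem_support_bind_iff] at hx
    obtain ⟨i, -, hi⟩ := hx
    rw [show x = ((i : ℕ), s.step) from by simpa [pure] using hi]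
    exact h _

/-- The body is entered in `s.step` because every iteration costs one step. -/
theorem sat_loop {k : ℕ} {b : β} {body : ℕ → β → M n β} {s : Config n}
    (I : ℕ → β → Config n → Prop) (h0 : I 0 b s)
    (hstep : ∀ i < k, ∀ c s, I i c s → Sat (body i c) s.step (I (i + 1))) :
    Sat (loop k b body) s (I k) := by
  induction k with
  | zero => simpa [loop] using h0
  | succ k ih =>
    unfold loop
    simp only [sat_bind, sat_tick]
    exact (ih fun i hi => hstep i (by omega)).mono fun c s' h => hstep k (by omega) c s' h

/-- The expectation of `Q` after running `m` from `s`. -/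
def wp (m : M n α) (Q : α → Config n → ℝ≥0∞) (s : Config n) : ℝ≥0∞ :=
  ∑' x, m s x * Q x.1 x.2

/-- Law of total expectation; in `ℝ≥0∞` the sums can be exchanged without a summability condition.
-/
theorem wp_bind (m : M n α) (k : α → M n β) (Q : β → Config n → ℝ≥0∞) (s : Config n) :
    wp (m >>= k) Q s = wp m (fun a s' => wp (k a) Q s') s := by
  unfold wp
  simp only [bind_run, PMF.bind_apply, ← ENNReal.tsum_mul_right, ← ENNReal.tsum_mul_left]
  rw [ENNReal.tsum_comm]
  simp only [mul_assoc]

theorem wp_det {m : M n α} {s s' : Config n} {a : α} (h : m s = PMF.pure (a, s'))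
    (Q : α → Config n → ℝ≥0∞) : wp m Q s = Q a s' := by
  unfold wp
  rw [h, tsum_eq_single (a, s')]
  · simp
  · intro x hx
    simp [PMF.pure_apply, hx]

theorem wp_pure (a : α) (Q : α → Config n → ℝ≥0∞) (s : Config n) :
    wp (pure a : M n α) Q s = Q a s := wp_det rfl Q

theorem wp_tick (Q : Unit → Config n → ℝ≥0∞) (s : Config n) : wp tick Q s = Q () s.step :=
  wp_det (s' := s.step) rfl Q

theorem wp_arith (x : α) (Q : α → Config n → ℝ≥0∞) (s : Config n) :
    wp (arith x) Q s = Q x s.step := wp_det (tick_bind_run _ s) Q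

theorem wp_deg {G : SimpleGraph (Fin n)} (A : AdjList G) (w : Fin n)
    (Q : ℕ → Config n → ℝ≥0∞) (s : Config n) : wp (deg A w) Q s = Q (A.nbrs w).length s.step :=
  wp_det (tick_bind_run _ s) Q

theorem wp_neigh {G : SimpleGraph (Fin n)} (A : AdjList G) (w : Fin n) (i : ℕ)
    (Q : Fin n → Config n → ℝ≥0∞) (s : Config n) :
    wp (neigh A w i) Q s = Q ((A.nbrs w).getD i w) s.step :=
  wp_det (tick_bind_run _ s) Q

theorem wp_branch (p : Prop) [Decidable p] (a b : M n α) (Q : α → Config n → ℝ≥0∞)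
    (s : Config n) : wp (branch p a b) Q s = if p then wp a Q s.step else wp b Q s.step := by
  unfold branch
  rw [wp_bind, wp_tick]
  split_ifs <;> rfl

theorem wp_draw (k : ℕ) (hk : 0 < k) (Q : ℕ → Config n → ℝ≥0∞) (s : Config n) :
    wp (draw k) Q s = ∑ i ∈ Finset.range k, (k : ℝ≥0∞)⁻¹ * Q i s.step := by
  obtain ⟨k, rfl⟩ : ∃ l, k = l + 1 := ⟨k - 1, by omega⟩
  unfold draw
  rw [wp_bind, wp_tick]
  unfold wp
  simp only [PMF.bind_apply, ← ENNReal.tsum_mul_right]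
  rw [ENNReal.tsum_comm, tsum_fintype, Finset.sum_range]
  refine Finset.sum_congr rfl fun i _ => ?_
  rw [tsum_eq_single ((i : ℕ), s.step)]
  · simp [pure]
  · intro x hx
    simp [pure, PMF.pure_apply, hx]

/-- Outcomes outside the support have weight zero. Through this lemma the invariants proved with
`Sat` enter the estimates of expectations. -/
theorem wp_mono_of_sat {m : M n α} {s : Config n} {P : α → Config n → Prop}
    {Q Q' : α → Config n → ℝ≥0∞} (h : Sat m s P) (hQ : ∀ a s', P a s' → Q a s' ≤ Q' a s') :
    wp m Q s ≤ wp m Q' s := by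
  refine ENNReal.tsum_le_tsum fun x => ?_
  by_cases hx : x ∈ (m s).support
  · exact mul_le_mul_right (hQ _ _ (h x hx)) _
  · rw [PMF.mem_support_iff, not_not] at hx
    simp [hx]

theorem wp_mono {m : M n α} {s : Config n} {Q Q' : α → Config n → ℝ≥0∞}
    (hQ : ∀ a s', Q a s' ≤ Q' a s') : wp m Q s ≤ wp m Q' s :=
  wp_mono_of_sat (P := fun _ _ => True) (fun _ _ => trivial) fun a s' _ => hQ a s'

theorem wp_const (m : M n α) (s : Config n) (c : ℝ≥0∞) : wp m (fun _ _ => c) s = c := by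
  unfold wp
  rw [ENNReal.tsum_mul_right, PMF.tsum_coe, one_mul]

theorem wp_le_of_sat {m : M n α} {s : Config n} {Q : α → Config n → ℝ≥0∞} {c : ℝ≥0∞}
    (h : Sat m s fun a s' => Q a s' ≤ c) : wp m Q s ≤ c :=
  (wp_mono_of_sat (Q' := fun _ _ => c) h fun _ _ h => h).trans_eq (wp_const m s c)

theorem wp_const_mul (m : M n α) (s : Config n) (c : ℝ≥0∞) (Q : α → Config n → ℝ≥0∞) :
    wp m (fun a s' => c * Q a s') s = c * wp m Q s := by
  unfold wp
  simp only [← ENNReal.tsum_mul_left, mul_left_comm]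

theorem wp_add (m : M n α) (s : Config n) (Q Q' : α → Config n → ℝ≥0∞) :
    wp m (fun a s' => Q a s' + Q' a s') s = wp m Q s + wp m Q' s := by
  unfold wp
  simp only [mul_add, ENNReal.tsum_add]

theorem wp_sum {ι : Type*} (I : Finset ι) (m : M n α) (s : Config n)
    (Q : ι → α → Config n → ℝ≥0∞) :
    wp m (fun a s' => ∑ i ∈ I, Q i a s') s = ∑ i ∈ I, wp m (Q i) s := by
  classical
  induction I using Finset.induction_on with
  | empty => simpa using wp_const m s 0
  | insert i I hi ih => simp only [Finset.sum_insert hi, wp_add, ih]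

end Logic

end ERSketch

end

noncomputable section

namespace ERSketch

open scoped ENNReal

/-! ## Lazy random walks -/

section Walks

variable {n : ℕ} {G : SimpleGraph (Fin n)}

/-! ### Adjacency lists and the matrix of the lazy walk. -/

theorem AdjList.toFinset_nbrs [DecidableRel G.Adj] (A : AdjList G) (w : Fin n) :
    (A.nbrs w).toFinset = G.neighborFinset w := by
  ext z
  simp [A.mem_iff]

theorem AdjList.length_nbrs [DecidableRel G.Adj] (A : AdjList G) (w : Fin n) :
    (A.nbrs w).length = G.degree w := by
  rw [← G.card_neighborFinset_eq_degree, ← A.toFinset_nbrs,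
    List.toFinset_card_of_nodup (A.nodup w)]

/-- The list has no duplicates, so a uniform index is a uniform neighbour; the default `w` does not
occur at these indices. -/
theorem AdjList.sum_getD [DecidableRel G.Adj] (A : AdjList G) (w : Fin n) (φ : Fin n → ℝ) :
    ∑ i ∈ Finset.range (A.nbrs w).length, φ ((A.nbrs w).getD i w)
      = ∑ z ∈ G.neighborFinset w, φ z := by
  rw [← A.toFinset_nbrs, List.sum_toFinset _ (A.nodup w), Finset.sum_range,
    ← Fin.sum_univ_fun_getElem]
  simp

/-- The transition matrix of the lazy random walk. -/
def lazyMatrix (G : SimpleGraph (Fin n)) [DecidableRel G.Adj] : Matrix (Fin n) (Fin n) ℝ :=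
  (1 / 2 : ℝ) • (1 : Matrix (Fin n) (Fin n) ℝ) + (1 / 2 : ℝ) • transition G

variable [DecidableRel G.Adj]

theorem lazyMatrix_apply (z w : Fin n) :
    lazyMatrix G z w = (if z = w then 1 / 2 else 0)
      + if G.Adj z w then 1 / 2 * (G.degree w : ℝ)⁻¹ else 0 := by
  unfold lazyMatrix transition
  rw [Matrix.add_apply, Matrix.smul_apply, Matrix.smul_apply, Matrix.mul_diagonal,
    Matrix.one_apply, SimpleGraph.adjMatrix_apply]
  split_ifs <;> simp

theorem lazyMatrix_nonneg (z w : Fin n) : 0 ≤ lazyMatrix G z w := by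
  rw [lazyMatrix_apply]
  split_ifs <;> positivity

theorem lazyMatrix_pow_nonneg (k : ℕ) (z w : Fin n) : 0 ≤ (lazyMatrix G ^ k) z w := by
  induction k generalizing z w with
  | zero =>
    rw [pow_zero, Matrix.one_apply]
    split_ifs <;> simp
  | succ k ih =>
    rw [pow_succ, Matrix.mul_apply]
    exact Finset.sum_nonneg fun i _ => mul_nonneg (ih z i) (lazyMatrix_nonneg i w)

/-- Column `w` is the law of one lazy step from `w`. The right side is the form in which both the
walk and the spreading of residual produce it. -/
theorem sum_lazyMatrix_mul (w : Fin n) (φ : Fin n → ℝ) :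
    ∑ z, lazyMatrix G z w * φ z
      = 1 / 2 * φ w + 1 / 2 * (G.degree w : ℝ)⁻¹ * ∑ z ∈ G.neighborFinset w, φ z := by
  simp only [lazyMatrix_apply, add_mul, Finset.sum_add_distrib, ite_mul, zero_mul,
    Finset.sum_ite_eq', Finset.mem_univ, if_true, Finset.mul_sum]
  congr 1
  rw [← Finset.sum_filter]
  refine Finset.sum_congr ?_ fun _ _ => rfl
  ext z
  simp [G.adj_comm]

theorem sum_lazyMatrix (w : Fin n) (hw : 0 < G.degree w) : ∑ z, lazyMatrix G z w = 1 := by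
  have h := sum_lazyMatrix_mul (G := G) w fun _ => 1
  have hd : (G.degree w : ℝ) ≠ 0 := by positivity
  simp only [mul_one, Finset.sum_const, G.card_neighborFinset_eq_degree, nsmul_eq_mul] at h
  rw [h]
  field_simp
  norm_num

/-- A function of the position after `k + 1` steps is pulled back to a function of the position
after `k` steps. -/
theorem sum_mul_lazyMatrix_pow_succ (k : ℕ) (u : Fin n) (φ : Fin n → ℝ) :
    ∑ w, (∑ z, lazyMatrix G z w * φ z) * (lazyMatrix G ^ k) w u
      = ∑ z, φ z * (lazyMatrix G ^ (k + 1)) z u := by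
  simp only [pow_succ', Matrix.mul_apply, Finset.sum_mul, Finset.mul_sum]
  rw [Finset.sum_comm]
  exact Finset.sum_congr rfl fun _ _ => Finset.sum_congr rfl fun _ _ => by ring

theorem sum_lazyMatrix_pow (hG : ∀ v, 0 < G.degree v) (k : ℕ) (u : Fin n) :
    ∑ w, (lazyMatrix G ^ k) w u = 1 := by
  induction k with
  | zero => simp [Matrix.one_apply]
  | succ k ih =>
    have h := sum_mul_lazyMatrix_pow_succ (G := G) k u fun _ => 1
    simp only [mul_one, one_mul, fun w => sum_lazyMatrix w (hG w)] at h
    rw [← h, ih]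

omit [DecidableRel G.Adj] in
-- Nothing is claimed about the vertex reached. Only the clock changes, by at most two draws, a
-- branch, a degree query and a neighbour query.
theorem sat_lazyStep (A : AdjList G) (w : Fin n) (s : Config n) (Q : Fin n → Config n → Prop)
    (hQ : ∀ z t, t ≤ s.time + 5 → Q z (s.setTime t)) : Sat (lazyStep A w) s Q := by
  unfold lazyStep
  rw [sat_bind]
  refine sat_draw _ _ _ fun i => ?_
  rw [sat_branch]
  split_ifs
  · rw [sat_bind, sat_deg, sat_bind]
    refine sat_draw _ _ _ fun j => ?_
    rw [sat_neigh]
    exact hQ _ (s.time + 5) le_rfl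
  · rw [sat_pure]
    exact hQ _ (s.time + 2) (by omega)

/-- The bound `hQ` is required for every clock value because staying and moving take different
times. -/
theorem wp_lazyStep_le (A : AdjList G) (w : Fin n) (hw : 0 < G.degree w) (s : Config n)
    (Q : Fin n → Config n → ℝ≥0∞) (φ : Fin n → ℝ) (hφ : ∀ z, 0 ≤ φ z)
    (hQ : ∀ z t, Q z (s.setTime t) ≤ ENNReal.ofReal (φ z)) :
    wp (lazyStep A w) Q s ≤ ENNReal.ofReal (∑ z, lazyMatrix G z w * φ z) := by
  have hl : 0 < (A.nbrs w).length := by rwa [A.length_nbrs]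
  have half : ((2 : ℕ) : ℝ≥0∞)⁻¹ = ENNReal.ofReal (1 / 2) := by
    rw [one_div, ENNReal.ofReal_inv_of_pos (by norm_num)]
    norm_num
  have hinv : ((G.degree w : ℕ) : ℝ≥0∞)⁻¹ = ENNReal.ofReal (G.degree w : ℝ)⁻¹ := by
    rw [ENNReal.ofReal_inv_of_pos (by positivity), ENNReal.ofReal_natCast]
  unfold lazyStep
  rw [wp_bind, wp_draw 2 two_pos, Finset.sum_range_succ, Finset.sum_range_one]
  rw [wp_branch, if_neg (by norm_num), wp_pure, wp_branch, if_pos rfl, wp_bind, wp_deg, wp_bind,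
    wp_draw _ hl]
  simp only [wp_neigh]
  rw [sum_lazyMatrix_mul, ← A.sum_getD, mul_assoc, ENNReal.ofReal_add (by have := hφ w; positivity)
    (by have := Finset.sum_nonneg (s := Finset.range (A.nbrs w).length)
          fun i _ => hφ ((A.nbrs w).getD i w)
        positivity),
    ENNReal.ofReal_mul (by norm_num), ENNReal.ofReal_mul (by norm_num),
    ENNReal.ofReal_mul (by positivity), half, A.length_nbrs, hinv,
    ENNReal.ofReal_sum_of_nonneg fun i _ => hφ _, Finset.mul_sum, Finset.mul_sum,
    Finset.mul_sum]
  gcongr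
  · exact hQ w (s.time + 2)
  · exact hQ _ (s.time + 5)

/-- The loop body of `lazyWalk`. -/
def walkBody (A : AdjList G) (visit : ℕ → Fin n → M n Unit) (k : ℕ) (w : Fin n) :
    M n (Fin n) := do
  let w' ← branch (k = 0) (pure w) (lazyStep A w)
  visit k w'
  pure w'

omit [DecidableRel G.Adj] in
theorem lazyWalk_eq (A : AdjList G) (L : ℕ) (u : Fin n) (visit : ℕ → Fin n → M n Unit) :
    lazyWalk A L u visit = loop (L + 1) u (walkBody A visit) >>= fun _ => pure () := rfl

omit [DecidableRel G.Adj] in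
-- The 7 steps are the loop iteration, the branch and at most five for `lazyStep`.
theorem sat_walkBody (A : AdjList G) (visit : ℕ → Fin n → M n Unit) (k : ℕ) (w : Fin n)
    (s : Config n) (Q : Config n → Prop)
    (h : ∀ z t, t ≤ s.time + 7 → Sat (visit k z) (s.setTime t) fun _ => Q) :
    Sat (walkBody A visit k w) s.step fun _ => Q := by
  have key : ∀ z t, t ≤ s.time + 7 → Sat (visit k z >>= fun _ => pure z) (s.setTime t)
      fun _ => Q := by
    intro z t ht
    rw [sat_bind]
    refine (h z t ht).mono fun _ s'' h => ?_
    rwa [sat_pure]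
  unfold walkBody
  rw [sat_bind, sat_branch]
  split_ifs
  · rw [sat_pure]
    exact key _ (s.time + 2) (by omega)
  · refine sat_lazyStep _ _ _ _ fun z t ht => key z t ?_
    simpa [add_assoc] using ht

omit [DecidableRel G.Adj] in
theorem sat_walkLoop (A : AdjList G) (L : ℕ) (u : Fin n) (visit : ℕ → Fin n → M n Unit)
    (I : ℕ → Config n → Prop) (hI : ∀ k s t, I k s → I k (s.setTime t))
    (hv : ∀ k ≤ L, ∀ w s, I k s → Sat (visit k w) s fun _ s' => I (k + 1) s')
    (s : Config n) (h0 : I 0 s) (l : ℕ) (hl : l ≤ L + 1) :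
    Sat (loop l u (walkBody A visit)) s fun _ s' => I l s' :=
  sat_loop (fun k _ s' => I k s') h0 fun k hk _ _ hs' => sat_walkBody _ _ _ _ _ _ fun z t _ =>
    hv k (by omega) z _ (hI _ _ t hs')

omit [DecidableRel G.Adj] in
theorem sat_lazyWalk (A : AdjList G) (L : ℕ) (u : Fin n) (visit : ℕ → Fin n → M n Unit)
    (I : ℕ → Config n → Prop) (hI : ∀ k s t, I k s → I k (s.setTime t))
    (hv : ∀ k ≤ L, ∀ w s, I k s → Sat (visit k w) s fun _ s' => I (k + 1) s')
    (s : Config n) (h0 : I 0 s) :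
    Sat (lazyWalk A L u visit) s fun _ s' => I (L + 1) s' := by
  rw [lazyWalk_eq, sat_bind]
  exact (sat_walkLoop A L u visit I hI hv s h0 (L + 1) le_rfl).mono fun _ s' h => by
    rwa [sat_pure]

omit [DecidableRel G.Adj] in
theorem sat_lazyWalk_time (A : AdjList G) (L : ℕ) (u : Fin n) (visit : ℕ → Fin n → M n Unit)
    (I : ℕ → Config n → Prop) (hI : ∀ k s t, I k s → I k (s.setTime t)) (a : ℕ)
    (hv : ∀ k ≤ L, ∀ w s, I k s →
      Sat (visit k w) s fun _ s' => s'.time ≤ s.time + a ∧ I (k + 1) s')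
    (s : Config n) (h0 : I 0 s) :
    Sat (lazyWalk A L u visit) s fun _ s' => s'.time ≤ s.time + (L + 1) * (a + 7) ∧
      I (L + 1) s' := by
  rw [lazyWalk_eq, sat_bind]
  refine (sat_loop (fun k _ s' => s'.time ≤ s.time + k * (a + 7) ∧ I k s') ⟨by simp, h0⟩ ?_).mono
    fun _ s' h => by rwa [sat_pure]
  rintro k hk w s' ⟨ht, hs'⟩
  refine sat_walkBody _ _ _ _ _ _ fun z t ht' => ?_
  refine (hv k (by omega) z _ (hI _ _ t hs')).mono fun _ s'' h => ⟨h.1.trans ?_, h.2⟩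
  change t + a ≤ _
  linarith

omit [DecidableRel G.Adj] in
-- The index of `I` counts visits over all walks together, so that invariants can record how many
-- visits were made in total.
theorem sat_walks (A : AdjList G) (L : ℕ) (u : Fin n) (visit : ℕ → Fin n → M n Unit)
    (I : ℕ → Config n → Prop) (hI : ∀ k s t, I k s → I k (s.setTime t)) (a N : ℕ)
    (hv : ∀ i, ∀ k ≤ L, ∀ w s, I i s →
      Sat (visit k w) s fun _ s' => s'.time ≤ s.time + a ∧ I (i + 1) s')
    (s : Config n) (h0 : I 0 s) :
    Sat (loop N () fun _ _ => lazyWalk A L u visit) s fun _ s' =>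
      s'.time ≤ s.time + N * ((L + 1) * (a + 7) + 1) ∧ I (N * (L + 1)) s' := by
  refine (sat_loop (fun k _ s' => s'.time ≤ s.time + k * ((L + 1) * (a + 7) + 1) ∧
    I (k * (L + 1)) s') ⟨by simp, by simpa using h0⟩ ?_)
  rintro k - - s' ⟨ht, hs'⟩
  refine (sat_lazyWalk_time A L u visit (fun j => I (k * (L + 1) + j)) (fun j => hI _) a
    (fun j hj w s h => hv _ j hj w s h) _ (hI _ _ (s'.time + 1) hs')).mono fun _ s'' h => ?_
  refine ⟨h.1.trans ?_, by rw [Nat.succ_mul]; exact h.2⟩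
  change s'.time + 1 + _ ≤ _
  linarith

/-- By linearity, the expectation of a sum of functions of the single positions involves only the
laws of these positions, which are the columns `u` of the matrix powers. -/
theorem wp_lazyWalk_le (hG : ∀ v, 0 < G.degree v) (A : AdjList G) (L : ℕ) (u : Fin n)
    (visit : ℕ → Fin n → M n Unit)
    (I : ℕ → Config n → Prop) (hI : ∀ k s t, I k s → I k (s.setTime t))
    (Y : ℕ → Config n → ℝ) (hY : ∀ k s t, Y k (s.setTime t) = Y k s)
    (hY0 : ∀ k s, I k s → 0 ≤ Y k s)
    (g : ℕ → Fin n → ℝ) (hg : ∀ k ≤ L, ∀ w, 0 ≤ g k w)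
    (hv : ∀ k ≤ L, ∀ w s, I k s →
      Sat (visit k w) s fun _ s' => I (k + 1) s' ∧ Y (k + 1) s' = Y k s + g k w)
    (s : Config n) (h0 : I 0 s) (hs : Y 0 s = 0) :
    wp (lazyWalk A L u visit) (fun _ s' => ENNReal.ofReal (Y (L + 1) s')) s
      ≤ ENNReal.ofReal (∑ k ∈ Finset.range (L + 1), ∑ w, g k w * (lazyMatrix G ^ k) w u) := by
  have hvisit : ∀ k ≤ L, ∀ z s t (φ : Fin n → ℝ), I k s →
      wp (visit k z >>= fun _ => (pure z : M n (Fin n)))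
        (fun w s' => ENNReal.ofReal (Y (k + 1) s' + φ w)) (s.setTime t)
        ≤ ENNReal.ofReal (Y k s + g k z + φ z) := by
    intro k hk z s t φ hs
    refine wp_le_of_sat ?_
    rw [sat_bind]
    refine (hv k hk z _ (hI _ _ t hs)).mono fun _ s' h => ?_
    rw [sat_pure, h.2, hY]
  have hsat := sat_walkLoop A L u visit I hI
    (fun k hk w s hs => (hv k hk w s hs).mono fun _ _ h => h.1) s h0
  -- The induction needs an arbitrary function φ of the current vertex: the expected gain of the
  -- next visit is such a function, is absorbed into φ and is then pulled back by the matrix. The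
  -- iteration `k = 0` does not move, which gives the power 0.
  have main : ∀ k ≤ L, ∀ φ : Fin n → ℝ, (∀ w, 0 ≤ φ w) →
      wp (loop (k + 1) u (walkBody A visit)) (fun w s' => ENNReal.ofReal (Y (k + 1) s' + φ w)) s
        ≤ ENNReal.ofReal (∑ i ∈ Finset.range (k + 1), ∑ w, g i w * (lazyMatrix G ^ i) w u
          + ∑ w, φ w * (lazyMatrix G ^ k) w u) := by
    intro k
    induction k with
    | zero =>
      intro _ φ hφ
      unfold loop
      rw [wp_bind]
      unfold loop
      rw [wp_pure, wp_bind, wp_tick]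
      unfold walkBody
      rw [wp_bind, wp_branch, if_pos rfl, wp_pure]
      refine (hvisit 0 (Nat.zero_le _) u s (s.time + 2) φ h0).trans_eq ?_
      simp [hs, Matrix.one_apply]
    | succ k ih =>
      intro hk φ hφ
      unfold loop
      rw [wp_bind]
      have hgn : ∀ z, 0 ≤ g (k + 1) z := hg (k + 1) hk
      have hψ : ∀ w, 0 ≤ ∑ z, lazyMatrix G z w * (g (k + 1) z + φ z) := fun w =>
        Finset.sum_nonneg fun z _ =>
          mul_nonneg (lazyMatrix_nonneg z w) (add_nonneg (hgn z) (hφ z))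
      refine (wp_mono_of_sat (Q' := fun w s' => ENNReal.ofReal (Y (k + 1) s'
        + ∑ z, lazyMatrix G z w * (g (k + 1) z + φ z))) (hsat (k + 1) (by omega)) ?_).trans ?_
      · intro w s' hs'
        have hY' := hY0 _ _ hs'
        rw [wp_bind, wp_tick]
        unfold walkBody
        rw [wp_bind, wp_branch, if_neg (Nat.succ_ne_zero k)]
        refine (wp_lazyStep_le A w (hG w) s'.step.step _ (fun z => Y (k + 1) s' + g (k + 1) z + φ z)
          (fun z => add_nonneg (add_nonneg hY' (hgn z)) (hφ z))
          fun z t => hvisit (k + 1) hk z s' t φ hs').trans_eq ?_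
        congr 1
        simp only [add_assoc, mul_add, Finset.sum_add_distrib]
        rw [← Finset.sum_mul, sum_lazyMatrix w (hG w), one_mul]
      · refine (ih (by omega) _ hψ).trans_eq ?_
        rw [sum_mul_lazyMatrix_pow_succ, Finset.sum_range_succ _ (k + 1)]
        congr 1
        simp only [add_mul, Finset.sum_add_distrib]
        ring
  rw [lazyWalk_eq, wp_bind]
  simp only [wp_pure]
  simpa using main L le_rfl (fun _ => 0) fun _ => le_rfl

/-! ### Exponential moments of additive functionals. -/

/-- Convexity of the exponential. The bound is affine in `x`, so its expectation needs only the mean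
of `x`. -/
theorem exp_mul_le_chord {x B : ℝ} (hB : 0 < B) (h0 : 0 ≤ x) (h1 : x ≤ B) (θ : ℝ) :
    Real.exp (θ * x) ≤ (B - x) / B + x / B * Real.exp (θ * B) := by
  have hsum : (B - x) / B + x / B = 1 := by
    field_simp
    ring
  have h := convexOn_exp.2 (Set.mem_univ 0) (Set.mem_univ (θ * B))
    (div_nonneg (by linarith : 0 ≤ B - x) hB.le) (div_nonneg h0 hB.le) hsum
  simp only [smul_eq_mul, mul_zero, zero_add, Real.exp_zero, mul_one] at h
  rwa [← mul_assoc, mul_comm _ θ, mul_assoc, div_mul_cancel₀ _ hB.ne'] at h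

/-- Exponential moment of an additive functional of one lazy random walk. -/
theorem wp_lazyWalk_exp_le (hG : ∀ v, 0 < G.degree v) (A : AdjList G) (L : ℕ) (u : Fin n)
    (visit : ℕ → Fin n → M n Unit)
    (I : Config n → Prop) (hI : ∀ s t, I s → I (s.setTime t))
    (Y : Config n → ℝ) (hY : ∀ s t, Y (s.setTime t) = Y s)
    (f : ℕ → Fin n → ℝ) (b : ℝ) (hb : 0 < b) (hf : ∀ k ≤ L, ∀ w, 0 ≤ f k w)
    (hfb : ∀ k ≤ L, ∀ w, f k w ≤ b)
    (hv : ∀ k ≤ L, ∀ w s, I s → Sat (visit k w) s fun _ s' => I s' ∧ Y s' = Y s + f k w)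
    (θ : ℝ) (s : Config n) (h0 : I s) :
    wp (lazyWalk A L u visit) (fun _ s' => ENNReal.ofReal (Real.exp (θ * Y s'))) s
      ≤ ENNReal.ofReal (Real.exp (θ * Y s) *
        Real.exp ((∑ k ∈ Finset.range (L + 1), ∑ w, f k w * (lazyMatrix G ^ k) w u)
          * ((Real.exp (θ * ((L + 1) * b)) - 1) / ((L + 1) * b)))) := by
  set B : ℝ := (L + 1) * b with hB
  have hBpos : 0 < B := by positivity
  set E := Real.exp (θ * B) with hE
  have hEpos : 0 < E := Real.exp_pos _
  set μ := ∑ k ∈ Finset.range (L + 1), ∑ w, f k w * (lazyMatrix G ^ k) w u with hμ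
  -- The chord with the budget `k * b` in place of `B`. It starts at 0, grows at each visit by a
  -- nonnegative amount that depends only on `k` and `w`, and is the chord itself at `k = L + 1`;
  -- hence it is an additive functional to which `wp_lazyWalk_le` applies.
  set Z : ℕ → Config n → ℝ := fun k s' => Real.exp (θ * Y s) *
    ((k * b - (Y s' - Y s)) / B + (Y s' - Y s) / B * E) with hZ
  set g : ℕ → Fin n → ℝ := fun k w => Real.exp (θ * Y s) * ((b - f k w) / B + f k w / B * E)
    with hg
  set I' : ℕ → Config n → Prop := fun k s' => I s' ∧ k ≤ L + 1 ∧ 0 ≤ Y s' - Y s ∧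
    Y s' - Y s ≤ k * b with hI'
  -- The column sums of the powers are 1, so the constant parts `b / B` of the `L + 1` visits add up
  -- to 1.
  have hsum : ∑ k ∈ Finset.range (L + 1), ∑ w, g k w * (lazyMatrix G ^ k) w u
      = Real.exp (θ * Y s) * (1 + μ * ((E - 1) / B)) := by
    have h1 : ∀ k w, g k w * (lazyMatrix G ^ k) w u = Real.exp (θ * Y s) *
        (b / B * (lazyMatrix G ^ k) w u + (E - 1) / B * (f k w * (lazyMatrix G ^ k) w u)) := by
      intro k w
      simp only [hg]
      ring
    simp only [h1, ← Finset.mul_sum, Finset.sum_add_distrib, sum_lazyMatrix_pow hG, ← hμ,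
      Finset.sum_const, Finset.card_range, nsmul_eq_mul]
    congr 2
    · push_cast
      rw [hB]
      field_simp
    · ring
  have hI'' : ∀ k s t, I' k s → I' k (s.setTime t) := fun k s t h => by
    simp only [hI', hY] at h ⊢
    exact ⟨hI _ _ h.1, h.2⟩
  have hv' : ∀ k ≤ L, ∀ w s, I' k s →
      Sat (visit k w) s fun _ s' => I' (k + 1) s' ∧ Z (k + 1) s' = Z k s + g k w := by
    intro k hk w s' h
    refine (hv k hk w s' h.1).mono fun _ s'' h' => ?_
    obtain ⟨h1, -, h2, h3⟩ := h
    have h4 := hf k hk w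
    have h5 := hfb k hk w
    have hYY : Y s'' - Y s = (Y s' - Y s) + f k w := by rw [h'.2]; ring
    refine ⟨⟨h'.1, by omega, by rw [hYY]; linarith, ?_⟩, ?_⟩
    · rw [hYY]
      push_cast
      linarith
    · simp only [hZ, hg, hYY]
      push_cast
      ring
  have h1 := wp_lazyWalk_le hG A L u visit I' hI'' Z (fun k s t => by simp only [hZ, hY])
    (fun k s' h => by
      obtain ⟨-, -, h2, h3⟩ := h
      have : 0 ≤ k * b - (Y s' - Y s) := by linarith
      simp only [hZ]
      positivity)
    g (fun k hk w => by
      have h2 := hf k hk w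
      have h3 : 0 ≤ b - f k w := by linarith [hfb k hk w]
      simp only [hg]
      positivity)
    hv'
    s ⟨h0, by omega, by simp, by simp⟩ (by simp [hZ])
  have hsat := sat_lazyWalk A L u visit I' hI''
    (fun k hk w s hs => (hv' k hk w s hs).mono fun _ _ h => h.1) s ⟨h0, by omega, by simp, by simp⟩
  refine (wp_mono_of_sat hsat fun _ s' h => ?_).trans (h1.trans ?_)
  · refine ENNReal.ofReal_le_ofReal ?_
    obtain ⟨-, -, h2, h3⟩ := h
    have h4 := exp_mul_le_chord hBpos h2 (by simpa [hB] using h3) θ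
    have : θ * Y s' = θ * Y s + θ * (Y s' - Y s) := by ring
    rw [this, Real.exp_add]
    simp only [hZ]
    push_cast
    rw [← hB]
    gcongr
  · rw [hsum]
    refine ENNReal.ofReal_le_ofReal ?_
    gcongr
    rw [add_comm]
    exact Real.add_one_le_exp _

/-- Exponential moment of an additive functional of `N` lazy random walks. -/
theorem wp_walks_exp_le (hG : ∀ v, 0 < G.degree v) (A : AdjList G) (L : ℕ) (u : Fin n)
    (visit : ℕ → Fin n → M n Unit)
    (I : Config n → Prop) (hI : ∀ s t, I s → I (s.setTime t))
    (Y : Config n → ℝ) (hY : ∀ s t, Y (s.setTime t) = Y s)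
    (f : ℕ → Fin n → ℝ) (b : ℝ) (hb : 0 < b) (hf : ∀ k ≤ L, ∀ w, 0 ≤ f k w)
    (hfb : ∀ k ≤ L, ∀ w, f k w ≤ b)
    (hv : ∀ k ≤ L, ∀ w s, I s → Sat (visit k w) s fun _ s' => I s' ∧ Y s' = Y s + f k w)
    (θ : ℝ) (s : Config n) (h0 : I s) (N : ℕ) :
    wp (loop N () fun _ _ => lazyWalk A L u visit)
        (fun _ s' => ENNReal.ofReal (Real.exp (θ * Y s'))) s
      ≤ ENNReal.ofReal (Real.exp (θ * Y s +
        N * ((∑ k ∈ Finset.range (L + 1), ∑ w, f k w * (lazyMatrix G ^ k) w u)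
          * ((Real.exp (θ * ((L + 1) * b)) - 1) / ((L + 1) * b))))) := by
  set ρ := (∑ k ∈ Finset.range (L + 1), ∑ w, f k w * (lazyMatrix G ^ k) w u)
          * ((Real.exp (θ * ((L + 1) * b)) - 1) / ((L + 1) * b)) with hρ
  have hsat : ∀ N, Sat (loop N () fun _ _ => lazyWalk A L u visit) s fun _ s' => I s' := fun N =>
    sat_loop (fun _ _ s' => I s') h0 fun _ _ _ s' hs' =>
      sat_lazyWalk A L u visit (fun _ => I) (fun _ => hI)
        (fun k hk w s hs => (hv k hk w s hs).mono fun _ _ h => h.1) _ (hI _ (s'.time + 1) hs')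
  induction N with
  | zero => simp [loop, wp_pure]
  | succ N ih =>
    unfold loop
    rw [wp_bind]
    -- From any state in which it may start, one walk multiplies the moment by at most `exp ρ`; this
    -- takes the place of independence.
    refine (wp_mono_of_sat (Q' := fun _ s' => ENNReal.ofReal (Real.exp ρ) *
      ENNReal.ofReal (Real.exp (θ * Y s'))) (hsat N) ?_).trans ?_
    · intro _ s' hs'
      rw [wp_bind, wp_tick]
      refine (wp_lazyWalk_exp_le hG A L u visit I hI Y hY f b hb hf hfb hv θ _
        (hI _ (s'.time + 1) hs')).trans_eq ?_
      rw [← ENNReal.ofReal_mul (Real.exp_pos _).le, mul_comm, hY]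
    · rw [wp_const_mul]
      refine (mul_le_mul_right ih _).trans_eq ?_
      rw [← ENNReal.ofReal_mul (Real.exp_pos _).le, ← Real.exp_add]
      congr 2
      push_cast
      ring

end Walks

end ERSketch

end

noncomputable section

namespace ERSketch

open scoped ENNReal

/-! ## Cells, frames and lists -/

section Frames

variable {n : ℕ}

/-- The cells that may be accessed when there are at most `J` candidates per vertex. -/
def cells (n L J : ℕ) : Finset (Cell n) :=
  (Finset.univ.image RealCell.visit ∪
      (Finset.range J ×ˢ Finset.univ).image (fun p => RealCell.approx p.1 p.2) ∪
      (Finset.range J ×ˢ Finset.range (L + 2) ×ˢ Finset.univ).image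
        (fun p => RealCell.resid p.1 p.2.1 p.2.2) ∪
      (Finset.range (n * J)).image RealCell.outValue).disjSum
    (((Finset.range n).image VertCell.seen ∪ (Finset.range J).image VertCell.cand ∪
      (Finset.range J ×ˢ Finset.range (L + 2) ×ˢ Finset.range n).image
        (fun p => VertCell.level p.1 p.2.1 p.2.2) ∪
      (Finset.range ((L + 1) * n)).image VertCell.hitVertex ∪
      (Finset.range (n * J)).image VertCell.outVertex).disjSum
    ({WordCell.seenLen, WordCell.candLen, WordCell.hitLen, WordCell.outLen} ∪
      (Finset.range J ×ˢ Finset.range (L + 2)).image (fun p => WordCell.levelLen p.1 p.2) ∪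
      (Finset.range ((L + 1) * n)).image WordCell.hitStep ∪
      (Finset.range (L + 1) ×ˢ Finset.univ).image (fun p => WordCell.count p.1 p.2) ∪
      (Finset.range (n + 1)).image WordCell.offset))

section Membership

variable (L J : ℕ)

@[simp] theorem visit_mem_cells (w : Fin n) : Sum.inl (.visit w) ∈ cells n L J := by
  simp [cells]

@[simp] theorem approx_mem_cells (j : ℕ) (w : Fin n) :
    Sum.inl (.approx j w) ∈ cells n L J ↔ j < J := by
  simp [cells]

@[simp] theorem resid_mem_cells (j i : ℕ) (w : Fin n) :
    Sum.inl (.resid j i w) ∈ cells n L J ↔ j < J ∧ i < L + 2 := by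
  simp [cells]

@[simp] theorem outValue_mem_cells (o : ℕ) :
    Sum.inl (.outValue o) ∈ cells n L J ↔ o < n * J := by
  simp [cells]

@[simp] theorem seen_mem_cells (t : ℕ) :
    Sum.inr (Sum.inl (.seen t)) ∈ cells n L J ↔ t < n := by
  simp [cells]

@[simp] theorem cand_mem_cells (j : ℕ) :
    Sum.inr (Sum.inl (.cand j)) ∈ cells n L J ↔ j < J := by
  simp [cells]

@[simp] theorem level_mem_cells (j i t : ℕ) :
    Sum.inr (Sum.inl (.level j i t)) ∈ cells n L J ↔ j < J ∧ i < L + 2 ∧ t < n := by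
  simp [cells]

@[simp] theorem hitVertex_mem_cells (t : ℕ) :
    Sum.inr (Sum.inl (.hitVertex t)) ∈ cells n L J ↔ t < (L + 1) * n := by
  simp [cells]

@[simp] theorem outVertex_mem_cells (o : ℕ) :
    Sum.inr (Sum.inl (.outVertex o)) ∈ cells n L J ↔ o < n * J := by
  simp [cells]

@[simp] theorem seenLen_mem_cells : Sum.inr (Sum.inr .seenLen) ∈ cells n L J := by
  simp [cells]

@[simp] theorem candLen_mem_cells : Sum.inr (Sum.inr .candLen) ∈ cells n L J := by
  simp [cells]

@[simp] theorem hitLen_mem_cells : Sum.inr (Sum.inr .hitLen) ∈ cells n L J := by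
  simp [cells]

@[simp] theorem outLen_mem_cells : Sum.inr (Sum.inr .outLen) ∈ cells n L J := by
  simp [cells]

@[simp] theorem levelLen_mem_cells (j i : ℕ) :
    Sum.inr (Sum.inr (.levelLen j i)) ∈ cells n L J ↔ j < J ∧ i < L + 2 := by
  simp [cells]

@[simp] theorem hitStep_mem_cells (t : ℕ) :
    Sum.inr (Sum.inr (.hitStep t)) ∈ cells n L J ↔ t < (L + 1) * n := by
  simp [cells]

@[simp] theorem count_mem_cells (k : ℕ) (w : Fin n) :
    Sum.inr (Sum.inr (.count k w)) ∈ cells n L J ↔ k < L + 1 := by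
  simp [cells]

@[simp] theorem offset_mem_cells (t : ℕ) :
    Sum.inr (Sum.inr (.offset t)) ∈ cells n L J ↔ t < n + 1 := by
  simp [cells]

end Membership

theorem card_cells_le (n L J : ℕ) :
    (cells n L J).card ≤ n + J * n + J * ((L + 2) * n) + n * J
      + (n + J + J * ((L + 2) * n) + (L + 1) * n + n * J
      + (4 + J * (L + 2) + (L + 1) * n + (L + 1) * n + (n + 1))) := by
  unfold cells
  rw [Finset.card_disjSum, Finset.card_disjSum]
  have im : ∀ {α β : Type} [DecidableEq β] (f : α → β) (T : Finset α) {c : ℕ}, T.card = c →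
      (T.image f).card ≤ c := fun f T c h => h ▸ Finset.card_image_le
  have un : ∀ {β : Type} [DecidableEq β] (S T : Finset β) {a b : ℕ}, S.card ≤ a → T.card ≤ b →
      (S ∪ T).card ≤ a + b := fun S T a b h h' =>
    (Finset.card_union_le S T).trans (Nat.add_le_add h h')
  refine Nat.add_le_add ?_ (Nat.add_le_add ?_ ?_)
  · refine un _ _ (un _ _ (un _ _ (im _ _ ?_) (im _ _ ?_)) (im _ _ ?_)) (im _ _ ?_) <;> simp
  · refine un _ _ (un _ _ (un _ _ (un _ _ (im _ _ ?_) (im _ _ ?_)) (im _ _ ?_)) (im _ _ ?_))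
      (im _ _ ?_) <;> simp
  · refine un _ _ (un _ _ (un _ _ (un _ _ ?_ (im _ _ ?_)) (im _ _ ?_)) (im _ _ ?_))
      (im _ _ ?_) <;> simp

/-- Outside the set `X` of cells the memories of `s` and `s'` agree. -/
structure Frame (X : Set (Cell n)) (s s' : Config n) : Prop where
  real : ∀ a, Sum.inl a ∉ X → s'.real a = s.real a
  vert : ∀ a, Sum.inr (Sum.inl a) ∉ X → s'.vert a = s.vert a
  word : ∀ a, Sum.inr (Sum.inr a) ∉ X → s'.word a = s.word a

namespace Frame

variable {X X' : Set (Cell n)} {s s' s'' : Config n}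

theorem refl (X : Set (Cell n)) (s : Config n) : Frame X s s :=
  ⟨fun _ _ => rfl, fun _ _ => rfl, fun _ _ => rfl⟩

theorem trans (h : Frame X s s') (h' : Frame X s' s'') : Frame X s s'' :=
  ⟨fun a ha => (h'.real a ha).trans (h.real a ha), fun a ha => (h'.vert a ha).trans (h.vert a ha),
    fun a ha => (h'.word a ha).trans (h.word a ha)⟩

theorem mono (h : Frame X s s') (hX : X ⊆ X') : Frame X' s s' :=
  ⟨fun a ha => h.real a fun h => ha (hX h), fun a ha => h.vert a fun h => ha (hX h),
    fun a ha => h.word a fun h => ha (hX h)⟩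

theorem step (h : Frame X s s') : Frame X s s'.step := ⟨h.1, h.2, h.3⟩

theorem setTime (h : Frame X s s') (t : ℕ) : Frame X s (s'.setTime t) := ⟨h.1, h.2, h.3⟩

theorem touch (h : Frame X s s') (a : Cell n) : Frame X s (s'.touch a) := ⟨h.1, h.2, h.3⟩

theorem setReal (h : Frame X s s') {a : RealCell n} (ha : Sum.inl a ∈ X) (x : ℝ) :
    Frame X s (s'.setReal a x) :=
  ⟨fun b hb => by
    rw [Config.setReal_real, Function.update_of_ne (by rintro rfl; exact hb ha), h.real b hb], h.2, h.3⟩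

theorem setVert (h : Frame X s s') {a : VertCell} (ha : Sum.inr (Sum.inl a) ∈ X) (x : Fin n) :
    Frame X s (s'.setVert a x) :=
  ⟨h.1, fun b hb => by
    rw [Config.setVert_vert, Function.update_of_ne (by rintro rfl; exact hb ha), h.vert b hb], h.3⟩

theorem setWord (h : Frame X s s') {a : WordCell n} (ha : Sum.inr (Sum.inr a) ∈ X) (x : ℕ) :
    Frame X s (s'.setWord a x) :=
  ⟨h.1, h.2, fun b hb => by
    rw [Config.setWord_word, Function.update_of_ne (by rintro rfl; exact hb ha), h.word b hb]⟩

end Frame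

/-- The first `l` values of `f` list the elements of `S`, each of them once. -/
structure Enum {α : Type} (f : ℕ → α) (l : ℕ) (S : Set α) : Prop where
  inj : ∀ i < l, ∀ j < l, f i = f j → i = j
  mem : ∀ a, a ∈ S ↔ ∃ i < l, f i = a

namespace Enum

variable {α : Type} {f f' : ℕ → α} {l : ℕ} {S S' : Set α} {a : α}

theorem nil (hS : ∀ a, a ∉ S) : Enum f 0 S := ⟨by simp, by simpa using hS⟩

theorem congr (h : Enum f l S) (hf : ∀ i < l, f' i = f i) (hS : ∀ a, a ∈ S' ↔ a ∈ S) :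
    Enum f' l S' := by
  refine ⟨fun i hi j hj hij => h.inj i hi j hj (by rwa [hf i hi, hf j hj] at hij), fun a => ?_⟩
  rw [hS, h.mem]
  exact exists_congr fun i => and_congr_right fun hi => by rw [hf i hi]

theorem push (h : Enum f l S) (ha : a ∉ S) (hf : ∀ i < l, f' i = f i) (hl : f' l = a)
    (hS : ∀ b, b ∈ S' ↔ b = a ∨ b ∈ S) : Enum f' (l + 1) S' := by
  have hne : ∀ i < l, f' i ≠ a := fun i hi hia =>
    ha ((h.mem a).2 ⟨i, hi, by rw [← hf i hi, hia]⟩)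
  refine ⟨fun i hi j hj hij => ?_, fun b => ?_⟩
  · rcases Nat.lt_succ_iff_lt_or_eq.1 hi with hi | rfl <;>
      rcases Nat.lt_succ_iff_lt_or_eq.1 hj with hj | rfl
    · exact h.inj i hi j hj (by rwa [hf i hi, hf j hj] at hij)
    · exact absurd (hij.trans hl) (hne i hi)
    · exact absurd (hij.symm.trans hl) (hne j hj)
    · rfl
  · rw [hS, h.mem]
    constructor
    · rintro (rfl | ⟨i, hi, rfl⟩)
      · exact ⟨l, Nat.lt_succ_self l, hl⟩
      · exact ⟨i, hi.trans (Nat.lt_succ_self l), hf i hi⟩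
    · rintro ⟨i, hi, rfl⟩
      rcases Nat.lt_succ_iff_lt_or_eq.1 hi with hi | rfl
      · exact Or.inr ⟨i, hi, (hf i hi).symm⟩
      · exact Or.inl hl

theorem mem_of_lt (h : Enum f l S) {i : ℕ} (hi : i < l) : f i ∈ S := (h.mem _).2 ⟨i, hi, rfl⟩

end Enum

/-! ### Sums along duplicate-free lists. -/

theorem sum_le_of_inj {α : Type} {f : ℕ → α} {l : ℕ}
    (hf : ∀ i < l, ∀ j < l, f i = f j → i = j) (T : Finset α) (hT : ∀ i < l, f i ∈ T)
    (g : α → ℝ) (hg : ∀ a ∈ T, 0 ≤ g a) : ∑ i ∈ Finset.range l, g (f i) ≤ ∑ a ∈ T, g a := by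
  classical
  rw [← Finset.sum_image (f := g) (g := f) fun i hi j hj =>
    hf i (Finset.mem_range.1 hi) j (Finset.mem_range.1 hj)]
  refine Finset.sum_le_sum_of_subset_of_nonneg ?_ fun a ha _ => hg a ha
  intro a ha
  obtain ⟨i, hi, rfl⟩ := Finset.mem_image.1 ha
  exact hT i (Finset.mem_range.1 hi)

/-- Only the elements with nonzero summand must be listed, and superfluous entries do no harm. The
level lists of the descent need this, since they keep relaxed vertices whose residual is 0. -/
theorem sum_eq_of_inj {α : Type} {f : ℕ → α} {l : ℕ}
    (hf : ∀ i < l, ∀ j < l, f i = f j → i = j) (T : Finset α) (hT : ∀ i < l, f i ∈ T)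
    (g : α → ℝ) (hg : ∀ a ∈ T, g a ≠ 0 → ∃ i < l, f i = a) :
    ∑ i ∈ Finset.range l, g (f i) = ∑ a ∈ T, g a := by
  classical
  rw [← Finset.sum_image (f := g) (g := f) fun i hi j hj =>
    hf i (Finset.mem_range.1 hi) j (Finset.mem_range.1 hj)]
  refine Finset.sum_subset ?_ fun a ha h => ?_
  · intro a ha
    obtain ⟨i, hi, rfl⟩ := Finset.mem_image.1 ha
    exact hT i (Finset.mem_range.1 hi)
  · by_contra h0
    obtain ⟨i, hi, rfl⟩ := hg a ha h0
    exact h (Finset.mem_image_of_mem f (Finset.mem_range.2 hi))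

theorem le_card_of_inj {α : Type} {f : ℕ → α} {l : ℕ}
    (hf : ∀ i < l, ∀ j < l, f i = f j → i = j) (T : Finset α) (hT : ∀ i < l, f i ∈ T) :
    l ≤ T.card := by
  have h := sum_le_of_inj hf T hT (fun _ => 1) fun _ _ => zero_le_one
  simpa using h

theorem le_of_inj {f : ℕ → Fin n} {l : ℕ} (hf : ∀ i < l, ∀ j < l, f i = f j → i = j) : l ≤ n := by
  simpa using le_card_of_inj hf Finset.univ fun _ _ => Finset.mem_univ _

end Frames

/-! ## First stage -/

section StageOne

variable {n : ℕ} {G : SimpleGraph (Fin n)}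

/-- The cells that are changed by the first stage. -/
def stageOneCells (n : ℕ) : Set (Cell n) := fun a => match a with
  | .inl (.visit _) => True
  | .inr (.inl (.seen _)) => True
  | .inr (.inl (.cand _)) => True
  | .inr (.inr .seenLen) => True
  | .inr (.inr .candLen) => True
  | _ => False

/-- The program that is run for each vertex met by a walk of the first stage. -/
def visitOne (N : ℕ) (_ : ℕ) (w : Fin n) : M n Unit := do
  let x ← readReal (.visit w)
  branch (x = 0)
    (do
      let t ← readWord .seenLen
      writeVert (.seen t) w
      writeWord .seenLen (t + 1))
    (pure ())
  let y ← arith (x + 1 / (2 * (N : ℝ)))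
  writeReal (.visit w) y

/-- The loop that extracts the candidates. -/
def extract (ε : ℝ) (t : ℕ) : M n Unit := do
  let w ← readVert (.seen t)
  let x ← readReal (.visit w)
  branch (ε / 2 < x)
    (do
      let j ← readWord .candLen
      writeVert (.cand j) w
      writeWord .candLen (j + 1))
    (pure ())

theorem stageOne_eq (A : AdjList G) (L : ℕ) (ε : ℝ) (u : Fin n) (N : ℕ) :
    stageOne A L ε u N = (loop N () fun _ _ => lazyWalk A L u (visitOne N)) >>= fun _ =>
      readWord .seenLen >>= fun l => loop l () fun t _ => extract ε t := rfl

/-- State of the first stage after `i` visits. -/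
structure VisitedOne (L J N : ℕ) (s₀ : Config n) (i : ℕ) (s : Config n) : Prop where
  frame : Frame (stageOneCells n) s₀ s
  nonneg : ∀ w, 0 ≤ s.real (.visit w)
  enum : Enum (fun t => s.vert (.seen t)) (s.word .seenLen) {w | s.real (.visit w) ≠ 0}
  sum : ∑ w, s.real (.visit w) = i * (1 / (2 * (N : ℝ)))
  len : s.word .seenLen ≤ i
  candLen : s.word .candLen = 0
  used : s.used ⊆ cells n L J

/-- The entries are nonnegative and the increments positive, so the value 0 characterizes vertices
not met before; this uses `N > 0`. -/
theorem sat_visitOne {L J N : ℕ} (hN : 0 < N) {s₀ s : Config n} {i : ℕ}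
    (h : VisitedOne L J N s₀ i s) (k : ℕ) (w : Fin n) :
    Sat (visitOne N k w) s fun _ s' => s'.time ≤ s.time + 7 ∧ VisitedOne L J N s₀ (i + 1) s' ∧
      ∀ v, s'.real (.visit v) = s.real (.visit v) + if v = w then 1 / (2 * (N : ℝ)) else 0 := by
  have hpos : 0 < 1 / (2 * (N : ℝ)) := by positivity
  have hupd : ∀ v, Function.update s.real (.visit w) (s.real (.visit w) + 1 / (2 * (N : ℝ)))
      (.visit v) = s.real (.visit v) + if v = w then 1 / (2 * (N : ℝ)) else 0 := by
    intro v
    by_cases hv : v = w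
    · subst hv
      simp
    · rw [Function.update_of_ne (by simpa using hv), if_neg hv, add_zero]
  have hsum : ∑ v, (s.real (.visit v) + if v = w then 1 / (2 * (N : ℝ)) else 0)
      = ((i + 1 : ℕ) : ℝ) * (1 / (2 * (N : ℝ))) := by
    rw [Finset.sum_add_distrib, h.sum, Finset.sum_ite_eq' Finset.univ w]
    simp
    ring
  have hlen : s.word .seenLen ≤ n := le_of_inj h.enum.inj
  unfold visitOne
  simp only [sat_bind, sat_readReal, sat_branch, sat_readWord, sat_writeVert, sat_writeWord,
    sat_arith, sat_writeReal, sat_pure]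
  split_ifs with hx
  -- The list with `w` appended still has distinct entries, so the new index is below `n` and its
  -- cell belongs to `cells`.
  · have hlt : s.word .seenLen < n := by
      have : s.word .seenLen + 1 ≤ n := le_of_inj (f := fun t => if t < s.word .seenLen then
        s.vert (.seen t) else w) (h.enum.push (a := w) (S' := insert w {w | s.real (.visit w) ≠ 0})
          (by simpa using hx) (fun i hi => by simp [hi]) (by simp) fun b => Iff.rfl).inj
      omega
    refine ⟨by simp, ⟨?_, ?_, ?_, ?_, ?_, ?_, ?_⟩, ?_⟩
    · exact ((((((((h.frame.touch _).step).touch _).setVert (by trivial) _).setWord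
        (by trivial) _).step).setReal (by trivial) _))
    · intro v
      simp only [Config.setReal_real, Config.step_real, Config.setWord_real, Config.setVert_real,
        Config.touch_real]
      rw [hupd]
      have := h.nonneg v
      split_ifs <;> linarith
    · simp only [Config.setReal_real, Config.step_real, Config.setWord_real, Config.setVert_real,
        Config.touch_real, Config.setReal_word, Config.setWord_word, Config.step_word,
        Function.update_self, Config.setReal_vert, Config.setWord_vert, Config.setVert_vert,
        Config.step_vert, Config.touch_vert, Config.touch_word]
      refine h.enum.push (a := w) (by simpa using hx) (fun i hi => ?_) (by simp) fun v => ?_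
      · rw [Function.update_of_ne]
        simpa using hi.ne
      · simp only [Set.mem_ofPred_eq]
        rw [hupd]
        by_cases hv : v = w
        · subst hv
          simp [hx]
          omega
        · simp [hv]
    · simp only [Config.setReal_real, Config.step_real, Config.setWord_real, Config.setVert_real,
        Config.touch_real]
      simp only [hupd, hsum]
    · simp
      exact h.len
    · simp [h.candLen]
    · simp [Finset.insert_subset_iff, h.used, hlt]
    · intro v
      exact hupd v
  · refine ⟨by simp, ⟨?_, ?_, ?_, ?_, ?_, ?_, ?_⟩, ?_⟩
    · exact (((h.frame.touch _).step).step).setReal (by trivial) _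
    · intro v
      simp only [Config.setReal_real, Config.step_real, Config.touch_real]
      rw [hupd]
      have := h.nonneg v
      split_ifs <;> linarith
    · refine h.enum.congr (fun i hi => rfl) fun v => ?_
      simp only [Config.setReal_real, Config.step_real, Config.touch_real, Set.mem_ofPred_eq]
      rw [hupd]
      by_cases hv : v = w
      · subst hv
        have := h.nonneg v
        simp only [if_true]
        exact iff_of_true (by linarith) hx
      · simp [hv]
    · simp only [Config.setReal_real, Config.step_real, Config.touch_real]
      simp only [hupd, hsum]
    · exact h.len.trans (Nat.le_succ i)
    · exact h.candLen
    · simp [Finset.insert_subset_iff, h.used]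
    · intro v
      exact hupd v

/-- State after the first stage. -/
structure AfterOne (L J N : ℕ) (ε : ℝ) (s₀ s : Config n) : Prop where
  frame : Frame (stageOneCells n) s₀ s
  nonneg : ∀ w, 0 ≤ s.real (.visit w)
  seen : Enum (fun t => s.vert (.seen t)) (s.word .seenLen) {w | s.real (.visit w) ≠ 0}
  sum : ∑ w, s.real (.visit w) = (L + 1) / 2
  seenLen : s.word .seenLen ≤ N * (L + 1)
  cand : Enum (fun t => s.vert (.cand t)) (s.word .candLen) {w | ε / 2 < s.real (.visit w)}
  used : s.used ⊆ cells n L J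

/-- Each candidate carries more than ε/2 of a total mass (L+1)/2. The list is arbitrary, so the
bound also applies to the partial lists inside the extraction loop. -/
theorem candidates_le {L J l : ℕ} {ε : ℝ} {p : Fin n → ℝ} (hp : ∀ w, 0 ≤ p w)
    (hsum : ∑ w, p w = (L + 1) / 2) (hJ : ∀ c : ℕ, c * ε ≤ L + 1 → c ≤ J) {f : ℕ → Fin n}
    (hf : ∀ i < l, ∀ j < l, f i = f j → i = j) (hl : ∀ i < l, ε / 2 < p (f i)) : l ≤ J := by
  refine hJ l ?_
  have h1 := sum_le_of_inj hf Finset.univ (fun _ _ => Finset.mem_univ _) p fun w _ => hp w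
  have h2 : ∑ i ∈ Finset.range l, ε / 2 ≤ ∑ i ∈ Finset.range l, p (f i) :=
    Finset.sum_le_sum fun i hi => (hl i (Finset.mem_range.1 hi)).le
  rw [Finset.sum_const, Finset.card_range, nsmul_eq_mul] at h2
  linarith

theorem sat_extractLoop {L J N : ℕ} {ε : ℝ} (hN : 0 < N) (hε : 0 < ε)
    (hJ : ∀ c : ℕ, c * ε ≤ L + 1 → c ≤ J) {s₀ s : Config n}
    (h : VisitedOne L J N s₀ (N * (L + 1)) s) :
    Sat (loop (s.word .seenLen) () fun t _ => extract ε t) s fun _ s' =>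
      s'.time ≤ s.time + 7 * (N * (L + 1)) ∧ AfterOne L J N ε s₀ s' ∧
      ∀ v, s'.real (.visit v) = s.real (.visit v) := by
  set l := s.word .seenLen with hl
  have hsum : ∑ w, s.real (.visit w) = (L + 1) / 2 := by
    rw [h.sum]
    push_cast
    field_simp
  have hln : l ≤ n := le_of_inj h.enum.inj
  refine (sat_loop (fun t _ s' => s'.time ≤ s.time + 7 * t ∧ Frame (stageOneCells n) s₀ s' ∧
    s'.real = s.real ∧ (∀ t, s'.vert (.seen t) = s.vert (.seen t)) ∧ s'.word .seenLen = l ∧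
    Enum (fun t => s'.vert (.cand t)) (s'.word .candLen)
      {w | ε / 2 < s.real (.visit w) ∧ ∃ i < t, s.vert (.seen i) = w} ∧
    s'.used ⊆ cells n L J) ⟨by simp, h.frame, rfl, fun _ => rfl, rfl, ?_, h.used⟩ ?_).mono ?_
  · rw [h.candLen]
    exact Enum.nil (by simp)
  · rintro t ht - s' ⟨h1, h2, h3, h4, h5, h6, h7⟩
    unfold extract
    simp only [sat_bind, sat_readReal, sat_branch, sat_readWord, sat_writeVert, sat_writeWord,
      sat_pure, sat_readVert]
    have hmem : ∀ w, (∃ i < t + 1, s.vert (.seen i) = w) ↔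
        (w = s.vert (.seen t) ∨ ∃ i < t, s.vert (.seen i) = w) := by
      intro w
      simp only [Nat.lt_succ_iff_lt_or_eq, or_and_right, exists_or]
      rw [or_comm]
      simp [eq_comm]
    split_ifs with hx
    · simp only [Config.touch_real, Config.step_real, Config.step_vert, h3, h4] at hx
      have hpush : Enum (fun t_1 => Function.update s'.vert (.cand (s'.word .candLen))
          (s'.vert (.seen t)) (.cand t_1)) (s'.word .candLen + 1)
          {w | ε / 2 < s.real (.visit w) ∧ ∃ i < t + 1, s.vert (.seen i) = w} := by
        refine h6.push (a := s'.vert (.seen t)) ?_ (fun i hi => ?_) (by simp) fun v => ?_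
        · rintro ⟨-, i, hi, hit⟩
          rw [h4] at hit
          have := h.enum.inj i (hi.trans ht) t ht hit
          omega
        · rw [Function.update_of_ne]
          simpa using hi.ne
        · simp only [Set.mem_ofPred_eq, hmem, h4, and_or_left]
          refine or_congr_left ⟨fun h => h.2, ?_⟩
          rintro rfl
          exact ⟨hx, rfl⟩
      -- Applied to the extended list, this shows that the cell written for the new candidate has an
      -- index below `J`.
      have hJ' := candidates_le h.nonneg hsum hJ hpush.inj fun i hi =>
        (hpush.mem_of_lt hi).1
      refine ⟨by simp; omega, ?_, ?_, ?_, ?_, ?_, ?_⟩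
      · exact (((((h2.step.touch _).touch _).step).touch _).setVert (by trivial) _).setWord
          (by trivial) _
      · simpa using h3
      · intro t
        simp [h4]
      · simpa using h5
      · simpa using hpush
      · simp only [Config.step_vert, Config.setWord_used, Config.setVert_used, Config.touch_used,
          Config.step_used, Finset.insert_subset_iff, h7]
        simp
        omega
    · simp only [Config.touch_real, Config.step_real, Config.step_vert, h3, h4] at hx
      refine ⟨by simp; omega, ((h2.step.touch _).touch _).step, h3, h4, h5, ?_, ?_⟩
      · refine h6.congr (fun _ _ => rfl) fun v => ?_
        simp only [Set.mem_ofPred_eq, hmem]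
        refine and_congr_right fun hv => or_iff_right ?_
        rintro rfl
        exact hx hv
      · simp [Finset.insert_subset_iff, h7]
        omega
  · rintro _ s' ⟨h1, h2, h3, h4, h5, h6, h7⟩
    refine ⟨h1.trans (by have := h.len; omega), ⟨h2, ?_, ?_, ?_, ?_, ?_, h7⟩, ?_⟩
    · simpa only [h3] using h.nonneg
    · simp only [h3, h4, h5]
      exact h.enum
    · simpa only [h3] using hsum
    · rw [h5]
      exact h.len
    · refine h6.congr (fun _ _ => rfl) fun v => ?_
      simp only [h3, Set.mem_ofPred_eq]
      -- A value above ε/2 is nonzero, so the vertex is in the list of seen vertices and was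
      -- examined.
      refine ⟨fun hv => ⟨hv, (h.enum.mem v).1 ?_⟩, fun hv => hv.1⟩
      simp only [Set.mem_ofPred_eq]
      linarith
    · intro v
      rw [h3]

/-- The working memory is empty. -/
structure Clean (s : Config n) : Prop where
  visit : ∀ w, s.real (.visit w) = 0
  seenLen : s.word .seenLen = 0
  candLen : s.word .candLen = 0
  approx : ∀ j w, s.real (.approx j w) = 0
  resid : ∀ j i w, s.real (.resid j i w) = 0
  levelLen : ∀ j i, s.word (.levelLen j i) = 0
  count : ∀ k w, s.word (.count k w) = 0
  hitLen : s.word .hitLen = 0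

theorem Clean.visitedOne {L J N : ℕ} {s : Config n} (h : Clean s) (hs : s.used ⊆ cells n L J) :
    VisitedOne L J N s 0 s where
  frame := Frame.refl _ _
  nonneg := by simp [h.visit]
  enum := by
    rw [h.seenLen]
    exact Enum.nil (by simp [h.visit])
  sum := by simp [h.visit]
  len := by simp [h.seenLen]
  candLen := h.candLen
  used := hs

theorem VisitedOne.setTime {L J N i : ℕ} {s₀ s : Config n} (h : VisitedOne L J N s₀ i s) (t : ℕ) :
    VisitedOne L J N s₀ i (s.setTime t) :=
  ⟨h.frame.setTime t, h.nonneg, h.enum, h.sum, h.len, h.candLen, h.used⟩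

theorem VisitedOne.touch_seenLen {L J N i : ℕ} {s₀ s : Config n} (h : VisitedOne L J N s₀ i s) :
    VisitedOne L J N s₀ i (s.touch (.inr (.inr .seenLen))) :=
  ⟨h.frame.touch _, h.nonneg, h.enum, h.sum, h.len, h.candLen, by
    simp [Finset.insert_subset_iff, h.used]⟩

theorem sat_stageOne (A : AdjList G) {L J N : ℕ} {ε : ℝ} (hN : 0 < N) (hε : 0 < ε)
    (hJ : ∀ c : ℕ, c * ε ≤ L + 1 → c ≤ J) (u : Fin n) {s : Config n} (h : Clean s)
    (hs : s.used ⊆ cells n L J) :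
    Sat (stageOne A L ε u N) s fun _ s' => s'.time ≤ s.time + 23 * (N * (L + 1)) ∧
      AfterOne L J N ε s s' := by
  rw [stageOne_eq, sat_bind]
  refine (sat_walks A L u (visitOne N) (VisitedOne L J N s) (fun k s t h => h.setTime t) 7 N
    (fun i k _ w s' h' => (sat_visitOne hN h' k w).mono fun _ s'' h => ⟨h.1, h.2.1⟩) s
    (h.visitedOne hs)).mono ?_
  rintro _ s' ⟨h1, h2⟩
  rw [sat_bind, sat_readWord]
  refine (sat_extractLoop hN hε hJ h2.touch_seenLen).mono ?_
  rintro _ s'' ⟨h3, h4, -⟩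
  refine ⟨?_, h4⟩
  simp only [Config.touch_time] at h3
  -- Fourteen steps per visit, one per walk and seven per seen vertex; the read of the length is
  -- absorbed because `N > 0`.
  have : N * ((L + 1) * (7 + 7) + 1) = 14 * (N * (L + 1)) + N := by ring
  have : N ≤ N * (L + 1) := Nat.le_mul_of_pos_right _ (by omega)
  omega

/-- The visit value of `v` is an additive functional with weight 1/(2N) at `v`, and the extraction
of the candidates leaves it unchanged. -/
theorem wp_stageOne_exp_le [DecidableRel G.Adj] (hG : ∀ v, 0 < G.degree v) (A : AdjList G)
    {L J N : ℕ} {ε : ℝ} (hN : 0 < N) (hε : 0 < ε)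
    (hJ : ∀ c : ℕ, c * ε ≤ L + 1 → c ≤ J) (u : Fin n) {s : Config n} (h : Clean s)
    (hs : s.used ⊆ cells n L J) (v : Fin n) (θ : ℝ) :
    wp (stageOne A L ε u N)
        (fun _ s' => ENNReal.ofReal (Real.exp (θ * s'.real (.visit v)))) s
      ≤ ENNReal.ofReal (Real.exp (N * ((∑ k ∈ Finset.range (L + 1),
          1 / (2 * (N : ℝ)) * (lazyMatrix G ^ k) v u) *
          ((Real.exp (θ * ((L + 1) * (1 / (2 * (N : ℝ))))) - 1)
            / ((L + 1) * (1 / (2 * (N : ℝ)))))))) := by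
  have hpos : 0 < 1 / (2 * (N : ℝ)) := by positivity
  rw [stageOne_eq, wp_bind]
  have hsat := sat_walks A L u (visitOne N) (VisitedOne L J N s) (fun k s t h => h.setTime t) 7 N
    (fun i k _ w s' h' => (sat_visitOne hN h' k w).mono fun _ s'' h => ⟨h.1, h.2.1⟩) s
    (h.visitedOne hs)
  refine (wp_mono_of_sat (Q' := fun _ s' => ENNReal.ofReal (Real.exp (θ * s'.real (.visit v))))
    hsat ?_).trans ?_
  · rintro _ s' ⟨-, h2⟩
    refine wp_le_of_sat ?_
    rw [sat_bind, sat_readWord]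
    refine (sat_extractLoop hN hε hJ h2.touch_seenLen).mono ?_
    rintro _ s'' ⟨-, -, h3⟩
    rw [h3]
    rfl
  · have := wp_walks_exp_le hG A L u (visitOne N) (fun s' => ∃ i, VisitedOne L J N s i s')
      (fun s' t ⟨i, h⟩ => ⟨i, h.setTime t⟩) (fun s' => s'.real (.visit v)) (fun _ _ => rfl)
      (fun _ w => if v = w then 1 / (2 * (N : ℝ)) else 0) (1 / (2 * (N : ℝ))) hpos
      (fun k _ w => by split_ifs <;> linarith) (fun k _ w => by split_ifs <;> linarith)
      (fun k _ w s' ⟨i, h'⟩ => (sat_visitOne hN h' k w).mono fun _ s'' h =>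
        ⟨⟨_, h.2.1⟩, h.2.2 v⟩) θ s ⟨0, h.visitedOne hs⟩ N
    refine this.trans_eq ?_
    simp [h.visit]

end StageOne

end ERSketch

end

noncomputable section

namespace ERSketch

/-! ## Coordinate gradient descent -/

section Descent

variable {n : ℕ} {G : SimpleGraph (Fin n)}

/-- The memory contents that belong to one candidate. -/
structure CgdData (n : ℕ) where
  approx : Fin n → ℝ
  resid : ℕ → Fin n → ℝ
  level : ℕ → ℕ → Fin n
  len : ℕ → ℕ

/-- The memory contents that belong to the `j`-th candidate. -/
def Config.data (s : Config n) (j : ℕ) : CgdData n where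
  approx w := s.real (.approx j w)
  resid i w := s.real (.resid j i w)
  level i t := s.vert (.level j i t)
  len i := s.word (.levelLen j i)

/-- The list of level `i` consists of the vertices with residual on level `i`. -/
def CgdData.Listed (d : CgdData n) (i : ℕ) : Prop :=
  Enum (d.level i) (d.len i) {w | d.resid i w ≠ 0}

/-- The cells of level `i` of the `j`-th candidate. -/
def levelCells (n j i : ℕ) : Set (Cell n) := fun a => match a with
  | .inl (.resid j' i' _) => j' = j ∧ i' = i
  | .inr (.inl (.level j' i' _)) => j' = j ∧ i' = i
  | .inr (.inr (.levelLen j' i')) => j' = j ∧ i' = i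
  | _ => False

/-- The cells that are changed while level `i` of the `j`-th candidate is processed. -/
def relaxCells (n j i : ℕ) : Set (Cell n) := fun a => match a with
  | .inl (.approx j' _) => j' = j
  | .inl (.resid j' i' _) => j' = j ∧ (i' = i ∨ i' = i + 1)
  | .inr (.inl (.level j' i' _)) => j' = j ∧ i' = i + 1
  | .inr (.inr (.levelLen j' i')) => j' = j ∧ i' = i + 1
  | _ => False

/-- The cells of the `j`-th candidate. -/
def cgdCells (n j : ℕ) : Set (Cell n) := fun a => match a with
  | .inl (.approx j' _) => j' = j
  | .inl (.resid j' _ _) => j' = j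
  | .inr (.inl (.level j' _ _)) => j' = j
  | .inr (.inr (.levelLen j' _)) => j' = j
  | _ => False

theorem levelCells_subset_relaxCells (j i : ℕ) : levelCells n j (i + 1) ⊆ relaxCells n j i := by
  rintro ((_ | _ | _ | _) | (_ | _ | _ | _ | _) | (_ | _ | _ | _ | _ | _ | _ | _)) h
  all_goals first
    | exact False.elim h
    | exact h
    | exact ⟨h.1, Or.inr h.2⟩

theorem levelCells_subset_cgdCells (j i : ℕ) : levelCells n j i ⊆ cgdCells n j := by
  rintro ((_ | _ | _ | _) | (_ | _ | _ | _ | _) | (_ | _ | _ | _ | _ | _ | _ | _)) h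
  all_goals first
    | exact False.elim h
    | exact h.1

theorem relaxCells_subset_cgdCells (j i : ℕ) : relaxCells n j i ⊆ cgdCells n j := by
  rintro ((_ | _ | _ | _) | (_ | _ | _ | _ | _) | (_ | _ | _ | _ | _ | _ | _ | _)) h
  all_goals first
    | exact False.elim h
    | exact h.1
    | exact h

/-- Residual was added to level `i` of the `j`-th candidate at most `k` times, and `T h` is the
integral of the function `h` against the added residual. -/
structure Added (L J j i : ℕ) (s s' : Config n) (T : (Fin n → ℝ) → ℝ) (k : ℕ) : Prop where
  frame : Frame (levelCells n j i) s s'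
  sum : ∀ h : Fin n → ℝ, ∑ w, (s'.data j).resid i w * h w = ∑ w, (s.data j).resid i w * h w + T h
  nonneg : ∀ w, 0 ≤ (s'.data j).resid i w
  listed : (s'.data j).Listed i
  len : (s'.data j).len i ≤ (s.data j).len i + k
  used : s'.used ⊆ cells n L J

theorem Added.step {L J j i k : ℕ} {s s' : Config n} {T : (Fin n → ℝ) → ℝ}
    (h : Added L J j i s s' T k) : Added L J j i s s'.step T k :=
  ⟨h.1.step, h.2, h.3, h.4, h.5, h.6⟩

/-- Added residual is recorded by its integral against all test functions: mass bounds, monotonicity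
and conservation then follow by the choice of the function. Positivity of `y` keeps the list equal
to the support. -/
theorem sat_addResid {L J j i k : ℕ} (hj : j < J) (hi : i < L + 2) {s₀ s : Config n}
    {T T' : (Fin n → ℝ) → ℝ} (h : Added L J j i s₀ s T k) (w : Fin n) {y : ℝ} (hy : 0 < y)
    (hT : ∀ φ, T' φ = T φ + y * φ w) :
    Sat (addResid j i w y) s fun _ s' => s'.time ≤ s.time + 7 ∧
      Added L J j i s₀ s' T' (k + 1) := by
  have hupd : ∀ v, Function.update s.real (.resid j i w) (s.real (.resid j i w) + y)
      (.resid j i v) = s.real (.resid j i v) + if v = w then y else 0 := by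
    intro v
    by_cases hv : v = w
    · subst hv
      simp
    · rw [Function.update_of_ne (by simpa using hv), if_neg hv, add_zero]
  have hsum : ∀ φ : Fin n → ℝ, ∑ v, (s.real (.resid j i v) + if v = w then y else 0) * φ v
      = ∑ v, (s₀.data j).resid i v * φ v + T' φ := by
    intro φ
    simp only [add_mul, ite_mul, zero_mul]
    rw [Finset.sum_add_distrib, Finset.sum_ite_eq' Finset.univ w, if_pos (Finset.mem_univ w), hT,
      ← add_assoc, ← h.sum]
    rfl
  have hnonneg : ∀ v, 0 ≤ s.real (.resid j i v) + if v = w then y else 0 := by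
    intro v
    have : 0 ≤ s.real (.resid j i v) := h.nonneg v
    split_ifs <;> linarith
  have henum : Enum (fun t => s.vert (.level j i t)) (s.word (.levelLen j i))
    {w | s.real (.resid j i w) ≠ 0} := h.listed
  have hlen : s.word (.levelLen j i) ≤ n := le_of_inj henum.inj
  unfold addResid
  simp only [sat_bind, sat_readReal, sat_branch, sat_readWord, sat_writeVert, sat_writeWord,
    sat_arith, sat_writeReal, sat_pure]
  split_ifs with hx
  · have hlt : s.word (.levelLen j i) < n := by
      have : s.word (.levelLen j i) + 1 ≤ n :=
        le_of_inj (f := fun t => if t < s.word (.levelLen j i) then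
        s.vert (.level j i t) else w) (henum.push (a := w)
          (S' := insert w {w | s.real (.resid j i w) ≠ 0})
          (by simpa using hx) (fun i hi => by simp [hi]) (by simp) fun b => Iff.rfl).inj
      omega
    refine ⟨by simp, ⟨?_, ?_, ?_, ?_, ?_, ?_⟩⟩
    · exact ((((((((h.frame.touch _).step).touch _).setVert (by exact ⟨rfl, rfl⟩) _).setWord
        (by exact ⟨rfl, rfl⟩) _).step).setReal (by exact ⟨rfl, rfl⟩) _))
    · intro φ
      simp only [Config.data, Config.setReal_real, Config.step_real, Config.setWord_real,
        Config.setVert_real, Config.touch_real, hupd]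
      exact hsum φ
    · intro v
      simp only [Config.data, Config.setReal_real, Config.step_real, Config.setWord_real,
        Config.setVert_real, Config.touch_real, hupd]
      exact hnonneg v
    · unfold CgdData.Listed
      simp only [Config.data, Config.setReal_real, Config.step_real, Config.setWord_real,
        Config.setVert_real, Config.touch_real, Config.setReal_word, Config.setWord_word,
        Config.step_word,
        Function.update_self, Config.setReal_vert, Config.setWord_vert, Config.setVert_vert,
        Config.step_vert, Config.touch_vert, Config.touch_word]
      refine henum.push (a := w) (by simpa using hx) (fun i hi => ?_) (by simp) fun v => ?_
      · rw [Function.update_of_ne]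
        simpa using hi.ne
      · simp only [Set.mem_ofPred_eq]
        rw [hupd]
        by_cases hv : v = w
        · subst hv
          simp [hx, hy.ne']
        · simp [hv]
    · have := h.len
      simp only [Config.data, Config.setReal_word, Config.setWord_word,
        Config.step_word, Config.setVert_word, Config.touch_word, Function.update_self] at this ⊢
      omega
    · simp [Finset.insert_subset_iff, h.used, hlt, hj, hi]
  · refine ⟨by simp, ⟨?_, ?_, ?_, ?_, ?_, ?_⟩⟩
    · exact (((h.frame.touch _).step).step).setReal (by exact ⟨rfl, rfl⟩) _
    · intro φ
      simp only [Config.data, Config.setReal_real, Config.step_real, Config.touch_real, hupd]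
      exact hsum φ
    · intro v
      simp only [Config.data, Config.setReal_real, Config.step_real, Config.touch_real, hupd]
      exact hnonneg v
    · refine henum.congr (fun i hi => rfl) fun v => ?_
      simp only [Config.data, Config.setReal_real, Config.step_real, Config.touch_real,
        Set.mem_ofPred_eq]
      rw [hupd]
      by_cases hv : v = w
      · subst hv
        have : 0 ≤ s.real (.resid j i v) := h.nonneg v
        simp only [if_true]
        exact iff_of_true (by linarith) hx
      · simp [hv]
    · exact h.len.trans (Nat.le_succ _)
    · simp [Finset.insert_subset_iff, h.used, hj, hi]

/-- The program that moves the residual `x` of `w` from level `i` to level `i + 1`. -/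
def spread (A : AdjList G) (j i : ℕ) (w : Fin n) (x : ℝ) (d : ℕ) : M n Unit := do
  loop d () fun s _ => do
    let z ← neigh A w s
    let y ← arith (1 / (2 * (d : ℝ)) * x)
    addResid j (i + 1) z y
  let y ← arith (1 / 2 * x)
  addResid j (i + 1) w y

/-- The program that processes the `t`-th vertex of level `i`. -/
def relax (A : AdjList G) (L : ℕ) (R : ℝ) (j i t : ℕ) : M n Unit := do
  let w ← readVert (.level j i t)
  let x ← readReal (.resid j i w)
  let d ← deg A w
  branch (R / (L : ℝ) ^ 2 * (d : ℝ) < x)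
    (do
      let q ← readReal (.approx j w)
      writeReal (.approx j w) (q + x)
      spread A j i w x d
      writeReal (.resid j i w) 0)
    (pure ())

theorem cgd_eq (A : AdjList G) (L : ℕ) (R : ℝ) (j : ℕ) (v : Fin n) :
    cgd A L R j v = addResid j 0 v (1 / 2) >>= fun _ =>
      loop (L + 1) () fun i _ => readWord (.levelLen j i) >>= fun l =>
        loop l () fun t _ => relax A L R j i t := by
  unfold cgd relax spread
  simp only [bind_assoc]

variable [DecidableRel G.Adj]

/-- The integral of the spread residual is `x` times the mean over one lazy step from `w`. As the
degree `d` is at least 1, the `d + 1` additions number at most `2 * d`, and the time `10 * d + 8` is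
at most `18 * d`. -/
theorem sat_spread (hG : ∀ v, 0 < G.degree v) (A : AdjList G) {L J j i : ℕ} (hj : j < J)
    (hi : i + 1 < L + 2) {s : Config n} (hnonneg : ∀ w, 0 ≤ (s.data j).resid (i + 1) w)
    (hlisted : (s.data j).Listed (i + 1)) (hs : s.used ⊆ cells n L J) (w : Fin n) {x : ℝ}
    (hx : 0 < x) :
    Sat (spread A j i w x (A.nbrs w).length) s fun _ s' =>
      s'.time ≤ s.time + 18 * G.degree w ∧
      Added L J j (i + 1) s s' (fun h => x * (1 / 2 * h w +
        1 / 2 * (G.degree w : ℝ)⁻¹ * ∑ z ∈ G.neighborFinset w, h z)) (2 * G.degree w) := by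
  have hd := hG w
  have hy : 0 < 1 / (2 * ((A.nbrs w).length : ℝ)) * x := by
    rw [A.length_nbrs]
    positivity
  unfold spread
  rw [sat_bind]
  refine (sat_loop (fun t _ s' => s'.time ≤ s.time + 10 * t ∧ Added L J j (i + 1) s s'
    (fun h => ∑ t' ∈ Finset.range t,
      1 / (2 * ((A.nbrs w).length : ℝ)) * x * h ((A.nbrs w).getD t' w)) t)
    ⟨le_rfl, ⟨Frame.refl _ _, by simp, hnonneg, hlisted, le_rfl, hs⟩⟩ ?_).mono ?_
  · rintro t - - s' ⟨h1, h2⟩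
    rw [sat_bind, sat_neigh, sat_bind, sat_arith]
    refine (sat_addResid hj hi h2.step.step.step _ hy fun φ => Finset.sum_range_succ _ _).mono ?_
    rintro _ s'' ⟨h3, h4⟩
    refine ⟨h3.trans ?_, h4⟩
    simp only [Config.step_time]
    omega
  · rintro _ s' ⟨h1, h2⟩
    rw [sat_bind, sat_arith]
    have hT : ∀ φ : Fin n → ℝ, x * (1 / 2 * φ w +
        1 / 2 * (G.degree w : ℝ)⁻¹ * ∑ z ∈ G.neighborFinset w, φ z)
        = ∑ t' ∈ Finset.range (A.nbrs w).length,
          1 / (2 * ((A.nbrs w).length : ℝ)) * x * φ ((A.nbrs w).getD t' w) + 1 / 2 * x * φ w := by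
      intro φ
      rw [← Finset.mul_sum, A.sum_getD, A.length_nbrs]
      field_simp
      ring
    refine (sat_addResid hj hi h2.step w (by positivity) hT).mono ?_
    rintro _ s'' ⟨h3, h4⟩
    simp only [Config.step_time] at h3
    have hl := A.length_nbrs w
    exact ⟨by omega, h4.1, h4.2, h4.3, h4.4, h4.5.trans (by omega), h4.6⟩

/-- The functions `q` and `h` for which `∑ q_v q + ∑ r_{i,v} h_i` is invariant. -/
def Harmonic (G : SimpleGraph (Fin n)) [DecidableRel G.Adj] (L : ℕ) (q : Fin n → ℝ)
    (h : ℕ → Fin n → ℝ) : Prop :=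
  ∀ i ≤ L, ∀ w, h i w = q w + (1 / 2 * h (i + 1) w +
    1 / 2 * (G.degree w : ℝ)⁻¹ * ∑ z ∈ G.neighborFinset w, h (i + 1) z)

/-- What holds at any time during the descent from `v`. -/
structure CgdInv (G : SimpleGraph (Fin n)) [DecidableRel G.Adj] (L : ℕ) (v : Fin n)
    (d : CgdData n) : Prop where
  approx_nonneg : ∀ w, 0 ≤ d.approx w
  resid_nonneg : ∀ i w, 0 ≤ d.resid i w
  -- Needed for the reset of the memory, which clears `approx` along the level lists.
  approx_cover : ∀ w, d.approx w ≠ 0 → ∃ i < L + 2, ∃ t < d.len i, d.level i t = w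
  -- Weaker than `Listed`, because a processed level keeps relaxed vertices with residual 0 in its
  -- list.
  inj : ∀ i, ∀ t < d.len i, ∀ t' < d.len i, d.level i t = d.level i t' → t = t'
  cover : ∀ i w, d.resid i w ≠ 0 → i < L + 2 ∧ ∃ t < d.len i, d.level i t = w
  conserve : ∀ q h, Harmonic G L q h →
    ∑ w, d.approx w * q w + ∑ i ∈ Finset.range (L + 2), ∑ w, d.resid i w * h i w = 1 / 2 * h 0 v

/-- Conservation for `q = 0` and `h = 1`: relaxations move residual mass to the next level and keep
its total at 1/2. -/
theorem CgdInv.sum_resid_le {L : ℕ} {v : Fin n} {d : CgdData n} (hG : ∀ v, 0 < G.degree v)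
    (h : CgdInv G L v d) {i : ℕ} (hi : i < L + 2) : ∑ w, d.resid i w ≤ 1 / 2 := by
  have h1 := h.conserve (fun _ => 0) (fun _ _ => 1) fun i _ w => by
    have : (G.degree w : ℝ) ≠ 0 := by have := hG w; positivity
    simp only [Finset.sum_const, G.card_neighborFinset_eq_degree, nsmul_eq_mul]
    field_simp
    norm_num
  simp only [mul_zero, Finset.sum_const_zero, zero_add, mul_one] at h1
  rw [← h1]
  exact Finset.single_le_sum (f := fun i => ∑ w, d.resid i w)
    (fun i _ => Finset.sum_nonneg fun w _ => h.resid_nonneg i w) (Finset.mem_range.2 hi)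

/-- The three changes, `x * q w` in the approximation, `-x * h i w` on level `i` and `x` times the
lazy mean of `h (i + 1)` at `w` on the next level, cancel by harmonicity at `w`. -/
theorem conserve_push {L i : ℕ} (hi : i ≤ L) {d d' : CgdData n} {w : Fin n} {x c : ℝ}
    {q : Fin n → ℝ} {h : ℕ → Fin n → ℝ} (hh : Harmonic G L q h)
    (ha : ∀ z, d'.approx z = d.approx z + if z = w then x else 0)
    (hr : ∀ z, d'.resid i z = d.resid i z - if z = w then x else 0)
    (hr' : ∀ φ : Fin n → ℝ, ∑ z, d'.resid (i + 1) z * φ z = ∑ z, d.resid (i + 1) z * φ z +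
      x * (1 / 2 * φ w + 1 / 2 * (G.degree w : ℝ)⁻¹ * ∑ z ∈ G.neighborFinset w, φ z))
    (ho : ∀ i', i' ≠ i → i' ≠ i + 1 → d'.resid i' = d.resid i')
    (hd : ∑ w, d.approx w * q w + ∑ i ∈ Finset.range (L + 2), ∑ w, d.resid i w * h i w = c) :
    ∑ w, d'.approx w * q w + ∑ i ∈ Finset.range (L + 2), ∑ w, d'.resid i w * h i w = c := by
  have h1 : ∑ z, d'.approx z * q z = ∑ z, d.approx z * q z + x * q w := by
    simp only [ha, add_mul, ite_mul, zero_mul, Finset.sum_add_distrib, Finset.sum_ite_eq',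
      Finset.mem_univ, if_true]
  have h2 : ∀ i', ∑ z, d'.resid i' z * h i' z = ∑ z, d.resid i' z * h i' z
      + ((if i' = i then -(x * h i w) else 0) + if i' = i + 1 then x * (1 / 2 * h (i + 1) w +
        1 / 2 * (G.degree w : ℝ)⁻¹ * ∑ z ∈ G.neighborFinset w, h (i + 1) z) else 0) := by
    intro i'
    by_cases h3 : i' = i
    · subst h3
      simp only [hr, sub_mul, ite_mul, zero_mul, Finset.sum_sub_distrib, Finset.sum_ite_eq',
        Finset.mem_univ, if_true, left_eq_add, one_ne_zero, if_false, add_zero]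
      ring
    by_cases h4 : i' = i + 1
    · subst h4
      simp [hr']
    · rw [ho i' h3 h4, if_neg h3, if_neg h4, add_zero, add_zero]
  simp only [h1, h2, Finset.sum_add_distrib]
  rw [Finset.sum_ite_eq' (Finset.range (L + 2)) i, Finset.sum_ite_eq' (Finset.range (L + 2)) (i + 1),
    if_pos (Finset.mem_range.2 (by omega)), if_pos (Finset.mem_range.2 (by omega)), ← hd,
    hh i hi w]
  ring

/-- State of the descent while level `i` is processed. -/
structure Relaxing (G : SimpleGraph (Fin n)) [DecidableRel G.Adj] (L J : ℕ) (R : ℝ) (j i : ℕ)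
    (v : Fin n) (s₁ : Config n) (t : ℕ) (s : Config n) : Prop where
  frame : Frame (relaxCells n j i) s₁ s
  inv : CgdInv G L v (s.data j)
  listed : (s.data j).Listed (i + 1)
  low : ∀ t' < t, (s.data j).resid i ((s₁.data j).level i t') ≤
    R / (L : ℝ) ^ 2 * G.degree ((s₁.data j).level i t')
  -- `D` is the sum of the degrees of the vertices relaxed so far on level `i`. It is paid for by
  -- the mass that left the level, and in turn bounds the length of the next list and the time.
  cost : ∃ D : ℕ, R / (L : ℝ) ^ 2 * D + ∑ w, (s.data j).resid i w ≤ 1 / 2 ∧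
    (s.data j).len (i + 1) ≤ 2 * D ∧ s.time ≤ s₁.time + 5 * t + 21 * D
  used : s.used ⊆ cells n L J

/-- Residual moves only from level `i` to level `i + 1`. So the list of level `i` does not change
during its pass, and vertices already below the threshold stay there. -/
theorem sat_relax (hG : ∀ v, 0 < G.degree v) (A : AdjList G) {L J j i : ℕ} {R : ℝ} (hR : 0 ≤ R)
    (hj : j < J) (hi : i ≤ L) {v : Fin n} {s₁ s : Config n} {t : ℕ}
    (ht : t < (s₁.data j).len i) (h : Relaxing G L J R j i v s₁ t s) :
    Sat (relax A L R j i t) s.step fun _ => Relaxing G L J R j i v s₁ (t + 1) := by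
  obtain ⟨D, hD1, hD2, hD3⟩ := h.cost
  have hw : s.vert (.level j i t) = s₁.vert (.level j i t) :=
    h.frame.vert _ fun h => absurd h.2 (by omega)
  have hlen : s.word (.levelLen j i) = s₁.word (.levelLen j i) :=
    h.frame.word _ fun h => absurd h.2 (by omega)
  have htn : t < n := lt_of_lt_of_le (lt_of_lt_of_eq ht hlen.symm) (le_of_inj (h.inv.inj i))
  set w := s₁.vert (.level j i t) with hwdef
  unfold relax
  simp only [sat_bind, sat_readVert, sat_readReal, sat_deg, sat_branch, sat_pure, sat_writeReal]
  simp only [Config.touch_real, Config.step_real, Config.step_vert, hw]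
  set x := s.real (.resid j i w) with hx
  split_ifs with hlt
  · rw [A.length_nbrs] at hlt
    have hd0 : (0 : ℝ) ≤ R / (L : ℝ) ^ 2 * G.degree w := by positivity
    have hx0 : 0 < x := by linarith
    refine (sat_spread hG A (L := L) (i := i) hj (by omega) (x := x) ?_ ?_ ?_ w hx0).mono ?_
    · exact h.inv.resid_nonneg _
    · exact h.listed
    · simp [Finset.insert_subset_iff, h.used, hj]
      omega
    · rintro _ s' ⟨h1, h2⟩
      simp only [Config.setReal_time, Config.touch_time, Config.step_time] at h1
      have ha : ∀ z, ((s'.setReal (.resid j i w) 0).data j).approx z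
          = (s.data j).approx z + if z = w then x else 0 := by
        intro z
        have e := h2.frame.real (.approx j z) fun h => h
        simp only [Config.data, Config.setReal_real]
        rw [Function.update_of_ne (by simp), e]
        simp only [Config.setReal_real, Config.touch_real, Config.step_real]
        by_cases hz : z = w
        · subst hz
          simp
        · rw [Function.update_of_ne (by simpa using hz), if_neg hz, add_zero]
      have hrne : ∀ i', i' ≠ i + 1 → (s'.data j).resid i' = (s.data j).resid i' := by
        intro i' hi'
        funext z
        refine (h2.frame.real (.resid j i' z) fun h => hi' h.2).trans ?_
        simp [Config.data]
      have hri : ∀ z, ((s'.setReal (.resid j i w) 0).data j).resid i z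
          = (s.data j).resid i z - if z = w then x else 0 := by
        intro z
        rw [← hrne i (by omega)]
        by_cases hz : z = w
        · subst hz
          have : (s'.data j).resid i w = x := by rw [hrne i (by omega)]; rfl
          rw [this]
          simp [Config.data]
        · rw [if_neg hz, sub_zero]
          simp only [Config.data, Config.setReal_real]
          rw [Function.update_of_ne (by simpa using hz)]
      have hrs : ∀ i', i' ≠ i → ((s'.setReal (.resid j i w) 0).data j).resid i'
          = (s'.data j).resid i' := by
        intro i' hi'
        funext z
        simp only [Config.data, Config.setReal_real]
        rw [Function.update_of_ne (by simp [hi'])]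
      have hlv : ∀ i', i' ≠ i + 1 → (s'.data j).level i' = (s.data j).level i' := by
        intro i' hi'
        funext z
        exact h2.frame.vert (.level j i' z) fun h => hi' h.2
      have hln : ∀ i', i' ≠ i + 1 → (s'.data j).len i' = (s.data j).len i' := fun i' hi' =>
        h2.frame.word (.levelLen j i') fun h => hi' h.2
      have hsame : ∀ i', i' ≠ i + 1 → ∀ z, (∃ t < (s'.data j).len i', (s'.data j).level i' t = z) ↔
          ∃ t < (s.data j).len i', (s.data j).level i' t = z := by
        intro i' hi' z
        rw [hlv i' hi', hln i' hi']
      have hr1 : ∀ φ : Fin n → ℝ, ∑ z, (s'.data j).resid (i + 1) z * φ z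
          = ∑ z, (s.data j).resid (i + 1) z * φ z + x * (1 / 2 * φ w +
            1 / 2 * (G.degree w : ℝ)⁻¹ * ∑ z ∈ G.neighborFinset w, φ z) := by
        intro φ
        rw [h2.sum]
        simp [Config.data]
      -- Testing `hr1` on the indicator of `z` shows that residual on level `i + 1` does not
      -- decrease; vertices listed there remain listed.
      have hmono : ∀ z, (s.data j).resid (i + 1) z ≠ 0 → (s'.data j).resid (i + 1) z ≠ 0 := by
        intro z hz
        have h3 := hr1 (Pi.single z 1)
        simp only [Pi.single_apply, mul_ite, mul_one, mul_zero, Finset.sum_ite_eq',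
          Finset.mem_univ, if_true] at h3
        have h4 : 0 < (s.data j).resid (i + 1) z :=
          lt_of_le_of_ne (h.inv.resid_nonneg _ _) hz.symm
        have h6 : (0 : ℝ) ≤ x * ((if w = z then 1 / 2 else 0) +
            if z ∈ G.neighborFinset w then 1 / 2 * (G.degree w : ℝ)⁻¹ else 0) := by
          split_ifs <;> positivity
        linarith
      refine ⟨?_, ⟨?_, ?_, ?_, ?_, ?_, ?_⟩, ?_, ?_, ?_, ?_⟩
      · refine Frame.setReal (Frame.trans ?_ (h2.frame.mono (levelCells_subset_relaxCells j i)))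
          (by exact ⟨rfl, Or.inl rfl⟩) _
        exact ((((((h.frame.step).touch _).touch _).step).step).touch _).setReal
          (by exact (rfl : j = j)) _
      · intro z
        rw [ha]
        have := h.inv.approx_nonneg z
        split_ifs <;> linarith
      · intro i' z
        by_cases h3 : i' = i
        · subst h3
          rw [hri]
          by_cases h4 : z = w
          · subst h4
            simp [hx, Config.data]
          · simpa [h4] using h.inv.resid_nonneg i' z
        · rw [hrs i' h3]
          by_cases h4 : i' = i + 1
          · subst h4
            exact h2.nonneg z
          · rw [hrne i' h4]
            exact h.inv.resid_nonneg i' z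
      · intro z hz
        by_cases h3 : z = w
        · subst h3
          refine ⟨i, by omega, t, ?_, ?_⟩
          · exact lt_of_lt_of_eq ht ((hln i (by omega)).trans hlen).symm
          · exact (congrFun (hlv i (by omega)) t).trans hw
        · rw [ha, if_neg h3, add_zero] at hz
          obtain ⟨i', hi', h4⟩ := h.inv.approx_cover z hz
          refine ⟨i', hi', ?_⟩
          by_cases h5 : i' = i + 1
          · subst h5
            obtain ⟨t', ht', h6⟩ := h4
            have h7 : (s.data j).resid (i + 1) z ≠ 0 := h6 ▸ h.listed.mem_of_lt ht'
            exact (h2.listed.mem z).1 (hmono z h7)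
          · exact (hsame i' h5 z).2 h4
      · intro i'
        by_cases h3 : i' = i + 1
        · subst h3
          exact h2.listed.inj
        · change ∀ t < (s'.data j).len i', ∀ t' < (s'.data j).len i', (s'.data j).level i' t
            = (s'.data j).level i' t' → t = t'
          rw [hlv i' h3, hln i' h3]
          exact h.inv.inj i'
      · intro i' z hz
        by_cases h3 : i' = i + 1
        · subst h3
          rw [hrs _ (by omega)] at hz
          exact ⟨by omega, (h2.listed.mem z).1 hz⟩
        · have h4 : (s.data j).resid i' z ≠ 0 := by
            by_cases h5 : i' = i
            · subst h5
              rw [hri] at hz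
              intro h6
              by_cases h7 : z = w
              · subst h7
                have : x = 0 := h6
                exact hx0.ne' this
              · simp [h7, h6] at hz
            · rwa [hrs i' h5, hrne i' h3] at hz
          exact ⟨(h.inv.cover i' z h4).1, (hsame i' h3 z).2 (h.inv.cover i' z h4).2⟩
      · intro q φ hφ
        refine conserve_push hi hφ ha hri (fun ψ => ?_) (fun i' h3 h4 => ?_)
          (h.inv.conserve q φ hφ)
        · rw [hrs _ (by omega)]
          exact hr1 ψ
        · rw [hrs i' h3, hrne i' h4]
      · unfold CgdData.Listed
        rw [hrs _ (by omega)]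
        exact h2.listed
      · intro t' ht'
        rw [hri]
        rcases Nat.lt_succ_iff_lt_or_eq.1 ht' with ht' | rfl
        · have := h.low t' ht'
          split_ifs <;> linarith
        · have h3 : (s₁.data j).level i t' = w := rfl
          have h4 : (s.data j).resid i w = x := rfl
          rw [h3, h4, if_pos rfl, sub_self]
          exact hd0
      -- The residual `x` taken from level `i` exceeds R/L² times the degree, which pays for the
      -- increase of `D`.
      · refine ⟨D + G.degree w, ?_, ?_, ?_⟩
        · have h3 : ∑ z, ((s'.setReal (.resid j i w) 0).data j).resid i z
              = ∑ z, (s.data j).resid i z - x := by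
            simp only [hri, Finset.sum_sub_distrib, Finset.sum_ite_eq', Finset.mem_univ, if_true]
          rw [h3]
          push_cast
          linarith
        · have h3 : (s'.data j).len (i + 1) ≤ (s.data j).len (i + 1) + 2 * G.degree w := h2.len
          change (s'.data j).len (i + 1) ≤ _
          omega
        -- Beyond the five steps of an examined entry, a relaxation makes three accesses besides
        -- `spread`; they are charged to the degree, which is at least 1.
        · have := hG w
          simp only [Config.setReal_time]
          omega
      · simp [Finset.insert_subset_iff, h2.used, hj]
        omega
  · rw [A.length_nbrs] at hlt
    refine ⟨((((h.frame.step).touch _).touch _).step).step, h.inv, h.listed, ?_,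
      ⟨D, hD1, hD2, by simp; omega⟩, ?_⟩
    · intro t' ht'
      rcases Nat.lt_succ_iff_lt_or_eq.1 ht' with ht' | rfl
      · exact h.low t' ht'
      · exact not_lt.1 hlt
    · simp [Finset.insert_subset_iff, h.used, hj]
      omega

/-- Bound for the sum of the degrees of the vertices that are relaxed on one level. -/
def levelCost (L : ℕ) (R : ℝ) : ℝ := (L : ℝ) ^ 2 / (2 * R)

/-- State of the descent before level `i` is processed. -/
structure AtLevel (G : SimpleGraph (Fin n)) [DecidableRel G.Adj] (L J : ℕ) (R : ℝ) (j : ℕ)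
    (v : Fin n) (s₀ : Config n) (i : ℕ) (s : Config n) : Prop where
  frame : Frame (cgdCells n j) s₀ s
  inv : CgdInv G L v (s.data j)
  listed : ∀ i' ≥ i, (s.data j).Listed i'
  empty : ∀ i' > i, (s.data j).len i' = 0
  low : ∀ i' < i, ∀ w, (s.data j).resid i' w ≤ R / (L : ℝ) ^ 2 * G.degree w
  lens : ((∑ i' ∈ Finset.range (i + 1), (s.data j).len i' : ℕ) : ℝ) ≤ 1 + 2 * i * levelCost L R
  time : (s.time : ℝ) ≤ s₀.time + 7 + 2 * i
    + 5 * (∑ i' ∈ Finset.range i, (s.data j).len i' : ℕ) + 21 * i * levelCost L R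
  used : s.used ⊆ cells n L J

theorem sat_level (hG : ∀ v, 0 < G.degree v) (A : AdjList G) {L J j i : ℕ} {R : ℝ} (hL : 1 ≤ L)
    (hR : 0 < R) (hj : j < J) (hi : i ≤ L) {v : Fin n} {s₀ s : Config n}
    (h : AtLevel G L J R j v s₀ i s) :
    Sat (readWord (.levelLen j i) >>= fun l => loop l () fun t _ => relax A L R j i t) s.step
      fun _ => AtLevel G L J R j v s₀ (i + 1) := by
  rw [sat_bind, sat_readWord]
  set s₁ := s.step.touch (Sum.inr (Sum.inr (.levelLen j i))) with hs₁
  have hR' : 0 ≤ R / (L : ℝ) ^ 2 := by positivity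
  have hdata : s₁.data j = s.data j := rfl
  have hs₁u : s₁.used ⊆ cells n L J := by
    simp [hs₁, Finset.insert_subset_iff, h.used, hj]
    omega
  refine (sat_loop (fun t _ => Relaxing G L J R j i v s₁ t) ?_ fun t ht _ s' hs' =>
    sat_relax hG A hR.le hj hi ht hs').mono ?_
  -- `D = 0` is admissible at the start since the list of the next level is still empty and the mass
  -- of the level is at most 1/2.
  · refine ⟨Frame.refl _ _, h.inv, h.listed _ (Nat.le_succ i), by simp, ⟨0, ?_, ?_, le_rfl⟩, hs₁u⟩
    · rw [hdata]
      simpa using h.inv.sum_resid_le hG (i := i) (by omega)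
    · exact (h.empty (i + 1) (Nat.lt_succ_self i)).le
  · rintro _ s' h'
    obtain ⟨D, hD1, hD2, hD3⟩ := h'.cost
    have hDle : (D : ℝ) ≤ levelCost L R := by
      have h0 : 0 ≤ ∑ w, (s'.data j).resid i w :=
        Finset.sum_nonneg fun w _ => h'.inv.resid_nonneg i w
      have hL0 : (0 : ℝ) < (L : ℝ) ^ 2 := by positivity
      unfold levelCost
      rw [le_div_iff₀ (by positivity)]
      have h1 : R / (L : ℝ) ^ 2 * D ≤ 1 / 2 := by linarith
      have h2 := mul_le_mul_of_nonneg_right h1 hL0.le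
      have h3 : R / (L : ℝ) ^ 2 * D * (L : ℝ) ^ 2 = R * D := by field_simp
      linarith
    have hlv : ∀ i', i' ≠ i + 1 → (s'.data j).level i' = (s.data j).level i' := by
      intro i' hi'
      funext z
      exact h'.frame.vert (.level j i' z) fun h => hi' h.2
    have hln : ∀ i', i' ≠ i + 1 → (s'.data j).len i' = (s.data j).len i' := fun i' hi' =>
      h'.frame.word (.levelLen j i') fun h => hi' h.2
    have hrs : ∀ i', i' ≠ i → i' ≠ i + 1 → (s'.data j).resid i' = (s.data j).resid i' := by
      intro i' hi' hi''
      funext z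
      exact h'.frame.real (.resid j i' z) fun h => h.2.elim hi' hi''
    have hsum : ∑ i' ∈ Finset.range (i + 1), (s'.data j).len i'
        = ∑ i' ∈ Finset.range (i + 1), (s.data j).len i' :=
      Finset.sum_congr rfl fun i' hi' => hln i' (by have := Finset.mem_range.1 hi'; omega)
    refine ⟨h.frame.trans ?_, h'.inv, ?_, ?_, ?_, ?_, ?_, h'.used⟩
    · exact (((Frame.refl _ s).step.touch _).trans (h'.frame.mono (relaxCells_subset_cgdCells j i)))
    · intro i' hi'
      by_cases h3 : i' = i + 1
      · subst h3
        exact h'.listed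
      · unfold CgdData.Listed
        rw [hlv i' h3, hln i' h3, hrs i' (by omega) h3]
        exact h.listed i' (by omega)
    · intro i' hi'
      rw [hln i' (by omega)]
      exact h.empty i' (by omega)
    · intro i' hi' w
      by_cases h3 : i' = i
      · subst h3
        -- A vertex with nonzero residual occurs in the list and was examined; for all others the
        -- bound is trivial.
        by_cases h4 : (s'.data j).resid i' w = 0
        · rw [h4]
          positivity
        · obtain ⟨-, t, ht, htw⟩ := h'.inv.cover i' w h4
          rw [hln i' (by omega)] at ht
          rw [hlv i' (by omega)] at htw
          have := h'.low t ht
          rw [hdata, htw] at this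
          exact this
      · rw [hrs i' h3 (by omega)]
        exact h.low i' (by omega) w
    · rw [Finset.sum_range_succ, hsum]
      have h3 := h.lens
      have h4 : (((s'.data j).len (i + 1) : ℕ) : ℝ) ≤ 2 * D := by exact_mod_cast hD2
      push_cast at h3 ⊢
      linarith
    · rw [hsum, Finset.sum_range_succ]
      have h3 := h.time
      have h4 : (s'.time : ℝ) ≤ (s.time + 1 + 1 : ℕ) + 5 * ((s.data j).len i : ℕ) + 21 * D := by
        exact_mod_cast hD3
      push_cast at h3 h4 ⊢
      linarith

/-- What holds for the data of the candidate `v` after the descent with threshold `R`. -/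
structure CgdDone (G : SimpleGraph (Fin n)) [DecidableRel G.Adj] (L : ℕ) (v : Fin n) (R : ℝ)
    (d : CgdData n) : Prop extends CgdInv G L v d where
  low : ∀ i ≤ L, ∀ w, d.resid i w ≤ R / (L : ℝ) ^ 2 * G.degree w
  lens : ((∑ i ∈ Finset.range (L + 2), d.len i : ℕ) : ℝ) ≤ 1 + 2 * (L + 1) * levelCost L R
  above : ∀ i ≥ L + 2, d.len i = 0

/-- The data of a candidate before the descent. -/
structure CgdData.Empty (d : CgdData n) : Prop where
  approx : ∀ w, d.approx w = 0
  resid : ∀ i w, d.resid i w = 0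
  len : ∀ i, d.len i = 0

/-- The constants: 7 steps for the first `addResid`, two per level, five per list entry and 21 per
unit of relaxed degree. At most `1 + 2 * (L + 1) * levelCost L R` list entries turn this into 12 = 7
+ 5 and 31 = 21 + 10. -/
theorem sat_cgd (hG : ∀ v, 0 < G.degree v) (A : AdjList G) {L J j : ℕ} {R : ℝ} (hL : 1 ≤ L)
    (hR : 0 < R) (hj : j < J) (v : Fin n) {s : Config n} (h : (s.data j).Empty)
    (hs : s.used ⊆ cells n L J) :
    Sat (cgd A L R j v) s fun _ s' => Frame (cgdCells n j) s s' ∧ CgdDone G L v R (s'.data j) ∧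
      (s'.time : ℝ) ≤ s.time + (12 + 2 * (L + 1) + 31 * (L + 1) * levelCost L R) ∧
      s'.used ⊆ cells n L J := by
  have hlist : ∀ i, (s.data j).Listed i := fun i => by
    unfold CgdData.Listed
    rw [h.len]
    exact Enum.nil (by simp [h.resid])
  rw [cgd_eq, sat_bind]
  refine (sat_addResid (T := fun _ => 0) (T' := fun φ => 1 / 2 * φ v) (k := 0) hj
    (by omega : 0 < L + 2) ⟨Frame.refl _ _, by simp, by simp [h.resid], hlist 0, le_rfl, hs⟩ v
    (by norm_num) (by simp)).mono ?_
  rintro _ s₁ ⟨h1, h2⟩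
  have hr : ∀ i, i ≠ 0 → (s₁.data j).resid i = (s.data j).resid i := by
    intro i hi
    funext z
    exact h2.frame.real (.resid j i z) fun h => hi h.2
  have hr0 : ∀ i w, i ≠ 0 → (s₁.data j).resid i w = 0 := fun i w hi => by rw [hr i hi, h.resid]
  have ha : ∀ w, (s₁.data j).approx w = 0 := fun w =>
    (h2.frame.real (.approx j w) fun h => h).trans (h.approx w)
  have hln : ∀ i, i ≠ 0 → (s₁.data j).len i = 0 := fun i hi =>
    (h2.frame.word (.levelLen j i) fun h => hi h.2).trans (h.len i)
  have hl0 : (s₁.data j).len 0 ≤ 1 := by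
    have := h2.len
    rwa [h.len] at this
  refine (sat_loop (fun i _ => AtLevel G L J R j v s i) ?_ fun i hi _ s' hs' =>
    sat_level hG A hL hR hj (by omega) hs').mono ?_
  · refine ⟨h2.frame.mono (levelCells_subset_cgdCells j 0), ⟨by simp [ha], ?_, by simp [ha], ?_, ?_,
      ?_⟩, ?_, ?_, by simp, ?_, ?_, h2.used⟩
    · intro i w
      by_cases hi : i = 0
      · subst hi
        exact h2.nonneg w
      · exact (hr0 i w hi).ge
    · intro i
      by_cases hi : i = 0
      · subst hi
        exact h2.listed.inj
      · simp [hln i hi]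
    · intro i w hw
      by_cases hi : i = 0
      · subst hi
        exact ⟨by omega, (h2.listed.mem w).1 hw⟩
      · exact absurd (hr0 i w hi) hw
    · intro q φ _
      rw [Finset.sum_range_succ', h2.sum]
      simp [ha, hr0, h.resid]
    · intro i _
      by_cases hi : i = 0
      · subst hi
        exact h2.listed
      · unfold CgdData.Listed
        rw [hln i hi]
        exact Enum.nil (by simp [hr0 i _ hi])
    · intro i hi
      exact hln i (by omega)
    · rw [Finset.sum_range_one]
      have : (((s₁.data j).len 0 : ℕ) : ℝ) ≤ 1 := by exact_mod_cast hl0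
      simpa using this
    · have : (s₁.time : ℝ) ≤ s.time + 7 := by exact_mod_cast h1
      simpa using this
  · rintro _ s' h'
    have hlens := h'.lens
    push_cast at hlens
    refine ⟨h'.frame, ⟨h'.inv, fun i hi => h'.low i (by omega), by push_cast; exact hlens,
      fun i hi => h'.empty i (by omega)⟩, ?_,
      h'.used⟩
    have h3 := h'.time
    have h4 : ∑ i ∈ Finset.range (L + 1), (((s'.data j).len i : ℕ) : ℝ)
        ≤ ∑ i ∈ Finset.range (L + 1 + 1), (((s'.data j).len i : ℕ) : ℝ) := by
      rw [Finset.sum_range_succ _ (L + 1)]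
      linarith [Nat.cast_nonneg (α := ℝ) ((s'.data j).len (L + 1))]
    push_cast at h3
    linarith

/-- The cells that are changed by the second stage. -/
def stageTwoCells (n : ℕ) : Set (Cell n) := fun a => match a with
  | .inl (.approx _ _) => True
  | .inl (.resid _ _ _) => True
  | .inr (.inl (.level _ _ _)) => True
  | .inr (.inr (.levelLen _ _)) => True
  | _ => False

theorem cgdCells_subset_stageTwoCells (j : ℕ) : cgdCells n j ⊆ stageTwoCells n := by
  rintro ((_ | _ | _ | _) | (_ | _ | _ | _ | _) | (_ | _ | _ | _ | _ | _ | _ | _)) h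
  all_goals first
    | exact False.elim h
    | exact trivial

theorem Frame.data_eq {X : Set (Cell n)} {s s' : Config n} (h : Frame X s s') (j : ℕ)
    (h1 : ∀ w, Sum.inl (.approx j w) ∉ X) (h2 : ∀ i w, Sum.inl (.resid j i w) ∉ X)
    (h3 : ∀ i t, Sum.inr (Sum.inl (.level j i t)) ∉ X)
    (h4 : ∀ i, Sum.inr (Sum.inr (.levelLen j i)) ∉ X) : s'.data j = s.data j := by
  unfold Config.data
  congr 1
  · exact funext fun w => h.real _ (h1 w)
  · exact funext fun i => funext fun w => h.real _ (h2 i w)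
  · exact funext fun i => funext fun t => h.vert _ (h3 i t)
  · exact funext fun i => h.word _ (h4 i)

/-- State after the second stage, which was started in `s₀`. -/
structure AfterTwo (G : SimpleGraph (Fin n)) [DecidableRel G.Adj] (L J : ℕ) (rmax : ℝ)
    (s₀ : Config n) (c : ℕ) (s : Config n) : Prop where
  frame : Frame (stageTwoCells n) s₀ s
  done : ∀ j < c, CgdDone G L (s₀.vert (.cand j))
    (rmax / (2 * s₀.real (.visit (s₀.vert (.cand j))))) (s.data j)
  empty : ∀ j ≥ c, (s.data j).Empty
  used : s.used ⊆ cells n L J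

theorem sat_stageTwo (hG : ∀ v, 0 < G.degree v) (A : AdjList G) {L J : ℕ} {rmax : ℝ} (hL : 1 ≤ L)
    (hr : 0 < rmax) {s : Config n} (hJ : s.word .candLen ≤ J)
    (hp : ∀ j < s.word .candLen, 0 < s.real (.visit (s.vert (.cand j))))
    (hd : ∀ j, (s.data j).Empty) (hs : s.used ⊆ cells n L J) :
    Sat (stageTwo A L rmax) s fun _ s' => AfterTwo G L J rmax s (s.word .candLen) s' ∧
      (s'.time : ℝ) ≤ s.time + 1 + ∑ j ∈ Finset.range (s.word .candLen), (16 + 2 * (L + 1) +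
        31 * (L + 1) * levelCost L (rmax / (2 * s.real (.visit (s.vert (.cand j)))))) := by
  unfold stageTwo
  rw [sat_bind, sat_readWord]
  refine sat_loop (fun t _ s' => AfterTwo G L J rmax s t s' ∧
      (s'.time : ℝ) ≤ s.time + 1 + ∑ j ∈ Finset.range t, (16 + 2 * (L + 1) +
        31 * (L + 1) * levelCost L (rmax / (2 * s.real (.visit (s.vert (.cand j)))))))
    ⟨⟨(Frame.refl _ _).touch _, by simp, fun j _ => hd j, ?_⟩, by simp⟩ ?_
  · simp [Finset.insert_subset_iff, hs]
  · rintro j hj - s' ⟨h, ht⟩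
    have hv : s'.vert (.cand j) = s.vert (.cand j) := h.frame.vert _ fun h => h
    have hx : s'.real (.visit (s.vert (.cand j))) = s.real (.visit (s.vert (.cand j))) :=
      h.frame.real _ fun h => h
    have hpj := hp j hj
    simp only [sat_bind, sat_readVert, sat_readReal, sat_arith]
    simp only [Config.touch_real, Config.step_real, Config.step_vert, hv, hx]
    refine (sat_cgd hG A hL (R := rmax / (2 * s.real (.visit (s.vert (.cand j)))))
      (by positivity) (lt_of_lt_of_le hj hJ) _ ?_ ?_).mono ?_
    · exact h.empty j le_rfl
    · simp [Finset.insert_subset_iff, h.used, lt_of_lt_of_le hj hJ]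
    · rintro _ s'' ⟨h1, h2, h3, h4⟩
      -- Each candidate has its own arrays, so finished descents persist and later ones still start
      -- from empty data.
      have hdata : ∀ j' ≠ j, s''.data j' = s'.data j' := fun j' hj' =>
        h1.data_eq j' (fun _ h => hj' h) (fun _ _ h => hj' h) (fun _ _ h => hj' h) (fun _ h => hj' h)
      refine ⟨⟨h.frame.trans ?_, ?_, ?_, h4⟩, ?_⟩
      · exact ((((Frame.refl _ s').step.touch _).touch _).step).trans
          (h1.mono (cgdCells_subset_stageTwoCells j))
      · intro j' hj'
        rcases Nat.lt_succ_iff_lt_or_eq.1 hj' with hj' | rfl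
        · rw [hdata j' hj'.ne]
          exact h.done j' hj'
        · exact h2
      · intro j' hj'
        rw [hdata j' (by omega)]
        exact h.empty j' (by omega)
      · rw [Finset.sum_range_succ]
        simp only [Config.step_time, Config.touch_time] at h3
        push_cast at h3
        linarith

end Descent

end ERSketch

end

noncomputable section

namespace ERSketch

open scoped ENNReal

/-! ## Third stage -/

section StageThree

variable {n : ℕ} {G : SimpleGraph (Fin n)}

/-- The cells that are changed by the third stage. -/
def stageThreeCells (n : ℕ) : Set (Cell n) := fun a => match a with
  | .inr (.inl (.hitVertex _)) => True
  | .inr (.inr .hitLen) => True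
  | .inr (.inr (.hitStep _)) => True
  | .inr (.inr (.count _ _)) => True
  | _ => False

/-- The program that is run for each vertex met by a walk of the third stage. -/
def visitThree (k : ℕ) (w : Fin n) : M n Unit := do
  let x ← readWord (.count k w)
  branch (x = 0)
    (do
      let t ← readWord .hitLen
      writeWord (.hitStep t) k
      writeVert (.hitVertex t) w
      writeWord .hitLen (t + 1))
    (pure ())
  writeWord (.count k w) (x + 1)

theorem stageThree_eq (A : AdjList G) (L : ℕ) (u : Fin n) (N : ℕ) :
    stageThree A L u N = loop N () fun _ _ => lazyWalk A L u visitThree := rfl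

/-- State of the third stage after `i` visits. -/
structure VisitedThree (L J : ℕ) (s₀ : Config n) (i : ℕ) (s : Config n) : Prop where
  frame : Frame (stageThreeCells n) s₀ s
  enum : Enum (fun t => (s.word (.hitStep t), s.vert (.hitVertex t))) (s.word .hitLen)
    {p | s.word (.count p.1 p.2) ≠ 0}
  step_le : ∀ k w, s.word (.count k w) ≠ 0 → k ≤ L
  len : s.word .hitLen ≤ i
  used : s.used ⊆ cells n L J

theorem VisitedThree.setTime {L J i : ℕ} {s₀ s : Config n} (h : VisitedThree L J s₀ i s) (t : ℕ) :
    VisitedThree L J s₀ i (s.setTime t) :=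
  ⟨h.frame.setTime t, h.enum, h.step_le, h.len, h.used⟩

/-- The walks make steps 0, …, L on `n` vertices, which bounds the number of distinct (step, vertex)
pairs whatever the number of walks. -/
theorem le_of_inj_pair {L : ℕ} {f : ℕ → ℕ × Fin n} {l : ℕ}
    (hf : ∀ i < l, ∀ j < l, f i = f j → i = j) (hl : ∀ i < l, (f i).1 ≤ L) :
    l ≤ (L + 1) * n := by
  have h := le_card_of_inj hf (Finset.range (L + 1) ×ˢ Finset.univ) fun i hi =>
    Finset.mem_product.2 ⟨Finset.mem_range.2 (Nat.lt_succ_of_le (hl i hi)), Finset.mem_univ _⟩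
  simpa using h

theorem VisitedThree.hitLen_le {L J i : ℕ} {s₀ s : Config n} (h : VisitedThree L J s₀ i s) :
    s.word .hitLen ≤ (L + 1) * n :=
  le_of_inj_pair h.enum.inj fun _ ht => h.step_le _ _ (h.enum.mem_of_lt ht)

theorem sat_visitThree {L J : ℕ} {s₀ s : Config n} {i : ℕ}
    (h : VisitedThree L J s₀ i s) {k : ℕ} (hk : k ≤ L) (w : Fin n) :
    Sat (visitThree k w) s fun _ s' => s'.time ≤ s.time + 7 ∧ VisitedThree L J s₀ (i + 1) s' ∧
      ∀ k' w', s'.word (.count k' w') = s.word (.count k' w') +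
        if k' = k ∧ w' = w then 1 else 0 := by
  have hupd : ∀ f : WordCell n → ℕ, (∀ k' w', f (.count k' w') = s.word (.count k' w')) →
      ∀ k' w', Function.update f (.count k w) (s.word (.count k w) + 1)
      (.count k' w') = s.word (.count k' w') + if k' = k ∧ w' = w then 1 else 0 := by
    intro f hf k' w'
    by_cases hv : k' = k ∧ w' = w
    · obtain ⟨rfl, rfl⟩ := hv
      simp
    · rw [Function.update_of_ne (by simpa using hv), if_neg hv, add_zero, hf]
  have hlen := h.hitLen_le
  unfold visitThree
  simp only [sat_bind, sat_readWord, sat_branch, sat_writeVert, sat_writeWord, sat_pure]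
  split_ifs with hx
  · have hlt : s.word .hitLen < (L + 1) * n := by
      have hp : Enum (fun t => if t < s.word .hitLen then
        (s.word (.hitStep t), s.vert (.hitVertex t)) else (k, w)) (s.word .hitLen + 1)
        (insert (k, w) {p | s.word (.count p.1 p.2) ≠ 0}) := h.enum.push (a := (k, w))
          (by simpa using hx) (fun i hi => by simp [hi]) (by simp) fun b => Iff.rfl
      have : s.word .hitLen + 1 ≤ (L + 1) * n := le_of_inj_pair hp.inj fun t ht => by
        have h1 := hp.mem_of_lt ht
        rcases h1 with h1 | h1
        · rw [h1]
          exact hk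
        · exact h.step_le _ _ h1
      omega
    have hc : ∀ k' w', Function.update (Function.update (Function.update s.word
        (.hitStep (s.word .hitLen)) k) .hitLen (s.word .hitLen + 1)) (.count k w)
        (s.word (.count k w) + 1) (.count k' w')
        = s.word (.count k' w') + if k' = k ∧ w' = w then 1 else 0 :=
      hupd _ fun k' w' => by simp
    refine ⟨by simp, ⟨?_, ?_, ?_, ?_, ?_⟩, ?_⟩
    · exact ((((((h.frame.touch _).step).touch _).setWord (by trivial) _).setVert (by trivial)
        _).setWord (by trivial) _).setWord (by trivial) _
    · simp only [Config.setWord_word, Config.setVert_word, Config.touch_word, Config.step_word,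
        Config.setWord_vert, Config.setVert_vert, Config.touch_vert, Config.step_vert, hc]
      rw [Function.update_of_ne (a := WordCell.hitLen) (by simp), Function.update_self]
      refine h.enum.push (a := (k, w)) (by simpa using hx) (fun i hi => ?_) (by simp) fun v => ?_
      · rw [Function.update_of_ne (by simp), Function.update_of_ne (by simp),
          Function.update_of_ne (by simpa using hi.ne), Function.update_of_ne (by simpa using hi.ne)]
      · simp only [Set.mem_ofPred_eq]
        by_cases hv : v = (k, w)
        · subst hv
          simp
        · have : ¬ (v.1 = k ∧ v.2 = w) := fun h => hv (Prod.ext h.1 h.2)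
          simp [hv, this]
    · intro k' w' h'
      simp only [Config.setWord_word, Config.setVert_word, Config.touch_word, Config.step_word,
        hc] at h'
      by_cases hv : k' = k ∧ w' = w
      · rw [hv.1]
        exact hk
      · rw [if_neg hv, add_zero] at h'
        exact h.step_le _ _ h'
    · simp
      exact h.len
    · simp only [Config.setWord_used, Config.setVert_used, Config.touch_used, Config.step_used,
        Finset.insert_subset_iff, h.used, Config.step_word, Config.touch_word]
      simp [hlt]
      omega
    · intro k' w'
      exact hc k' w'
  · have hc := hupd s.word fun _ _ => rfl
    refine ⟨by simp, ⟨?_, ?_, ?_, ?_, ?_⟩, ?_⟩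
    · exact (((h.frame.touch _).step)).setWord (by trivial) _
    · simp only [Config.setWord_word, Config.touch_word, Config.step_word,
        Config.setWord_vert, Config.touch_vert, Config.step_vert, hc]
      rw [Function.update_of_ne (a := WordCell.hitLen) (by simp)]
      refine h.enum.congr (fun i hi => ?_) fun v => ?_
      · rw [Function.update_of_ne (by simp)]
      · simp only [Set.mem_ofPred_eq]
        by_cases hv : v.1 = k ∧ v.2 = w
        · simp only [hv, and_self, if_true]
          exact iff_of_true (by omega) hx
        · simp [hv]
    · intro k' w' h'
      simp only [Config.setWord_word, Config.touch_word, Config.step_word, hc] at h'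
      by_cases hv : k' = k ∧ w' = w
      · rw [hv.1]
        exact hk
      · rw [if_neg hv, add_zero] at h'
        exact h.step_le _ _ h'
    · simp
      exact h.len.trans (Nat.le_succ i)
    · simp [Finset.insert_subset_iff, h.used]
      omega
    · intro k' w'
      exact hc k' w'

theorem visitedThree_zero {L J : ℕ} {s : Config n} (hc : ∀ k w, s.word (.count k w) = 0)
    (hl : s.word .hitLen = 0) (hs : s.used ⊆ cells n L J) : VisitedThree L J s 0 s := by
  refine ⟨Frame.refl _ _, ?_, by simp [hc], hl.le, hs⟩
  rw [hl]
  exact Enum.nil (by simp [hc])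

theorem sat_stageThree (A : AdjList G) {L J : ℕ} (N : ℕ) (u : Fin n) {s : Config n}
    (hc : ∀ k w, s.word (.count k w) = 0) (hl : s.word .hitLen = 0) (hs : s.used ⊆ cells n L J) :
    Sat (stageThree A L u N) s fun _ s' => s'.time ≤ s.time + 15 * (N * (L + 1)) ∧
      VisitedThree L J s (N * (L + 1)) s' := by
  rw [stageThree_eq]
  refine (sat_walks A L u visitThree (VisitedThree L J s) (fun k s t h => h.setTime t) 7 N
    (fun i k hk w s' h' => (sat_visitThree h' hk w).mono fun _ s'' h => ⟨h.1, h.2.1⟩) s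
    (visitedThree_zero hc hl hs)).mono ?_
  rintro _ s' ⟨h1, h2⟩
  refine ⟨?_, h2⟩
  have : N * ((L + 1) * (7 + 7) + 1) = 14 * (N * (L + 1)) + N := by ring
  have : N ≤ N * (L + 1) := Nat.le_mul_of_pos_right _ (by omega)
  omega

/-- The integral of `f` against the visit counts. -/
def countSum (L : ℕ) (f : ℕ → Fin n → ℝ) (s : Config n) : ℝ :=
  ∑ k ∈ Finset.range (L + 1), ∑ w, f k w * (s.word (.count k w) : ℝ)

/-- The function `f` is arbitrary, so the same walks serve every candidate, each with its own
residual weights. -/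
theorem wp_stageThree_exp_le [DecidableRel G.Adj] (hG : ∀ v, 0 < G.degree v) (A : AdjList G)
    {L J : ℕ} (N : ℕ) (u : Fin n) {s : Config n}
    (hc : ∀ k w, s.word (.count k w) = 0) (hl : s.word .hitLen = 0) (hs : s.used ⊆ cells n L J)
    (f : ℕ → Fin n → ℝ) (b : ℝ) (hb : 0 < b) (hf : ∀ k ≤ L, ∀ w, 0 ≤ f k w)
    (hfb : ∀ k ≤ L, ∀ w, f k w ≤ b) (θ : ℝ) :
    wp (stageThree A L u N)
        (fun _ s' => ENNReal.ofReal (Real.exp (θ * countSum L f s'))) s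
      ≤ ENNReal.ofReal (Real.exp (N * ((∑ k ∈ Finset.range (L + 1),
          ∑ w, f k w * (lazyMatrix G ^ k) w u) *
          ((Real.exp (θ * ((L + 1) * b)) - 1) / ((L + 1) * b))))) := by
  rw [stageThree_eq]
  refine (wp_walks_exp_le hG A L u visitThree (fun s' => ∃ i, VisitedThree L J s i s')
      (fun s' t ⟨i, h⟩ => ⟨i, h.setTime t⟩) (countSum L f) (fun _ _ => rfl) f b hb hf hfb
      (fun k hk w s' ⟨i, h'⟩ => (sat_visitThree h' hk w).mono fun _ s'' h => ⟨⟨_, h.2.1⟩, ?_⟩)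
      θ s ⟨0, visitedThree_zero hc hl hs⟩ N).trans_eq ?_
  · unfold countSum
    simp only [h.2.2, Nat.cast_add, mul_add, Finset.sum_add_distrib, add_right_inj]
    rw [Finset.sum_eq_single k, Finset.sum_eq_single w]
    · simp
    · intro w' _ hw'
      simp [hw']
    · simp
    · intro k' _ hk'
      simp [hk']
    · intro h
      exact absurd (Finset.mem_range.2 (by omega)) h
  · simp [countSum, hc]

end StageThree

/-! ## Output -/

section Combine

variable {n : ℕ} {G : SimpleGraph (Fin n)}

/-- The value computed by `residSum`. -/
def residValue (G : SimpleGraph (Fin n)) [DecidableRel G.Adj] (L j : ℕ) (s : Config n) : ℝ :=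
  ∑ i ∈ Finset.range (L + 1), ∑ t ∈ Finset.range ((s.data j).len i),
    ∑ k ∈ Finset.range (L + 1 - i), (s.data j).resid i ((s.data j).level i t) /
      (G.degree ((s.data j).level i t) : ℝ) * (s.word (.count k ((s.data j).level i t)) : ℝ)

variable [DecidableRel G.Adj]

theorem Frame.eq_of_empty {s s' : Config n} (h : Frame ∅ s s') :
    s'.real = s.real ∧ s'.vert = s.vert ∧ s'.word = s.word :=
  ⟨funext fun a => h.real a (by simp), funext fun a => h.vert a (by simp),
    funext fun a => h.word a (by simp)⟩

theorem sat_residSum (A : AdjList G) {L J j : ℕ} (hj : j < J) {s : Config n}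
    (hlen : ∀ i, (s.data j).len i ≤ n) (hs : s.used ⊆ cells n L J) :
    Sat (residSum A L j) s fun a s' => a = residValue G L j s ∧ Frame ∅ s s' ∧
      s'.time ≤ s.time + 2 * (L + 1) +
        7 * (L + 1) * ∑ i ∈ Finset.range (L + 1), (s.data j).len i ∧ s'.used ⊆ cells n L J := by
  unfold residSum
  refine sat_loop (fun l a s' => a = ∑ i ∈ Finset.range l, ∑ t ∈ Finset.range ((s.data j).len i),
    ∑ k ∈ Finset.range (L + 1 - i), (s.data j).resid i ((s.data j).level i t) /
      (G.degree ((s.data j).level i t) : ℝ) * (s.word (.count k ((s.data j).level i t)) : ℝ) ∧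
    Frame ∅ s s' ∧ s'.time ≤ s.time + 2 * l +
        7 * (L + 1) * ∑ i ∈ Finset.range l, (s.data j).len i ∧ s'.used ⊆ cells n L J)
    ⟨by simp, Frame.refl _ _, by simp, hs⟩ ?_
  rintro i hi a s' ⟨h1, h2, h3, h4⟩
  rw [sat_bind, sat_readWord]
  obtain ⟨er, ev, ew⟩ := h2.eq_of_empty
  have hl : s'.step.word (.levelLen j i) = (s.data j).len i := by
    rw [Config.step_word, ew]
    rfl
  rw [hl]
  refine (sat_loop (fun l a' s'' => a' = a + ∑ t ∈ Finset.range l,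
    ∑ k ∈ Finset.range (L + 1 - i), (s.data j).resid i ((s.data j).level i t) /
      (G.degree ((s.data j).level i t) : ℝ) * (s.word (.count k ((s.data j).level i t)) : ℝ) ∧
    Frame ∅ s s'' ∧ s''.time ≤ s'.time + 2 + 7 * (L + 1) * l ∧ s''.used ⊆ cells n L J)
    ⟨by simp, (h2.step).touch _, by simp, ?_⟩ ?_).mono ?_
  · simp [Finset.insert_subset_iff, h4, hj]
    omega
  · rintro t ht a' s'' ⟨h5, h6, h7, h8⟩
    obtain ⟨er', ev', ew'⟩ := h6.eq_of_empty
    simp only [sat_bind, sat_readVert, sat_readReal, sat_deg]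
    simp only [Config.step_vert, Config.touch_real, Config.step_real, er', ev']
    simp only [A.length_nbrs]
    refine (sat_loop (fun l b s₃ => b = a' + ∑ k ∈ Finset.range l,
      (s.data j).resid i ((s.data j).level i t) /
      (G.degree ((s.data j).level i t) : ℝ) * (s.word (.count k ((s.data j).level i t)) : ℝ) ∧
      Frame ∅ s s₃ ∧ s₃.time ≤ s''.time + 4 + 3 * l ∧ s₃.used ⊆ cells n L J)
      ⟨by simp, (((h6.step).touch _).touch _).step, by simp, ?_⟩ ?_).mono ?_
    · have := hlen i
      simp [Finset.insert_subset_iff, h8, hj]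
      omega
    · rintro k hk b s₃ ⟨h9, h10, h11, h12⟩
      obtain ⟨-, -, ew₃⟩ := h10.eq_of_empty
      rw [sat_bind, sat_readWord, sat_arith]
      refine ⟨?_, ((h10.step).touch _).step, by simp; omega, ?_⟩
      · rw [Finset.sum_range_succ, ← add_assoc, ← h9, Config.step_word, ew₃]
        rfl
      · simp [Finset.insert_subset_iff, h12]
        omega
    · rintro b s₃ ⟨h9, h10, h11, h12⟩
      refine ⟨?_, h10, ?_, h12⟩
      · rw [Finset.sum_range_succ, ← add_assoc, ← h5]
        exact h9
      · have h13 : 7 * (L + 1) * (t + 1) = 7 * (L + 1) * t + 7 * (L + 1) := by ring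
        -- A list entry costs one iteration, two reads and a degree query, and then three steps for
        -- each admissible `k`.
        have h14 : 4 + 3 * (L + 1 - i) ≤ 7 * (L + 1) := by omega
        omega
  · rintro a' s'' ⟨h5, h6, h7, h8⟩
    refine ⟨?_, h6, ?_, h8⟩
    · rw [Finset.sum_range_succ, ← h1]
      exact h5
    · rw [Finset.sum_range_succ, mul_add (7 * (L + 1))]
      omega

/-- The cells that are changed by `combine` if the output has `o₀` entries before. -/
def outCells (n o₀ : ℕ) : Set (Cell n) := fun a => match a with
  | .inl (.outValue o) => o₀ ≤ o
  | .inr (.inl (.outVertex o)) => o₀ ≤ o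
  | .inr (.inr .outLen) => True
  | _ => False

/-- The output value for the `j`-th candidate. -/
def outputValue (G : SimpleGraph (Fin n)) [DecidableRel G.Adj] (L : ℕ) (u : Fin n) (N j : ℕ)
    (s : Config n) : ℝ :=
  (s.data j).approx u * (G.degree (s.vert (.cand j)) : ℝ) / (G.degree u : ℝ) +
    (G.degree (s.vert (.cand j)) : ℝ) / (N : ℝ) * residValue G L j s

/-- The value that the output entries from `o₀` on assign to `v`. -/
def entrySum (o₀ : ℕ) (s : Config n) (v : Fin n) : ℝ :=
  ∑ o ∈ Finset.Ico o₀ (s.word .outLen),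
    if s.vert (.outVertex o) = v then s.real (.outValue o) else 0

theorem residValue_congr {X : Set (Cell n)} {s s' : Config n} (h : Frame X s s') (L j : ℕ)
    (hd : s'.data j = s.data j) (hc : ∀ k w, Sum.inr (Sum.inr (.count k w)) ∉ X) :
    residValue G L j s' = residValue G L j s := by
  have hw : ∀ k w, s'.word (.count k w) = s.word (.count k w) := fun k w => h.word _ (hc k w)
  unfold residValue
  rw [hd]
  simp only [hw]

/-- The hypothesis `ho` leaves room for `J` further entries among the output cells. Entries before
the old length lie outside `outCells`, so earlier output survives. -/
theorem sat_combine (A : AdjList G) {L J : ℕ} (u : Fin n) (N : ℕ) {s : Config n}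
    (hc : s.word .candLen ≤ J) (ho : s.word .outLen + J ≤ n * J)
    (hlen : ∀ j i, (s.data j).len i ≤ n) (hs : s.used ⊆ cells n L J) :
    Sat (combine A L u N) s fun _ s' => Frame (outCells n (s.word .outLen)) s s' ∧
      s.word .outLen ≤ s'.word .outLen ∧ s'.word .outLen ≤ s.word .outLen + J ∧
      (∀ v, entrySum (s.word .outLen) s' v = ∑ j ∈ Finset.range (s.word .candLen),
        if s.vert (.cand j) = v ∧ G.degree v ≤ G.degree u then outputValue G L u N j s else 0) ∧
      s'.time ≤ s.time + 2 + ∑ j ∈ Finset.range (s.word .candLen), (12 + 2 * (L + 1) +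
        7 * (L + 1) * ∑ i ∈ Finset.range (L + 1), (s.data j).len i) ∧ s'.used ⊆ cells n L J := by
  unfold combine
  rw [sat_bind, sat_deg, sat_bind, sat_readWord]
  simp only [A.length_nbrs]
  refine (sat_loop (fun c _ s' => Frame (outCells n (s.word .outLen)) s s' ∧
      s.word .outLen ≤ s'.word .outLen ∧ s'.word .outLen ≤ s.word .outLen + c ∧
      (∀ v, entrySum (s.word .outLen) s' v = ∑ j ∈ Finset.range c,
        if s.vert (.cand j) = v ∧ G.degree v ≤ G.degree u then outputValue G L u N j s else 0) ∧
      s'.time ≤ s.time + 2 + ∑ j ∈ Finset.range c, (12 + 2 * (L + 1) +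
        7 * (L + 1) * ∑ i ∈ Finset.range (L + 1), (s.data j).len i) ∧ s'.used ⊆ cells n L J)
    ⟨((Frame.refl _ _).step).touch _, by simp, by simp, by simp [entrySum], by simp, ?_⟩ ?_).mono ?_
  · simp [Finset.insert_subset_iff, hs]
  · rintro j hj - s' ⟨h1, h2, h3, h4, h5, h6⟩
    have hjc : j < s.word .candLen := hj
    have hv : s'.vert (.cand j) = s.vert (.cand j) := h1.vert _ fun h => h
    have hdata : s'.data j = s.data j := h1.data_eq j (fun _ h => h) (fun _ _ h => h)
      (fun _ _ h => h) (fun _ h => h)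
    simp only [sat_bind, sat_readVert, sat_deg, sat_branch, sat_pure]
    simp only [Config.step_vert, hv]
    simp only [A.length_nbrs]
    split_ifs with hdeg
    · set s₁ := ((s'.step.touch (Sum.inr (Sum.inl (.cand j)))).step).step with hs₁
      have hs₁u : s₁.used ⊆ cells n L J := by
        simp [hs₁, Finset.insert_subset_iff, h6]
        omega
      refine (sat_residSum A (J := J) (by omega) (s := s₁) ?_ hs₁u).mono ?_
      · intro i
        change (s'.data j).len i ≤ n
        rw [hdata]
        exact hlen j i
      · rintro a s₂ ⟨h7, h8, h9, h10⟩
        obtain ⟨er, ev, ew⟩ := h8.eq_of_empty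
        simp only [sat_readReal, sat_arith, sat_readWord, sat_writeVert, sat_writeReal,
          sat_writeWord, Config.step_word, Config.touch_word]
        have hol : s₂.word .outLen = s'.word .outLen := by rw [ew]; rfl
        have ha : a = residValue G L j s := by
          rw [h7]
          exact residValue_congr h1 L j hdata fun _ _ h => h
        have hq : s₂.real (.approx j u) = (s.data j).approx u := by
          rw [er, ← hdata]
          rfl
        rw [ha, hq, hol]
        have hval : (s.data j).approx u * (G.degree (s.vert (.cand j)) : ℝ) / (G.degree u : ℝ) +
          (G.degree (s.vert (.cand j)) : ℝ) / (N : ℝ) * residValue G L j s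
          = outputValue G L u N j s := rfl
        rw [hval]
        have hfr : Frame ∅ s' s₁ := (((Frame.refl _ s').step.touch _).step).step
        refine ⟨h1.trans ?_, ?_, ?_, ?_, ?_, ?_⟩
        · exact (((((((hfr.trans h8).mono (Set.empty_subset _)).touch _).step).touch _).setVert
            (by exact h2) _).setReal (by exact h2) _).setWord (by trivial) _
        · simp
          omega
        · simp
          omega
        · intro v
          rw [Finset.sum_range_succ, ← h4]
          unfold entrySum
          simp only [Config.setWord_word, Function.update_self, Config.setWord_vert,
            Config.setReal_vert, Config.setVert_vert, Config.touch_vert, Config.step_vert,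
            Config.setWord_real, Config.setReal_real, Config.setVert_real, Config.touch_real,
            Config.step_real]
          rw [Finset.sum_Ico_succ_top h2]
          congr 1
          · refine Finset.sum_congr rfl fun o ho' => ?_
            have := (Finset.mem_Ico.1 ho').2
            have hne : VertCell.outVertex o ≠ .outVertex (s'.word .outLen) := by
              simpa using this.ne
            have hne' : (RealCell.outValue o : RealCell n) ≠ .outValue (s'.word .outLen) := by
              simpa using this.ne
            simp only [Function.update_of_ne hne, Function.update_of_ne hne', ev, er]
            rfl
          · simp only [Function.update_self]
            by_cases hvv : s.vert (.cand j) = v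
            · subst hvv
              simp [hdeg]
            · simp [hvv]
        · rw [Finset.sum_range_succ]
          have h11 : ∑ i ∈ Finset.range (L + 1), (s₁.data j).len i
              = ∑ i ∈ Finset.range (L + 1), (s.data j).len i := by
            change ∑ i ∈ Finset.range (L + 1), (s'.data j).len i = _
            rw [hdata]
          rw [h11] at h9
          simp only [hs₁, Config.step_time, Config.touch_time] at h9
          simp only [Config.setWord_time, Config.setReal_time, Config.setVert_time,
            Config.touch_time, Config.step_time]
          omega
        · have : s'.word .outLen < n * J := by omega
          simp [Finset.insert_subset_iff, h10, this]
          omega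
    · refine ⟨((h1.step.touch _).step).step, h2, by simp; omega, ?_, ?_, ?_⟩
      · intro v
        rw [Finset.sum_range_succ, ← h4, if_neg, add_zero]
        · rfl
        · rintro ⟨rfl, h⟩
          exact hdeg h
      · rw [Finset.sum_range_succ]
        simp
        omega
      · simp [Finset.insert_subset_iff, h6]
        omega
  · rintro _ s' ⟨h1, h2, h3, h4, h5, h6⟩
    refine ⟨h1, h2, ?_, h4, h5, h6⟩
    exact h3.trans (by simpa using hc)

end Combine

end ERSketch

end

noncomputable section

namespace ERSketch

/-! ## Resetting the working memory -/

section CleanUp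

variable {n : ℕ} {G : SimpleGraph (Fin n)}

/-- The cells that are changed by `cleanUp`. -/
def cleanCells (n : ℕ) : Set (Cell n) := fun a => match a with
  | .inl (.visit _) => True
  | .inl (.approx _ _) => True
  | .inl (.resid _ _ _) => True
  | .inr (.inr .seenLen) => True
  | .inr (.inr .candLen) => True
  | .inr (.inr .hitLen) => True
  | .inr (.inr (.levelLen _ _)) => True
  | .inr (.inr (.count _ _)) => True
  | _ => False

/-- Reset the data of the first stage. -/
def clearSeen (n : ℕ) : M n Unit := do
  let l ← readWord .seenLen
  loop l () fun t _ => do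
    let w ← readVert (.seen t)
    writeReal (.visit w) 0
  writeWord .seenLen 0

/-- Reset the data of the third stage. -/
def clearHits (n : ℕ) : M n Unit := do
  let h ← readWord .hitLen
  loop h () fun t _ => do
    let k ← readWord (.hitStep t)
    let w ← readVert (.hitVertex t)
    writeWord (.count k w) 0
  writeWord .hitLen 0

/-- Reset level `i` of the `j`-th candidate. -/
def clearLevel (n j i : ℕ) : M n Unit := do
  let l ← readWord (.levelLen j i)
  loop l () fun t _ => do
    let w ← readVert (.level j i t)
    writeReal (.resid j i w) 0
    writeReal (.approx j w) 0
  writeWord (.levelLen j i) 0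

/-- Reset the data of the candidates. -/
def clearCands (n L : ℕ) : M n Unit := do
  let c ← readWord .candLen
  loop c () fun j _ => loop (L + 2) () fun i _ => clearLevel n j i
  writeWord .candLen 0

theorem cleanUp_eq (n L : ℕ) : cleanUp n L =
    clearSeen n >>= fun _ => clearHits n >>= fun _ => clearCands n L := by
  unfold cleanUp clearSeen clearHits clearCands clearLevel
  simp only [bind_assoc]

/-- The cells of the first stage that are reset. -/
def seenCells (n : ℕ) : Set (Cell n) := fun a => match a with
  | .inl (.visit _) => True
  | .inr (.inr .seenLen) => True
  | _ => False

/-- The cells of the third stage that are reset. -/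
def hitCells (n : ℕ) : Set (Cell n) := fun a => match a with
  | .inr (.inr .hitLen) => True
  | .inr (.inr (.count _ _)) => True
  | _ => False

/-- The cells of the `j`-th candidate that are reset. -/
def dataCells (n j : ℕ) : Set (Cell n) := fun a => match a with
  | .inl (.approx j' _) => j' = j
  | .inl (.resid j' _ _) => j' = j
  | .inr (.inr (.levelLen j' _)) => j' = j
  | _ => False

/-- The cells of the candidates that are reset. -/
def candCells (n : ℕ) : Set (Cell n) := fun a => match a with
  | .inl (.approx _ _) => True
  | .inl (.resid _ _ _) => True
  | .inr (.inr .candLen) => True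
  | .inr (.inr (.levelLen _ _)) => True
  | _ => False

theorem seenCells_subset : seenCells n ⊆ cleanCells n := by
  rintro ((_ | _ | _ | _) | (_ | _ | _ | _ | _) | (_ | _ | _ | _ | _ | _ | _ | _)) h
  all_goals first
    | exact False.elim h
    | exact trivial

theorem hitCells_subset : hitCells n ⊆ cleanCells n := by
  rintro ((_ | _ | _ | _) | (_ | _ | _ | _ | _) | (_ | _ | _ | _ | _ | _ | _ | _)) h
  all_goals first
    | exact False.elim h
    | exact trivial

theorem candCells_subset : candCells n ⊆ cleanCells n := by
  rintro ((_ | _ | _ | _) | (_ | _ | _ | _ | _) | (_ | _ | _ | _ | _ | _ | _ | _)) h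
  all_goals first
    | exact False.elim h
    | exact trivial

theorem dataCells_subset (j : ℕ) : dataCells n j ⊆ candCells n := by
  rintro ((_ | _ | _ | _) | (_ | _ | _ | _ | _) | (_ | _ | _ | _ | _ | _ | _ | _)) h
  all_goals first
    | exact False.elim h
    | exact trivial

/-- Throughout the loop every cell is zero or unchanged, and the entries passed are zero. Since the
list covers all nonzero cells, only zeros remain; the other resets follow the same scheme. -/
theorem sat_clearSeen {L J : ℕ} {s : Config n}
    (hcover : ∀ w, s.real (.visit w) ≠ 0 → ∃ t < s.word .seenLen, s.vert (.seen t) = w)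
    (hlen : s.word .seenLen ≤ n) (hs : s.used ⊆ cells n L J) :
    Sat (clearSeen n) s fun _ s' => Frame (seenCells n) s s' ∧ (∀ w, s'.real (.visit w) = 0) ∧
      s'.word .seenLen = 0 ∧ s'.time ≤ s.time + 2 + 3 * s.word .seenLen ∧
      s'.used ⊆ cells n L J := by
  unfold clearSeen
  rw [sat_bind, sat_readWord, sat_bind]
  refine (sat_loop (fun t _ s' => Frame (seenCells n) s s' ∧
    (∀ w, s'.real (.visit w) = 0 ∨ s'.real (.visit w) = s.real (.visit w)) ∧
    (∀ t' < t, s'.real (.visit (s.vert (.seen t'))) = 0) ∧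
    s'.time ≤ s.time + 1 + 3 * t ∧ s'.used ⊆ cells n L J)
    ⟨(Frame.refl _ _).touch _, by simp, by simp, by simp, ?_⟩ ?_).mono ?_
  · simp [Finset.insert_subset_iff, hs]
  · rintro t ht - s' ⟨h1, h2, h3, h4, h5⟩
    have hv : s'.vert (.seen t) = s.vert (.seen t) := h1.vert _ fun h => h
    rw [sat_bind, sat_readVert, sat_writeReal, Config.step_vert, hv]
    refine ⟨((h1.step).touch _).setReal (by trivial) _, ?_, ?_, by simp; omega, ?_⟩
    · intro w
      simp only [Config.setReal_real, Config.touch_real, Config.step_real]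
      by_cases hw : w = s.vert (.seen t)
      · subst hw
        simp
      · rw [Function.update_of_ne (by simpa using hw)]
        exact h2 w
    · intro t' ht'
      simp only [Config.setReal_real, Config.touch_real, Config.step_real]
      by_cases hw : s.vert (.seen t') = s.vert (.seen t)
      · rw [hw]
        simp
      · rw [Function.update_of_ne (by simpa using hw)]
        refine h3 t' ?_
        rcases Nat.lt_succ_iff_lt_or_eq.1 ht' with h | rfl
        · exact h
        · exact absurd rfl hw
    · have : t < s.word .seenLen := ht
      simp [Finset.insert_subset_iff, h5]
      omega
  · rintro _ s' ⟨h1, h2, h3, h4, h5⟩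
    rw [sat_writeWord]
    refine ⟨h1.setWord (by trivial) _, ?_, by simp, ?_, ?_⟩
    · intro w
      rcases h2 w with h | h
      · exact h
      · by_contra h0
        have h6 : s.real (.visit w) ≠ 0 := fun h7 => h0 (h.trans h7)
        obtain ⟨t, ht, rfl⟩ := hcover w h6
        exact h0 (h3 t ht)
    · simp only [Config.setWord_time]
      omega
    · simp [Finset.insert_subset_iff, h5]

theorem sat_clearHits {L J : ℕ} {s : Config n}
    (hcover : ∀ k w, s.word (.count k w) ≠ 0 →
      ∃ t < s.word .hitLen, s.word (.hitStep t) = k ∧ s.vert (.hitVertex t) = w)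
    (hlow : ∀ t < s.word .hitLen, s.word (.hitStep t) ≤ L)
    (hlen : s.word .hitLen ≤ (L + 1) * n) (hs : s.used ⊆ cells n L J) :
    Sat (clearHits n) s fun _ s' => Frame (hitCells n) s s' ∧
      (∀ k w, s'.word (.count k w) = 0) ∧ s'.word .hitLen = 0 ∧
      s'.time ≤ s.time + 2 + 4 * s.word .hitLen ∧ s'.used ⊆ cells n L J := by
  unfold clearHits
  rw [sat_bind, sat_readWord, sat_bind]
  refine (sat_loop (fun t _ s' => Frame (hitCells n) s s' ∧
    (∀ k w, s'.word (.count k w) = 0 ∨ s'.word (.count k w) = s.word (.count k w)) ∧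
    (∀ t' < t, s'.word (.count (s.word (.hitStep t')) (s.vert (.hitVertex t'))) = 0) ∧
    s'.time ≤ s.time + 1 + 4 * t ∧ s'.used ⊆ cells n L J)
    ⟨(Frame.refl _ _).touch _, by simp, by simp, by simp, ?_⟩ ?_).mono ?_
  · simp [Finset.insert_subset_iff, hs]
  · rintro t ht - s' ⟨h1, h2, h3, h4, h5⟩
    have hv : s'.vert (.hitVertex t) = s.vert (.hitVertex t) := h1.vert _ fun h => h
    have hw : s'.word (.hitStep t) = s.word (.hitStep t) := h1.word _ fun h => h
    rw [sat_bind, sat_readWord, sat_bind, sat_readVert, sat_writeWord]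
    simp only [Config.step_word, Config.touch_vert, Config.step_vert, hv, hw]
    have ht' : t < s.word .hitLen := ht
    refine ⟨(((h1.step).touch _).touch _).setWord (by trivial) _, ?_, ?_, by simp; omega, ?_⟩
    · intro k w
      simp only [Config.setWord_word, Config.touch_word, Config.step_word]
      by_cases hkw : k = s.word (.hitStep t) ∧ w = s.vert (.hitVertex t)
      · obtain ⟨rfl, rfl⟩ := hkw
        simp
      · rw [Function.update_of_ne (by simpa using hkw)]
        exact h2 k w
    · intro t' ht'
      simp only [Config.setWord_word, Config.touch_word, Config.step_word]
      by_cases hkw : s.word (.hitStep t') = s.word (.hitStep t) ∧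
          s.vert (.hitVertex t') = s.vert (.hitVertex t)
      · rw [hkw.1, hkw.2]
        simp
      · rw [Function.update_of_ne (by simpa using hkw)]
        refine h3 t' ?_
        rcases Nat.lt_succ_iff_lt_or_eq.1 ht' with h | rfl
        · exact h
        · exact absurd ⟨rfl, rfl⟩ hkw
    · have := hlow t ht'
      have : t < (L + 1) * n := lt_of_lt_of_le ht' hlen
      simp [Finset.insert_subset_iff, h5, this]
      omega
  · rintro _ s' ⟨h1, h2, h3, h4, h5⟩
    rw [sat_writeWord]
    refine ⟨h1.setWord (by trivial) _, ?_, by simp, ?_, ?_⟩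
    · intro k w
      rw [Config.setWord_word, Function.update_of_ne (by simp)]
      rcases h2 k w with h | h
      · exact h
      · by_contra h0
        have h6 : s.word (.count k w) ≠ 0 := fun h7 => h0 (h.trans h7)
        obtain ⟨t, ht, rfl, rfl⟩ := hcover k w h6
        exact h0 (h3 t ht)
    · simp only [Config.setWord_time]
      omega
    · simp [Finset.insert_subset_iff, h5]

/-- A vertex may be listed on several levels and its `approx` cell cleared repeatedly; the
conclusion "zero or unchanged" is stable under this. -/
theorem sat_clearLevel {L J j i : ℕ} (hj : j < J) (hi : i < L + 2) {s : Config n}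
    (hlen : (s.data j).len i ≤ n) (hs : s.used ⊆ cells n L J) :
    Sat (clearLevel n j i) s fun _ s' => Frame (dataCells n j) s s' ∧
      (∀ i' w, (s'.data j).resid i' w = 0 ∨ (s'.data j).resid i' w = (s.data j).resid i' w) ∧
      (∀ w, (s'.data j).approx w = 0 ∨ (s'.data j).approx w = (s.data j).approx w) ∧
      (∀ t < (s.data j).len i, (s'.data j).resid i ((s.data j).level i t) = 0 ∧
        (s'.data j).approx ((s.data j).level i t) = 0) ∧
      (s'.data j).len i = 0 ∧ (∀ i' ≠ i, (s'.data j).len i' = (s.data j).len i') ∧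
      s'.time ≤ s.time + 2 + 4 * (s.data j).len i ∧ s'.used ⊆ cells n L J := by
  unfold clearLevel
  rw [sat_bind, sat_readWord, sat_bind]
  refine (sat_loop (fun t _ s' => Frame (dataCells n j) s s' ∧
      (∀ i' w, (s'.data j).resid i' w = 0 ∨ (s'.data j).resid i' w = (s.data j).resid i' w) ∧
      (∀ w, (s'.data j).approx w = 0 ∨ (s'.data j).approx w = (s.data j).approx w) ∧
      (∀ t' < t, (s'.data j).resid i ((s.data j).level i t') = 0 ∧
        (s'.data j).approx ((s.data j).level i t') = 0) ∧
      (∀ i', (s'.data j).len i' = (s.data j).len i') ∧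
      s'.time ≤ s.time + 1 + 4 * t ∧ s'.used ⊆ cells n L J)
    ⟨(Frame.refl _ _).touch _, fun _ _ => Or.inr rfl, fun _ => Or.inr rfl, by simp, fun _ => rfl,
      by simp, ?_⟩ ?_).mono ?_
  · simp [Finset.insert_subset_iff, hs, hj, hi]
  · rintro t ht - s' ⟨h1, h2, h3, h4, h5, h6, h7⟩
    have hv : s'.vert (.level j i t) = (s.data j).level i t := h1.vert _ fun h => h
    rw [sat_bind, sat_readVert, sat_bind, sat_writeReal, sat_writeReal, Config.step_vert, hv]
    set w := (s.data j).level i t with hw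
    have hr : ∀ i' z, ((((s'.step.touch (Sum.inr (Sum.inl (.level j i t)))).setReal
        (.resid j i w) 0).setReal (.approx j w) 0).data j).resid i' z
        = if i' = i ∧ z = w then 0 else (s'.data j).resid i' z := by
      intro i' z
      simp only [Config.data, Config.setReal_real, Config.touch_real, Config.step_real]
      rw [Function.update_of_ne (by simp)]
      split_ifs with hz
      · obtain ⟨rfl, rfl⟩ := hz
        simp
      · rw [Function.update_of_ne (by simpa using hz)]
    have ha : ∀ z, ((((s'.step.touch (Sum.inr (Sum.inl (.level j i t)))).setReal
        (.resid j i w) 0).setReal (.approx j w) 0).data j).approx z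
        = if z = w then 0 else (s'.data j).approx z := by
      intro z
      simp only [Config.data, Config.setReal_real, Config.touch_real, Config.step_real]
      split_ifs with hz
      · subst hz
        simp
      · rw [Function.update_of_ne (by simpa using hz), Function.update_of_ne (by simp)]
    have ht' : t < (s.data j).len i := ht
    refine ⟨(((h1.step).touch _).setReal (by exact (rfl : j = j)) _).setReal
      (by exact (rfl : j = j)) _, ?_, ?_, ?_, h5, by simp; omega, ?_⟩
    · intro i' z
      rw [hr]
      split_ifs
      · exact Or.inl rfl
      · exact h2 i' z
    · intro z
      rw [ha]
      split_ifs
      · exact Or.inl rfl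
      · exact h3 z
    · intro t' ht'
      rw [hr, ha]
      by_cases hz : (s.data j).level i t' = w
      · simp [hz]
      · have : t' < t := by
          rcases Nat.lt_succ_iff_lt_or_eq.1 ht' with h | rfl
          · exact h
          · exact absurd rfl hz
        simp [hz, h4 t' this]
    · simp [Finset.insert_subset_iff, h7, hj, hi]
      omega
  · rintro _ s' ⟨h1, h2, h3, h4, h5, h6, h7⟩
    rw [sat_writeWord]
    refine ⟨h1.setWord (by exact (rfl : j = j)) _, h2, h3, h4, ?_, ?_, ?_, ?_⟩
    · simp [Config.data]
    · intro i' hi'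
      simp only [Config.data, Config.setWord_word]
      rw [Function.update_of_ne (by simpa using hi')]
      exact h5 i'
    · have h8 : s'.time ≤ s.time + 1 + 4 * (s.data j).len i := h6
      simp only [Config.setWord_time]
      omega
    · simp [Finset.insert_subset_iff, h7, hj, hi]

theorem sat_clearData {L J j : ℕ} (hj : j < J) {s : Config n}
    (happrox : ∀ w, (s.data j).approx w ≠ 0 →
      ∃ i < L + 2, ∃ t < (s.data j).len i, (s.data j).level i t = w)
    (hresid : ∀ i w, (s.data j).resid i w ≠ 0 →
      i < L + 2 ∧ ∃ t < (s.data j).len i, (s.data j).level i t = w)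
    (hzero : ∀ i ≥ L + 2, (s.data j).len i = 0)
    (hlen : ∀ i, (s.data j).len i ≤ n) (hs : s.used ⊆ cells n L J) :
    Sat (loop (L + 2) () fun i _ => clearLevel n j i) s fun _ s' => Frame (dataCells n j) s s' ∧
      (s'.data j).Empty ∧
      s'.time ≤ s.time + 3 * (L + 2) + 4 * ∑ i ∈ Finset.range (L + 2), (s.data j).len i ∧
      s'.used ⊆ cells n L J := by
  refine (sat_loop (fun i _ s' => Frame (dataCells n j) s s' ∧
      (∀ i' w, (s'.data j).resid i' w = 0 ∨ (s'.data j).resid i' w = (s.data j).resid i' w) ∧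
      (∀ w, (s'.data j).approx w = 0 ∨ (s'.data j).approx w = (s.data j).approx w) ∧
      (∀ i' < i, ∀ t < (s.data j).len i', (s'.data j).resid i' ((s.data j).level i' t) = 0 ∧
        (s'.data j).approx ((s.data j).level i' t) = 0) ∧
      (∀ i' < i, (s'.data j).len i' = 0) ∧ (∀ i' ≥ i, (s'.data j).len i' = (s.data j).len i') ∧
      s'.time ≤ s.time + 3 * i + 4 * ∑ i' ∈ Finset.range i, (s.data j).len i' ∧
      s'.used ⊆ cells n L J)
    ⟨Frame.refl _ _, fun _ _ => Or.inr rfl, fun _ => Or.inr rfl, by simp, by simp, fun _ _ => rfl,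
      by simp, hs⟩ ?_).mono ?_
  · rintro i hi - s' ⟨h1, h2, h3, h4, h5, h6, h7, h8⟩
    have hli : (s'.data j).len i = (s.data j).len i := h6 i le_rfl
    have hlv : (s'.data j).level = (s.data j).level :=
      funext fun i => funext fun t => h1.vert (.level j i t) fun h => h
    refine (sat_clearLevel (i := i) hj hi (s := s'.step) ?_ h8).mono ?_
    · change (s'.data j).len i ≤ n
      rw [hli]
      exact hlen i
    · rintro _ s'' ⟨g1, g2, g3, g4, g5, g6, g7, g8⟩
      have hst : s'.step.data j = s'.data j := rfl
      rw [hst] at g2 g3 g4 g6 g7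
      rw [hlv, hli] at g4
      refine ⟨h1.step.trans g1, ?_, ?_, ?_, ?_, ?_, ?_, g8⟩
      · intro i' w
        rcases g2 i' w with h | h
        · exact Or.inl h
        · rw [h]
          exact h2 i' w
      · intro w
        rcases g3 w with h | h
        · exact Or.inl h
        · rw [h]
          exact h3 w
      · intro i' hi' t ht
        rcases Nat.lt_succ_iff_lt_or_eq.1 hi' with hi' | rfl
        · have h9 := h4 i' hi' t ht
          exact ⟨(g2 i' _).elim id fun h => h.trans h9.1, (g3 _).elim id fun h => h.trans h9.2⟩
        · exact g4 t ht
      · intro i' hi'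
        rcases Nat.lt_succ_iff_lt_or_eq.1 hi' with hi' | rfl
        · rw [g6 i' hi'.ne]
          exact h5 i' hi'
        · exact g5
      · intro i' hi'
        rw [g6 i' (by omega)]
        exact h6 i' (by omega)
      · rw [Finset.sum_range_succ]
        rw [hli] at g7
        simp only [Config.step_time] at g7
        omega
  · rintro _ s' ⟨h1, h2, h3, h4, h5, h6, h7, h8⟩
    refine ⟨h1, ⟨?_, ?_, ?_⟩, h7, h8⟩
    · intro w
      rcases h3 w with h | h
      · exact h
      · by_contra h0
        obtain ⟨i, hi, t, ht, rfl⟩ := happrox w fun h9 => h0 (h.trans h9)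
        exact h0 (h4 i hi t ht).2
    · intro i w
      rcases h2 i w with h | h
      · exact h
      · by_contra h0
        obtain ⟨hi, t, ht, rfl⟩ := hresid i w fun h9 => h0 (h.trans h9)
        exact h0 (h4 i hi t ht).1
    · intro i
      by_cases hi : i < L + 2
      · exact h5 i hi
      · rw [h6 i (by omega), hzero i (by omega)]

theorem sat_clearCands {L J : ℕ} {s : Config n} (hc : s.word .candLen ≤ J)
    (happrox : ∀ j < s.word .candLen, ∀ w, (s.data j).approx w ≠ 0 →
      ∃ i < L + 2, ∃ t < (s.data j).len i, (s.data j).level i t = w)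
    (hresid : ∀ j < s.word .candLen, ∀ i w, (s.data j).resid i w ≠ 0 →
      i < L + 2 ∧ ∃ t < (s.data j).len i, (s.data j).level i t = w)
    (hzero : ∀ j < s.word .candLen, ∀ i ≥ L + 2, (s.data j).len i = 0)
    (hempty : ∀ j ≥ s.word .candLen, (s.data j).Empty)
    (hlen : ∀ j i, (s.data j).len i ≤ n) (hs : s.used ⊆ cells n L J) :
    Sat (clearCands n L) s fun _ s' => Frame (candCells n) s s' ∧ (∀ j, (s'.data j).Empty) ∧
      s'.word .candLen = 0 ∧
      s'.time ≤ s.time + 2 + ∑ j ∈ Finset.range (s.word .candLen), (1 + 3 * (L + 2) +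
        4 * ∑ i ∈ Finset.range (L + 2), (s.data j).len i) ∧ s'.used ⊆ cells n L J := by
  unfold clearCands
  rw [sat_bind, sat_readWord, sat_bind]
  refine (sat_loop (fun c _ s' => Frame (candCells n) s s' ∧ (∀ j < c, (s'.data j).Empty) ∧
      (∀ j ≥ c, s'.data j = s.data j) ∧
      s'.time ≤ s.time + 1 + ∑ j ∈ Finset.range c, (1 + 3 * (L + 2) +
        4 * ∑ i ∈ Finset.range (L + 2), (s.data j).len i) ∧ s'.used ⊆ cells n L J)
    ⟨(Frame.refl _ _).touch _, by simp, fun _ _ => rfl, by simp, ?_⟩ ?_).mono ?_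
  · simp [Finset.insert_subset_iff, hs]
  · rintro j hj - s' ⟨h1, h2, h3, h4, h5⟩
    have hj' : j < s.word .candLen := hj
    have hd : s'.step.data j = s.data j := h3 j le_rfl
    refine (sat_clearData (L := L) (J := J) (j := j) (by omega) (s := s'.step) ?_ ?_ ?_ ?_ h5).mono ?_
    · rw [hd]
      exact happrox j hj'
    · rw [hd]
      exact hresid j hj'
    · rw [hd]
      exact hzero j hj'
    · rw [hd]
      exact hlen j
    · rintro _ s'' ⟨g1, g2, g3, g4⟩
      have hdata : ∀ j' ≠ j, s''.data j' = s'.data j' := fun j' hj' =>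
        g1.data_eq j' (fun _ h => hj' h) (fun _ _ h => hj' h) (fun _ _ h => h) (fun _ h => hj' h)
      refine ⟨h1.step.trans (g1.mono (dataCells_subset j)), ?_, ?_, ?_, g4⟩
      · intro j' hj'
        rcases Nat.lt_succ_iff_lt_or_eq.1 hj' with hj' | rfl
        · rw [hdata j' hj'.ne]
          exact h2 j' hj'
        · exact g2
      · intro j' hj'
        rw [hdata j' (by omega)]
        exact h3 j' (by omega)
      · rw [Finset.sum_range_succ]
        rw [hd] at g3
        simp only [Config.step_time] at g3
        omega
  · rintro _ s' ⟨h1, h2, h3, h4, h5⟩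
    rw [sat_writeWord]
    refine ⟨h1.setWord (by trivial) _, ?_, by simp, ?_, ?_⟩
    · intro j
      have hd : (s'.setWord .candLen 0).data j = s'.data j := by
        simp [Config.data]
      rw [hd]
      by_cases hj : j < s.word .candLen
      · exact h2 j hj
      · rw [h3 j (not_lt.1 hj)]
        exact hempty j (not_lt.1 hj)
    · simp only [Config.setWord_time] at h4 ⊢
      omega
    · simp [Finset.insert_subset_iff, h5]

/-- What is needed in order that `cleanUp` resets the working memory. -/
structure Tracked (L J : ℕ) (s : Config n) : Prop where
  seen : ∀ w, s.real (.visit w) ≠ 0 → ∃ t < s.word .seenLen, s.vert (.seen t) = w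
  seenLen : s.word .seenLen ≤ n
  hit : ∀ k w, s.word (.count k w) ≠ 0 →
      ∃ t < s.word .hitLen, s.word (.hitStep t) = k ∧ s.vert (.hitVertex t) = w
  hitStep : ∀ t < s.word .hitLen, s.word (.hitStep t) ≤ L
  hitLen : s.word .hitLen ≤ (L + 1) * n
  candLen : s.word .candLen ≤ J
  approx : ∀ j < s.word .candLen, ∀ w, (s.data j).approx w ≠ 0 →
      ∃ i < L + 2, ∃ t < (s.data j).len i, (s.data j).level i t = w
  resid : ∀ j < s.word .candLen, ∀ i w, (s.data j).resid i w ≠ 0 →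
      i < L + 2 ∧ ∃ t < (s.data j).len i, (s.data j).level i t = w
  above : ∀ j < s.word .candLen, ∀ i ≥ L + 2, (s.data j).len i = 0
  empty : ∀ j ≥ s.word .candLen, (s.data j).Empty
  levelLen : ∀ j i, (s.data j).len i ≤ n
  used : s.used ⊆ cells n L J

theorem sat_cleanUp {L J : ℕ} {s : Config n} (h : Tracked L J s) :
    Sat (cleanUp n L) s fun _ s' => Frame (cleanCells n) s s' ∧ Clean s' ∧
      s'.time ≤ s.time + 6 + 3 * s.word .seenLen + 4 * s.word .hitLen +
        ∑ j ∈ Finset.range (s.word .candLen), (1 + 3 * (L + 2) +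
        4 * ∑ i ∈ Finset.range (L + 2), (s.data j).len i) ∧ s'.used ⊆ cells n L J := by
  rw [cleanUp_eq, sat_bind]
  refine (sat_clearSeen h.seen h.seenLen h.used).mono ?_
  rintro _ s₁ ⟨a1, a2, a3, a4, a5⟩
  have hc₁ : ∀ k w, s₁.word (.count k w) = s.word (.count k w) := fun k w => a1.word _ fun h => h
  have hl₁ : s₁.word .hitLen = s.word .hitLen := a1.word _ fun h => h
  have hs₁ : ∀ t, s₁.word (.hitStep t) = s.word (.hitStep t) := fun t => a1.word _ fun h => h
  have hv₁ : ∀ t, s₁.vert (.hitVertex t) = s.vert (.hitVertex t) := fun t => a1.vert _ fun h => h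
  rw [sat_bind]
  refine (sat_clearHits (L := L) (J := J) ?_ ?_ ?_ a5).mono ?_
  · simpa only [hc₁, hl₁, hs₁, hv₁] using h.hit
  · simpa only [hl₁, hs₁] using h.hitStep
  · rw [hl₁]
    exact h.hitLen
  rintro _ s₂ ⟨b1, b2, b3, b4, b5⟩
  have hd₂ : ∀ j, s₂.data j = s.data j := fun j =>
    (b1.data_eq j (fun _ h => h) (fun _ _ h => h) (fun _ _ h => h) (fun _ h => h)).trans
      (a1.data_eq j (fun _ h => h) (fun _ _ h => h) (fun _ _ h => h) (fun _ h => h))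
  have hn₂ : s₂.word .candLen = s.word .candLen :=
    (b1.word .candLen fun h => h).trans (a1.word .candLen fun h => h)
  refine (sat_clearCands (L := L) (J := J) ?_ ?_ ?_ ?_ ?_ ?_ b5).mono ?_
  · rw [hn₂]
    exact h.candLen
  · simpa only [hd₂, hn₂] using h.approx
  · simpa only [hd₂, hn₂] using h.resid
  · simpa only [hd₂, hn₂] using h.above
  · simpa only [hd₂, hn₂] using h.empty
  · simpa only [hd₂] using h.levelLen
  rintro _ s₃ ⟨c1, c2, c3, c4, c5⟩
  refine ⟨((a1.mono seenCells_subset).trans (b1.mono hitCells_subset)).trans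
    (c1.mono candCells_subset), ⟨?_, ?_, c3, ?_, ?_, ?_, ?_, ?_⟩, ?_, c5⟩
  · intro w
    rw [c1.real (.visit w) fun h => h, b1.real (.visit w) fun h => h]
    exact a2 w
  · rw [c1.word .seenLen fun h => h, b1.word .seenLen fun h => h]
    exact a3
  · exact fun j w => (c2 j).approx w
  · exact fun j i w => (c2 j).resid i w
  · exact fun j i => (c2 j).len i
  · intro k w
    rw [c1.word (.count k w) fun h => h]
    exact b2 k w
  · rw [c1.word .hitLen fun h => h]
    exact b3
  · simp only [hd₂, hn₂] at c4
    rw [hl₁] at b4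
    omega

end CleanUp

end ERSketch

end

noncomputable section

namespace ERSketch

/-! ## One round of the main loop -/

section Round

variable {n : ℕ} {G : SimpleGraph (Fin n)}

/-- All cells except for the output. -/
def workCells (n : ℕ) : Set (Cell n) := fun a => match a with
  | .inl (.outValue _) => False
  | .inr (.inl (.outVertex _)) => False
  | .inr (.inr .outLen) => False
  | .inr (.inr (.offset _)) => False
  | _ => True

theorem stageOneCells_subset : stageOneCells n ⊆ workCells n := by
  rintro ((_ | _ | _ | _) | (_ | _ | _ | _ | _) | (_ | _ | _ | _ | _ | _ | _ | _)) h
  all_goals first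
    | exact trivial
    | exact False.elim h

theorem stageTwoCells_subset : stageTwoCells n ⊆ workCells n := by
  rintro ((_ | _ | _ | _) | (_ | _ | _ | _ | _) | (_ | _ | _ | _ | _ | _ | _ | _)) h
  all_goals first
    | exact trivial
    | exact False.elim h

theorem stageThreeCells_subset : stageThreeCells n ⊆ workCells n := by
  rintro ((_ | _ | _ | _) | (_ | _ | _ | _ | _) | (_ | _ | _ | _ | _ | _ | _ | _)) h
  all_goals first
    | exact trivial
    | exact False.elim h

variable [DecidableRel G.Adj]

/-- The contents of the working memory after the first two stages of a round that was started
in `s₀`. -/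
structure Ready (G : SimpleGraph (Fin n)) [DecidableRel G.Adj] (L J N : ℕ) (ε rmax : ℝ)
    (s₀ s : Config n) : Prop where
  frame : Frame (workCells n) s₀ s
  nonneg : ∀ w, 0 ≤ s.real (.visit w)
  seen : Enum (fun t => s.vert (.seen t)) (s.word .seenLen) {w | s.real (.visit w) ≠ 0}
  sum : ∑ w, s.real (.visit w) = (L + 1) / 2
  seenLen : s.word .seenLen ≤ N * (L + 1)
  cand : Enum (fun t => s.vert (.cand t)) (s.word .candLen) {w | ε / 2 < s.real (.visit w)}
  candLen : s.word .candLen ≤ J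
  done : ∀ j < s.word .candLen, CgdDone G L (s.vert (.cand j))
    (rmax / (2 * s.real (.visit (s.vert (.cand j))))) (s.data j)
  empty : ∀ j ≥ s.word .candLen, (s.data j).Empty
  used : s.used ⊆ cells n L J

variable {L J N : ℕ} {ε rmax : ℝ} {s₀ s s' : Config n}

theorem Ready.step (h : Ready G L J N ε rmax s₀ s) : Ready G L J N ε rmax s₀ s.step :=
  ⟨h.frame.step, h.nonneg, h.seen, h.sum, h.seenLen, h.cand, h.candLen, h.done, h.empty, h.used⟩

theorem Ready.stageThree (h : Ready G L J N ε rmax s₀ s) (hf : Frame (stageThreeCells n) s s')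
    (hu : s'.used ⊆ cells n L J) : Ready G L J N ε rmax s₀ s' := by
  have hr : s'.real = s.real := funext fun a => hf.real a fun h => h
  have hseen : ∀ t, s'.vert (.seen t) = s.vert (.seen t) := fun t => hf.vert _ fun h => h
  have hcand : ∀ t, s'.vert (.cand t) = s.vert (.cand t) := fun t => hf.vert _ fun h => h
  have hsl : s'.word .seenLen = s.word .seenLen := hf.word _ fun h => h
  have hcl : s'.word .candLen = s.word .candLen := hf.word _ fun h => h
  have hd : ∀ j, s'.data j = s.data j := fun j =>
    hf.data_eq j (fun _ h => h) (fun _ _ h => h) (fun _ _ h => h) (fun _ h => h)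
  refine ⟨h.frame.trans (hf.mono stageThreeCells_subset), ?_, ?_, ?_, ?_, ?_, ?_, ?_, ?_, hu⟩
  · rw [hr]
    exact h.nonneg
  · simp only [hr, hseen, hsl]
    exact h.seen
  · rw [hr]
    exact h.sum
  · rw [hsl]
    exact h.seenLen
  · simp only [hr, hcand, hcl]
    exact h.cand
  · rw [hcl]
    exact h.candLen
  · simp only [hr, hcand, hcl, hd]
    exact h.done
  · simp only [hcl, hd]
    exact h.empty

theorem AfterOne.ready (hJ : ∀ c : ℕ, c * ε ≤ L + 1 → c ≤ J)
    (h : AfterOne L J N ε s₀ s) (h' : AfterTwo G L J rmax s (s.word .candLen) s') :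
    Ready G L J N ε rmax s₀ s' := by
  have hf := h'.frame
  have hv : ∀ w, s'.real (.visit w) = s.real (.visit w) := fun w => hf.real _ fun h => h
  have hseen : ∀ t, s'.vert (.seen t) = s.vert (.seen t) := fun t => hf.vert _ fun h => h
  have hcand : ∀ t, s'.vert (.cand t) = s.vert (.cand t) := fun t => hf.vert _ fun h => h
  have hsl : s'.word .seenLen = s.word .seenLen := hf.word _ fun h => h
  have hcl : s'.word .candLen = s.word .candLen := hf.word _ fun h => h
  refine ⟨(h.frame.mono stageOneCells_subset).trans (hf.mono stageTwoCells_subset), ?_, ?_, ?_, ?_,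
    ?_, ?_, ?_, ?_, h'.used⟩
  · simp only [hv]
    exact h.nonneg
  · simp only [hv, hseen, hsl]
    exact h.seen
  · simp only [hv]
    exact h.sum
  · rw [hsl]
    exact h.seenLen
  · simp only [hv, hcand, hcl]
    exact h.cand
  · rw [hcl]
    exact candidates_le h.nonneg h.sum hJ h.cand.inj fun i hi => h.cand.mem_of_lt hi
  · simp only [hv, hcand, hcl]
    exact h'.done
  · rw [hcl]
    exact h'.empty

theorem Ready.len_le (h : Ready G L J N ε rmax s₀ s) (j i : ℕ) : (s.data j).len i ≤ n := by
  by_cases hj : j < s.word .candLen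
  · exact le_of_inj ((h.done j hj).inj i)
  · rw [(h.empty j (not_lt.1 hj)).len]
    exact Nat.zero_le _

theorem Ready.tracked (h : Ready G L J N ε rmax s₀ s) {s₁ : Config n} {i : ℕ}
    (h' : VisitedThree L J s₁ i s) : Tracked L J s where
  seen w hw := (h.seen.mem w).1 hw
  seenLen := le_of_inj h.seen.inj
  hit k w hw := by
    obtain ⟨t, ht, he⟩ := (h'.enum.mem (k, w)).1 hw
    exact ⟨t, ht, congrArg Prod.fst he, congrArg Prod.snd he⟩
  hitStep t ht := h'.step_le _ _ (h'.enum.mem_of_lt ht)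
  hitLen := h'.hitLen_le
  candLen := h.candLen
  approx j hj := (h.done j hj).approx_cover
  resid j hj := (h.done j hj).cover
  above j hj := (h.done j hj).above
  empty := h.empty
  levelLen := h.len_le
  used := h.used

/-- State of the memory before the round for the vertex `t`. -/
structure Between (L J t : ℕ) (s : Config n) : Prop where
  clean : Clean s
  used : s.used ⊆ cells n L J
  outLen : s.word .outLen ≤ t * J
  offset : s.word (.offset t) = s.word .outLen
  offset_le : ∀ i ≤ t, s.word (.offset i) ≤ s.word .outLen

/-- The output for the vertices before `t` is the same in `s` and in `s'`. -/
structure Kept (t : ℕ) (s s' : Config n) : Prop where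
  offset : ∀ i ≤ t, s'.word (.offset i) = s.word (.offset i)
  vert : ∀ o < s.word .outLen, s'.vert (.outVertex o) = s.vert (.outVertex o)
  value : ∀ o < s.word .outLen, s'.real (.outValue o) = s.real (.outValue o)

/-- The value for `u < t` reads only offsets up to `t` and entries before the end of the output,
which later rounds do not alter. -/
theorem Kept.pHat_eq {t : ℕ} (h : Kept t s s') (hs : Between L J t s) {u : Fin n}
    (hu : (u : ℕ) < t) (v : Fin n) : s'.pHat u v = s.pHat u v := by
  unfold Config.pHat
  rw [h.offset u hu.le, h.offset (u + 1) hu]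
  refine Finset.sum_congr rfl fun o ho => ?_
  have ho' : o < s.word .outLen := lt_of_lt_of_le (Finset.mem_Ico.1 ho).2 (hs.offset_le _ hu)
  rw [h.value o ho']
  simp only [h.vert o ho']

/-- The end of a round. -/
def finish (A : AdjList G) (L : ℕ) (u : Fin n) (N t : ℕ) : M n Unit := do
  combine A L u N
  let o ← readWord .outLen
  writeWord (.offset (t + 1)) o
  cleanUp n L

/-- The sum of the output values of the candidates that are equal to `v`. -/
def answer (G : SimpleGraph (Fin n)) [DecidableRel G.Adj] (L : ℕ) (u : Fin n) (N : ℕ)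
    (s : Config n) (v : Fin n) : ℝ :=
  ∑ j ∈ Finset.range (s.word .candLen),
    if s.vert (.cand j) = v ∧ G.degree v ≤ G.degree u then outputValue G L u N j s else 0

theorem sat_finish (A : AdjList G) {u : Fin n} {N₃ i : ℕ} {s₁ : Config n}
    (h₀ : Between L J u s₀) (h : Ready G L J N ε rmax s₀ s) (h' : VisitedThree L J s₁ i s) :
    Sat (finish A L u N₃ u) s fun _ s' => Between L J (u + 1) s' ∧ Kept u s₀ s' ∧
      (∀ v, s'.pHat u v = answer G L u N₃ s v) ∧
      s'.time ≤ s.time + 10 + 3 * s.word .seenLen + 4 * s.word .hitLen +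
        ∑ j ∈ Finset.range (s.word .candLen), (13 + 2 * (L + 1) + 3 * (L + 2) +
          (7 * (L + 1) + 4) * ∑ i ∈ Finset.range (L + 2), (s.data j).len i) := by
  have hol : s.word .outLen = s₀.word .outLen := h.frame.word .outLen fun h => h
  have hun : (u : ℕ) + 1 ≤ n := u.2
  have hJn : s₀.word .outLen + J ≤ n * J := by
    have := h₀.outLen
    have h2 : ((u : ℕ) + 1) * J ≤ n * J := Nat.mul_le_mul_right J hun
    rw [Nat.succ_mul] at h2
    omega
  unfold finish
  rw [sat_bind]
  refine (sat_combine A u N₃ h.candLen (by rw [hol]; exact hJn) h.len_le h.used).mono ?_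
  rintro _ s₂ ⟨a1, a2, a3, a4, a5, a6⟩
  rw [sat_bind, sat_readWord, sat_bind, sat_writeWord]
  set s₃ := (s₂.touch (Sum.inr (Sum.inr .outLen))).setWord (.offset (u + 1)) (s₂.word .outLen)
    with hs₃
  have hf : Frame (fun a => a ∈ outCells n (s.word .outLen) ∨
      a = Sum.inr (Sum.inr (.offset (u + 1)))) s s₃ :=
    ((a1.mono fun _ h => Or.inl h).touch _).setWord
      (by exact Or.inr rfl) _
  have hseen : ∀ t, s₃.vert (.seen t) = s.vert (.seen t) := fun t =>
    hf.vert (.seen t) fun h => h.elim (fun h => h) (by simp)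
  have hstep : ∀ t, s₃.word (.hitStep t) = s.word (.hitStep t) := fun t =>
    hf.word (.hitStep t) fun h => h.elim (fun h => h) (by simp)
  have hvert : ∀ t, s₃.vert (.hitVertex t) = s.vert (.hitVertex t) := fun t =>
    hf.vert (.hitVertex t) fun h => h.elim (fun h => h) (by simp)
  have hvisit : ∀ w, s₃.real (.visit w) = s.real (.visit w) := fun t =>
    hf.real (.visit t) fun h => h.elim (fun h => h) (by simp)
  have hcount : ∀ k w, s₃.word (.count k w) = s.word (.count k w) := fun k w =>
    hf.word (.count k w) fun h => h.elim (fun h => h) (by simp)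
  have hsl : s₃.word .seenLen = s.word .seenLen :=
    hf.word .seenLen fun h => h.elim (fun h => h) (by simp)
  have hcl : s₃.word .candLen = s.word .candLen :=
    hf.word .candLen fun h => h.elim (fun h => h) (by simp)
  have hhl : s₃.word .hitLen = s.word .hitLen :=
    hf.word .hitLen fun h => h.elim (fun h => h) (by simp)
  have hd : ∀ j, s₃.data j = s.data j := fun j => hf.data_eq j
    (fun _ h => h.elim (fun h => h) (by simp)) (fun _ _ h => h.elim (fun h => h) (by simp))
    (fun _ _ h => h.elim (fun h => h) (by simp)) (fun _ h => h.elim (fun h => h) (by simp))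
  have htr := h.tracked h'
  have htr₃ : Tracked L J s₃ := by
    refine ⟨?_, ?_, ?_, ?_, ?_, ?_, ?_, ?_, ?_, ?_, ?_, ?_⟩
    · simpa only [hvisit, hsl, hseen] using htr.seen
    · simpa only [hsl] using htr.seenLen
    · simpa only [hcount, hhl, hstep, hvert] using htr.hit
    · simpa only [hhl, hstep] using htr.hitStep
    · simpa only [hhl] using htr.hitLen
    · simpa only [hcl] using htr.candLen
    · simpa only [hcl, hd] using htr.approx
    · simpa only [hcl, hd] using htr.resid
    · simpa only [hcl, hd] using htr.above
    · simpa only [hcl, hd] using htr.empty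
    · simpa only [hd] using htr.levelLen
    · simp [hs₃, Finset.insert_subset_iff, a6]
  refine (sat_cleanUp htr₃).mono ?_
  rintro _ s₄ ⟨b1, b2, b3, b4⟩
  have hout : ∀ o < s.word .outLen, s₄.vert (.outVertex o) = s₀.vert (.outVertex o) ∧
      s₄.real (.outValue o) = s₀.real (.outValue o) := by
    intro o ho
    constructor
    · rw [b1.vert (.outVertex o) fun h => h, hf.vert (.outVertex o), h.frame.vert (.outVertex o)
        fun h => h]
      rintro (h | h)
      · exact absurd h (not_le.2 ho)
      · simp at h
    · rw [b1.real (.outValue o) fun h => h, hf.real (.outValue o), h.frame.real (.outValue o)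
        fun h => h]
      rintro (h | h)
      · exact absurd h (not_le.2 ho)
      · simp at h
  have holn : s₄.word .outLen = s₂.word .outLen := by
    rw [b1.word .outLen fun h => h]
    simp [hs₃]
  have hoff : ∀ i, i ≠ (u : ℕ) + 1 → s₄.word (.offset i) = s₀.word (.offset i) := by
    intro i hi
    rw [b1.word (.offset i) fun h => h, hf.word (.offset i), h.frame.word (.offset i) fun h => h]
    rintro (h | h)
    · exact h
    · simp at h
      exact hi h
  have hoff' : s₄.word (.offset (u + 1)) = s₂.word .outLen := by
    rw [b1.word (.offset (u + 1)) fun h => h]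
    simp [hs₃]
  refine ⟨⟨b2, b4, ?_, ?_, ?_⟩, ⟨?_, ?_, ?_⟩, ?_, ?_⟩
  · have := h₀.outLen
    rw [holn, Nat.succ_mul]
    omega
  · rw [hoff', holn]
  · intro i hi
    by_cases hiu : i = u + 1
    · rw [hiu, hoff', holn]
    · rw [hoff i hiu, holn]
      exact (h₀.offset_le i (by omega)).trans (hol ▸ a2)
  · exact fun i hi => hoff i (by omega)
  · exact fun o ho => (hout o (hol ▸ ho)).1
  · exact fun o ho => (hout o (hol ▸ ho)).2
  · intro v
    unfold Config.pHat
    -- The offset of `u` is the output length at the start of the round, so the entries of `u` are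
    -- exactly those appended by `combine`.
    rw [hoff', hoff u (by omega), h₀.offset, ← hol]
    refine Eq.trans ?_ (a4 v)
    unfold entrySum
    refine Finset.sum_congr rfl fun o _ => ?_
    have e1 : s₄.vert (.outVertex o) = s₂.vert (.outVertex o) := b1.vert (.outVertex o) fun h => h
    have e2 : s₄.real (.outValue o) = s₂.real (.outValue o) := b1.real (.outValue o) fun h => h
    simp only [e1, e2]
  · simp only [hsl, hhl, hcl, hd] at b3
    have h9 : s₃.time = s₂.time + 2 := by simp [hs₃]
    have h10 : ∑ j ∈ Finset.range (s.word .candLen), (12 + 2 * (L + 1) +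
        7 * (L + 1) * ∑ i ∈ Finset.range (L + 1), (s.data j).len i) +
        ∑ j ∈ Finset.range (s.word .candLen), (1 + 3 * (L + 2) +
        4 * ∑ i ∈ Finset.range (L + 2), (s.data j).len i) ≤
        ∑ j ∈ Finset.range (s.word .candLen), (13 + 2 * (L + 1) + 3 * (L + 2) +
          (7 * (L + 1) + 4) * ∑ i ∈ Finset.range (L + 2), (s.data j).len i) := by
      rw [← Finset.sum_add_distrib]
      refine Finset.sum_le_sum fun j _ => ?_
      have h11 : ∑ i ∈ Finset.range (L + 1), (s.data j).len i ≤
          ∑ i ∈ Finset.range (L + 2), (s.data j).len i := by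
        rw [Finset.sum_range_succ _ (L + 1)]
        omega
      have h12 := Nat.mul_le_mul_left (7 * (L + 1)) h11
      rw [add_mul]
      omega
    omega

/-- One round of the main loop. -/
def round [NeZero n] (A : AdjList G) (L : ℕ) (K ε m : ℝ) (t : ℕ) : M n Unit := do
  let u ← arith (Fin.ofNat n t)
  let N₁ ← arith ⌈K * (L : ℝ) ^ 2 * Real.log (n : ℝ) / ε⌉₊
  stageOne A L ε u N₁
  let rmax ← arith ((L : ℝ) * ε * Real.sqrt ((n : ℝ) / m))
  stageTwo A L rmax
  let du ← deg A u
  let N₃ ← arith ⌈K * (L : ℝ) / ε ^ 2 * rmax * (du : ℝ) * Real.log (n : ℝ)⌉₊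
  stageThree A L u N₃
  finish A L u N₃ t

omit [DecidableRel G.Adj] in
theorem buildIndex_eq [NeZero n] (A : AdjList G) (L : ℕ) (K ε : ℝ) :
    buildIndex A L K ε = (loop n 0 fun t e => deg A (Fin.ofNat n t) >>= fun d => arith (e + d)) >>=
      fun e => arith ((e : ℝ) / 2) >>= fun m => loop n () fun t _ => round A L K ε m t := rfl

/-- The number of walks in the first stage. -/
def walksOne (n L : ℕ) (K ε : ℝ) : ℕ := ⌈K * (L : ℝ) ^ 2 * Real.log (n : ℝ) / ε⌉₊

/-- The number of walks in the third stage from a vertex of degree `d`. -/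
def walksThree (n L : ℕ) (K ε rmax : ℝ) (d : ℕ) : ℕ :=
  ⌈K * (L : ℝ) / ε ^ 2 * rmax * (d : ℝ) * Real.log (n : ℝ)⌉₊

/-- The value of `r_max`. -/
def residMax (n L : ℕ) (ε m : ℝ) : ℝ := (L : ℝ) * ε * Real.sqrt ((n : ℝ) / m)

/-- Bound for the time of one round. -/
def roundCost (L : ℕ) (ε rmax : ℝ) (N₁ N₃ : ℕ) : ℝ :=
  16 + 26 * (N₁ * (L + 1)) + 19 * (N₃ * (L + 1)) + 32 * (L + 1) ^ 2 / ε
    + 17 * (L + 1) ^ 3 * L ^ 2 / rmax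

/-! ### Cost of the second stage, the output and the reset. -/

theorem Ready.sum_visit_le (h : Ready G L J N ε rmax s₀ s) :
    ∑ j ∈ Finset.range (s.word .candLen), s.real (.visit (s.vert (.cand j))) ≤ (L + 1) / 2 := by
  rw [← h.sum]
  exact sum_le_of_inj h.cand.inj Finset.univ (fun _ _ => Finset.mem_univ _)
    (fun w => s.real (.visit w)) fun w _ => h.nonneg w

/-- The threshold is inversely proportional to the visit value `p'` of the candidate, so the cost of
its descent is proportional to `p'`. The sum over the candidates is then controlled by the total
visit mass and not by their number, which matters only for the constant part. -/
theorem Ready.cost_le (h : Ready G L J N ε rmax s₀ s) (hL : 1 ≤ L) (hε : 0 < ε) (hr : 0 < rmax)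
    (hJ : (J : ℝ) ≤ (L + 1) / ε) :
    ∑ j ∈ Finset.range (s.word .candLen), (16 + 2 * ((L : ℝ) + 1) + 31 * (L + 1) *
        levelCost L (rmax / (2 * s.real (.visit (s.vert (.cand j)))))) +
      ((∑ j ∈ Finset.range (s.word .candLen), (13 + 2 * (L + 1) + 3 * (L + 2) +
          (7 * (L + 1) + 4) * ∑ i ∈ Finset.range (L + 2), (s.data j).len i) : ℕ) : ℝ)
      ≤ 32 * (L + 1) ^ 2 / ε + 17 * (L + 1) ^ 3 * L ^ 2 / rmax := by
  have hL' : (1 : ℝ) ≤ L := by exact_mod_cast hL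
  push_cast
  rw [← Finset.sum_add_distrib]
  have hlev : ∀ j < s.word .candLen,
      levelCost L (rmax / (2 * s.real (.visit (s.vert (.cand j)))))
        = (L : ℝ) ^ 2 / rmax * s.real (.visit (s.vert (.cand j))) := by
    intro j hj
    have : 0 < s.real (.visit (s.vert (.cand j))) :=
      (half_pos hε).trans (h.cand.mem_of_lt hj)
    unfold levelCost
    field_simp
  have hterm : ∀ j ∈ Finset.range (s.word .candLen),
      (16 + 2 * ((L : ℝ) + 1) + 31 * (L + 1) *
        levelCost L (rmax / (2 * s.real (.visit (s.vert (.cand j)))))) +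
      (13 + 2 * ((L : ℝ) + 1) + 3 * (L + 2) +
          (7 * (L + 1) + 4) * ∑ i ∈ Finset.range (L + 2), ((s.data j).len i : ℝ))
      ≤ 32 * (L + 1) + 34 * (L + 1) ^ 2 *
        ((L : ℝ) ^ 2 / rmax * s.real (.visit (s.vert (.cand j)))) := by
    intro j hj
    have hj' := Finset.mem_range.1 hj
    have h1 := (h.done j hj').lens
    rw [hlev j hj'] at h1 ⊢
    have h0 : 0 ≤ (L : ℝ) ^ 2 / rmax * s.real (.visit (s.vert (.cand j))) :=
      mul_nonneg (by positivity) (h.nonneg _)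
    set D := (L : ℝ) ^ 2 / rmax * s.real (.visit (s.vert (.cand j)))
    push_cast at h1
    have h2 : (7 * ((L : ℝ) + 1) + 4) * ∑ i ∈ Finset.range (L + 2), ((s.data j).len i : ℝ)
        ≤ (7 * ((L : ℝ) + 1) + 4) * (1 + 2 * (L + 1) * D) :=
      mul_le_mul_of_nonneg_left h1 (by positivity)
    -- The constants are chosen so that `L = 1` works: 50 + 14L ≤ 32(L+1) for the fixed part, and
    -- 39(L+1) + 14(L+1)² ≤ 34(L+1)² for the coefficient of `D`.
    have h3 : 0 ≤ ((L : ℝ) - 1) * ((L + 1) * D) := by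
      have : 0 ≤ (L : ℝ) - 1 := by linarith
      positivity
    nlinarith
  refine (Finset.sum_le_sum hterm).trans ?_
  rw [Finset.sum_add_distrib, Finset.sum_const, Finset.card_range, nsmul_eq_mul, ← Finset.mul_sum,
    ← Finset.mul_sum]
  have hc : ((s.word .candLen : ℕ) : ℝ) ≤ (L + 1) / ε :=
    (Nat.cast_le.2 h.candLen).trans hJ
  have h4 : ((s.word .candLen : ℕ) : ℝ) * (32 * (L + 1)) ≤ 32 * (L + 1) ^ 2 / ε := by
    calc ((s.word .candLen : ℕ) : ℝ) * (32 * (L + 1)) ≤ (L + 1) / ε * (32 * (L + 1)) := by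
          gcongr
      _ = 32 * (L + 1) ^ 2 / ε := by ring
  have h5 : 34 * ((L : ℝ) + 1) ^ 2 * ((L : ℝ) ^ 2 / rmax *
      ∑ j ∈ Finset.range (s.word .candLen), s.real (.visit (s.vert (.cand j))))
      ≤ 17 * (L + 1) ^ 3 * L ^ 2 / rmax := by
    calc _ ≤ 34 * ((L : ℝ) + 1) ^ 2 * ((L : ℝ) ^ 2 / rmax * ((L + 1) / 2)) := by
          gcongr
          exact h.sum_visit_le
      _ = _ := by ring
  linarith

end Round

end ERSketch

end

noncomputable section

namespace ERSketch

open scoped ENNReal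

/-! ## Accuracy -/

section Accuracy

variable {n : ℕ} {G : SimpleGraph (Fin n)} [DecidableRel G.Adj]

/-! ### The approximated vector as the mean of the estimator. -/

theorem pVec_apply (L : ℕ) (u v : Fin n) :
    pVec G L u v = 1 / 2 * ∑ k ∈ Finset.range (L + 1), (lazyMatrix G ^ k) v u := by
  unfold pVec
  rw [Pi.smul_apply, Finset.sum_apply, smul_eq_mul]
  congr 1
  refine Finset.sum_congr rfl fun k _ => ?_
  rw [Matrix.mulVec_single_one]
  rfl

theorem pVec_nonneg (L : ℕ) (u v : Fin n) : 0 ≤ pVec G L u v := by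
  rw [pVec_apply]
  have := Finset.sum_nonneg fun k (_ : k ∈ Finset.range (L + 1)) =>
    lazyMatrix_pow_nonneg (G := G) k v u
  positivity

/-- Reversibility of the walk: D⁻¹AD⁻¹ is symmetric. -/
theorem lazyMatrix_div_comm (w z : Fin n) :
    lazyMatrix G w z / G.degree w = lazyMatrix G z w / G.degree z := by
  rw [lazyMatrix_apply, lazyMatrix_apply]
  by_cases h : w = z
  · subst h
    rfl
  · have h' : z ≠ w := fun e => h e.symm
    simp only [h, h', if_false, zero_add, G.adj_comm w z]
    split_ifs
    · ring
    · simp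

/-- The value of the residual of a vertex on a level for the vertex `u`. -/
def potential (G : SimpleGraph (Fin n)) [DecidableRel G.Adj] (L : ℕ) (u : Fin n) (i : ℕ)
    (w : Fin n) : ℝ :=
  1 / (G.degree w : ℝ) * ∑ k ∈ Finset.range (L + 1 - i), (lazyMatrix G ^ k) w u

/-- The term `k = 0` of the potential is the indicator of `u` over its degree; in the remaining
terms the first factor W is moved to the other side by reversibility, leaving the potential of level
`i + 1`. -/
theorem harmonic_potential (L : ℕ) (u : Fin n) :
    Harmonic G L (fun w => if w = u then 1 / (G.degree u : ℝ) else 0) (potential G L u) := by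
  intro i hi w
  have h1 : L + 1 - i = (L + 1 - (i + 1)) + 1 := by omega
  have h2 : ∀ k, 1 / (G.degree w : ℝ) * (lazyMatrix G ^ (k + 1)) w u
      = ∑ z, lazyMatrix G z w * (1 / (G.degree z : ℝ) * (lazyMatrix G ^ k) z u) := by
    intro k
    rw [pow_succ', Matrix.mul_apply, Finset.mul_sum]
    refine Finset.sum_congr rfl fun z _ => ?_
    have := lazyMatrix_div_comm (G := G) w z
    calc 1 / (G.degree w : ℝ) * (lazyMatrix G w z * (lazyMatrix G ^ k) z u)
        = lazyMatrix G w z / (G.degree w : ℝ) * (lazyMatrix G ^ k) z u := by ring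
      _ = _ := by
        rw [this]
        ring
  rw [← sum_lazyMatrix_mul]
  unfold potential
  rw [h1, Finset.sum_range_succ', mul_add, add_comm]
  congr 1
  · rw [pow_zero, Matrix.one_apply]
    by_cases h : w = u
    · subst h
      simp
    · simp [h]
  · simp only [Finset.mul_sum, h2]
    rw [Finset.sum_comm]

/-- The weight `∑_{i ≤ L - k} r_i(w) / d_w` of a visit of `w` at step `k`. -/
def weight (G : SimpleGraph (Fin n)) [DecidableRel G.Adj] (L : ℕ) (d : CgdData n) (k : ℕ)
    (w : Fin n) : ℝ :=
  ∑ i ∈ Finset.range (L + 1 - k), d.resid i w / (G.degree w : ℝ)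

/-- Both sides sum over the triangle `i + k ≤ L`. The left side is organized by the visits of a
walk, the right side by the levels of the residuals. -/
theorem sum_weight_mul (L : ℕ) (d : CgdData n) (c : ℕ → Fin n → ℝ) :
    ∑ k ∈ Finset.range (L + 1), ∑ w, weight G L d k w * c k w
      = ∑ i ∈ Finset.range (L + 1), ∑ w, ∑ k ∈ Finset.range (L + 1 - i),
        d.resid i w / (G.degree w : ℝ) * c k w := by
  unfold weight
  simp only [Finset.sum_mul]
  calc _ = ∑ k ∈ Finset.range (L + 1), ∑ i ∈ Finset.range (L + 1 - k), ∑ w,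
        d.resid i w / (G.degree w : ℝ) * c k w :=
      Finset.sum_congr rfl fun k _ => Finset.sum_comm
    _ = ∑ i ∈ Finset.range (L + 1), ∑ k ∈ Finset.range (L + 1 - i), ∑ w,
        d.resid i w / (G.degree w : ℝ) * c k w := by
      refine Finset.sum_comm' fun k i => ?_
      simp only [Finset.mem_range]
      omega
    _ = _ := Finset.sum_congr rfl fun i _ => Finset.sum_comm

/-- The expected weight of the visits of a lazy random walk from `u`. -/
def meanWeight (G : SimpleGraph (Fin n)) [DecidableRel G.Adj] (L : ℕ) (u : Fin n)
    (d : CgdData n) : ℝ :=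
  ∑ k ∈ Finset.range (L + 1), ∑ w, weight G L d k w * (lazyMatrix G ^ k) w u

/-- Conservation for the potential of `u`, multiplied by the degree of `v`. It holds at any stage of
the descent, whatever the threshold. -/
theorem CgdInv.pVec_eq {L : ℕ} {v : Fin n} {d : CgdData n} (hG : ∀ v, 0 < G.degree v)
    (h : CgdInv G L v d) (u : Fin n) : pVec G L u v =
      d.approx u * G.degree v / G.degree u + G.degree v * meanWeight G L u d := by
  have hv : (G.degree v : ℝ) ≠ 0 := by have := hG v; positivity
  have h1 := h.conserve _ _ (harmonic_potential L u)
  have h2 : ∑ i ∈ Finset.range (L + 2), ∑ w, d.resid i w * potential G L u i w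
      = meanWeight G L u d := by
    unfold meanWeight
    rw [sum_weight_mul, Finset.sum_range_succ]
    -- Level `L + 1` receives residual but is never relaxed; its potential is an empty sum, so this
    -- residual causes no error.
    have h3 : ∑ w, d.resid (L + 1) w * potential G L u (L + 1) w = 0 :=
      Finset.sum_eq_zero fun w _ => by simp [potential]
    rw [h3, add_zero]
    refine Finset.sum_congr rfl fun i _ => Finset.sum_congr rfl fun w _ => ?_
    unfold potential
    rw [← Finset.mul_sum]
    ring
  have h4 : ∑ w, d.approx w * (if w = u then 1 / (G.degree u : ℝ) else 0)
      = d.approx u * (1 / (G.degree u : ℝ)) := by simp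
  have h5 : pVec G L u v = G.degree v * (1 / 2 * potential G L u 0 v) := by
    rw [pVec_apply]
    unfold potential
    rw [Nat.sub_zero]
    field_simp
  rw [h5, ← h1, h2, h4]
  ring

theorem weight_nonneg {L : ℕ} {v : Fin n} {d : CgdData n} (h : CgdInv G L v d) (k : ℕ)
    (w : Fin n) : 0 ≤ weight G L d k w :=
  Finset.sum_nonneg fun i _ => div_nonneg (h.resid_nonneg i w) (Nat.cast_nonneg _)

theorem meanWeight_nonneg {L : ℕ} {v : Fin n} {d : CgdData n} (h : CgdInv G L v d) (u : Fin n) :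
    0 ≤ meanWeight G L u d :=
  Finset.sum_nonneg fun k _ => Finset.sum_nonneg fun w _ =>
    mul_nonneg (weight_nonneg h k w) (lazyMatrix_pow_nonneg k w u)

/-- At most L+1 levels contribute R/L² each, and (L+1)² ≤ 4L². In this form the total over the L+1
visits of a walk is at most 4R. -/
theorem weight_le {L : ℕ} {v : Fin n} {R : ℝ} {d : CgdData n} (hG : ∀ v, 0 < G.degree v)
    (hL : 1 ≤ L) (hR : 0 < R) (h : CgdDone G L v R d) (k : ℕ) (w : Fin n) :
    weight G L d k w ≤ 4 * R / (L + 1) := by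
  have hw : (0 : ℝ) < G.degree w := by have := hG w; positivity
  have hL' : (1 : ℝ) ≤ L := by exact_mod_cast hL
  have h1 : weight G L d k w ≤ ∑ i ∈ Finset.range (L + 1), R / (L : ℝ) ^ 2 := by
    unfold weight
    refine (Finset.sum_le_sum_of_subset_of_nonneg (Finset.range_mono (Nat.sub_le _ _))
      fun i _ _ => div_nonneg (h.resid_nonneg i w) hw.le).trans ?_
    refine Finset.sum_le_sum fun i hi => ?_
    rw [div_le_iff₀ hw]
    exact h.low i (Nat.lt_succ_iff.1 (Finset.mem_range.1 hi)) w
  refine h1.trans ?_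
  rw [Finset.sum_const, Finset.card_range, nsmul_eq_mul, Nat.cast_add, Nat.cast_one, ← mul_div_assoc,
    div_le_div_iff₀ (by positivity) (by positivity)]
  nlinarith [mul_nonneg hR.le (by nlinarith : (0 : ℝ) ≤ 4 * L ^ 2 - (L + 1) ^ 2)]

/-- Listed vertices that were relaxed contribute zero, and every vertex with residual is listed, so
the sum along the lists is the sum over all vertices. -/
theorem residValue_eq {L j : ℕ} {v : Fin n} {s : Config n} (h : CgdInv G L v (s.data j)) :
    residValue G L j s = countSum L (weight G L (s.data j)) s := by
  unfold countSum
  rw [sum_weight_mul]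
  unfold residValue
  refine Finset.sum_congr rfl fun i _ => ?_
  refine sum_eq_of_inj (h.inj i) Finset.univ (fun _ _ => Finset.mem_univ _)
    (fun w => ∑ k ∈ Finset.range (L + 1 - i), (s.data j).resid i w / (G.degree w : ℝ) *
      (s.word (.count k w) : ℝ)) fun w _ hw => (h.cover i w ?_).2
  intro h0
  exact hw (by simp [h0])

/-- The first stage found the large entries. -/
def GoodOne (G : SimpleGraph (Fin n)) [DecidableRel G.Adj] (L : ℕ) (ε : ℝ) (u : Fin n)
    (s : Config n) : Prop :=
  ∀ v, ε < pVec G L u v → pVec G L u v / 2 < s.real (.visit v)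

/-- The third stage gave good estimates for the candidate `j`. -/
def GoodThree (G : SimpleGraph (Fin n)) [DecidableRel G.Adj] (L : ℕ) (ε : ℝ) (u : Fin n) (N : ℕ)
    (d : CgdData n) (v : Fin n) (s : Config n) : Prop :=
  |(G.degree v : ℝ) / N * countSum L (weight G L d) s - G.degree v * meanWeight G L u d| ≤ ε

variable {L J N : ℕ} {ε rmax : ℝ} {s₀ s : Config n}

/-- For a candidate the `approx` terms of output and exact value coincide and the error is that of
the walks. Otherwise the answer is 0, and a good first stage forces the exact value to be at most ε.
-/
theorem Ready.answer_accurate (hG : ∀ v, 0 < G.degree v) (h : Ready G L J N ε rmax s₀ s)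
    {u : Fin n} {N₃ : ℕ} (h1 : GoodOne G L ε u s)
    (h3 : ∀ j < s.word .candLen, G.degree (s.vert (.cand j)) ≤ G.degree u →
      GoodThree G L ε u N₃ (s.data j) (s.vert (.cand j)) s)
    (v : Fin n) (hv : G.degree v ≤ G.degree u) :
    |answer G L u N₃ s v - pVec G L u v| ≤ ε := by
  by_cases hc : ε / 2 < s.real (.visit v)
  · obtain ⟨j, hj, hjv⟩ := (h.cand.mem v).1 hc
    have hjv' : s.vert (.cand j) = v := hjv
    have h4 : answer G L u N₃ s v = outputValue G L u N₃ j s := by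
      unfold answer
      rw [Finset.sum_eq_single j]
      · rw [if_pos ⟨hjv', hv⟩]
      · intro j' hj' hne
        refine if_neg fun h5 => hne ?_
        exact h.cand.inj j' (Finset.mem_range.1 hj') j hj (h5.1.trans hjv'.symm)
      · intro h5
        exact absurd (Finset.mem_range.2 hj) h5
    have h5 := h.done j hj
    have h6 := h3 j hj (by rwa [hjv'])
    rw [hjv'] at h5 h6
    rw [h4, h5.pVec_eq hG u]
    unfold outputValue
    rw [residValue_eq h5.toCgdInv, hjv']
    unfold GoodThree at h6
    rwa [add_sub_add_left_eq_sub]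
  · have h4 : answer G L u N₃ s v = 0 := by
      unfold answer
      refine Finset.sum_eq_zero fun j hj => if_neg ?_
      rintro ⟨rfl, -⟩
      exact hc (h.cand.mem_of_lt (Finset.mem_range.1 hj))
    have h5 : pVec G L u v ≤ ε := by
      by_contra h6
      push Not at h6
      have := h1 v h6
      exact hc (by linarith)
    rw [h4, zero_sub, abs_neg, abs_of_nonneg (pVec_nonneg L u v)]
    exact h5

/-! ### Tail bounds. -/

theorem ofReal_exp_neg_le {n : ℕ} (hn : 0 < n) {a x : ℝ} (h : a * Real.log n ≤ x) :
    ENNReal.ofReal (Real.exp (-x)) ≤ ENNReal.ofReal ((n : ℝ) ^ (-a)) := by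
  refine ENNReal.ofReal_le_ofReal ?_
  rw [Real.rpow_def_of_pos (by exact_mod_cast hn)]
  exact Real.exp_le_exp.2 (by linarith)

open Classical in
/-- The indicator of a proposition. -/
def ind (p : Prop) : ℝ≥0∞ := if p then 1 else 0

theorem ind_le_one (p : Prop) : ind p ≤ 1 := by
  unfold ind
  split_ifs <;> simp

theorem ind_pos {p : Prop} (h : p) : ind p = 1 := if_pos h

theorem ind_neg {p : Prop} (h : ¬ p) : ind p = 0 := if_neg h

theorem ind_le {p : Prop} {x : ℝ≥0∞} (h : p → 1 ≤ x) : ind p ≤ x := by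
  by_cases hp : p
  · exact (ind_pos hp).trans_le (h hp)
  · exact (ind_neg hp).trans_le zero_le

theorem ind_mono {p q : Prop} (h : p → q) : ind p ≤ ind q :=
  ind_le fun hp => (ind_pos (h hp)).ge

/-- Markov's inequality for an exponential moment. -/
theorem wp_indicator_le {α : Type} (m : M n α) (s : Config n) (E : Config n → Prop)
    (Y : Config n → ℝ) (θ c x : ℝ) (hE : ∀ s', E s' → 0 ≤ θ * Y s' + c)
    (h : wp m (fun _ s' => ENNReal.ofReal (Real.exp (θ * Y s'))) s
      ≤ ENNReal.ofReal (Real.exp x)) :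
    wp m (fun _ s' => ind (E s')) s ≤ ENNReal.ofReal (Real.exp (c + x)) := by
  refine (wp_mono (Q' := fun _ s' => ENNReal.ofReal (Real.exp c) *
    ENNReal.ofReal (Real.exp (θ * Y s'))) fun _ s' => ind_le fun hs => ?_).trans ?_
  · rw [← ENNReal.ofReal_mul (Real.exp_pos _).le, ← Real.exp_add, ENNReal.one_le_ofReal]
    exact Real.one_le_exp (by linarith [hE s' hs])
  · rw [wp_const_mul, Real.exp_add, ENNReal.ofReal_mul (Real.exp_pos _).le]
    gcongr

/-- Union bound. -/
theorem wp_exists_le {ι α : Type} (I : Finset ι) (m : M n α) (s : Config n)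
    (E : ι → Config n → Prop) (δ : ℝ≥0∞)
    (h : ∀ i ∈ I, wp m (fun _ s' => ind (E i s')) s ≤ δ) :
    wp m (fun _ s' => ind (∃ i ∈ I, E i s')) s ≤ I.card * δ := by
  refine (wp_mono (Q' := fun _ s' => ∑ i ∈ I, ind (E i s')) fun _ s' => ind_le ?_).trans ?_
  · rintro ⟨i, hi, hE⟩
    exact (ind_pos hE).ge.trans
      (Finset.single_le_sum (f := fun i => ind (E i s')) (fun _ _ => zero_le) hi)
  · rw [wp_sum]
    exact (Finset.sum_le_sum h).trans_eq (by simp)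

/-- Lower Chernoff tail for the event that an entry `p > ε` is estimated by at most `p / 2`, and a
union bound over the vertices. -/
theorem wp_stageOne_bad_le (hG : ∀ v, 0 < G.degree v) (A : AdjList G) (hL : 1 ≤ L) (hε : 0 < ε)
    (hJ : ∀ c : ℕ, c * ε ≤ L + 1 → c ≤ J) (hn : 0 < n) {K a : ℝ} (hN : 0 < N)
    (hNK : K * (L : ℝ) ^ 2 * Real.log n / ε ≤ N) (ha : 8 * a ≤ K * L)
    (h : Clean s) (hs : s.used ⊆ cells n L J) (u : Fin n) :
    wp (stageOne A L ε u N) (fun _ s' => ind (¬ GoodOne G L ε u s')) s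
      ≤ n * ENNReal.ofReal ((n : ℝ) ^ (-a)) := by
  have hL' : (1 : ℝ) ≤ L := by exact_mod_cast hL
  have hN' : (0 : ℝ) < N := by exact_mod_cast hN
  have hlog : 0 ≤ Real.log n := Real.log_natCast_nonneg n
  refine le_trans (wp_mono (Q' := fun _ s' => ind (∃ v ∈ (Finset.univ : Finset (Fin n)),
    (ε < pVec G L u v ∧ s'.real (.visit v) ≤ pVec G L u v / 2)))
    fun _ s' => ind_mono fun h => ?_) ?_
  · unfold GoodOne at h
    push Not at h
    simpa using h
  refine (wp_exists_le Finset.univ _ s _ (ENNReal.ofReal ((n : ℝ) ^ (-a))) fun v _ => ?_).trans_eq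
    (by rw [Finset.card_univ, Fintype.card_fin])
  by_cases hp : ε < pVec G L u v
  swap
  · exact wp_le_of_sat fun x _ => (ind_neg fun h => hp h.1).trans_le zero_le
  set p := pVec G L u v with hpdef
  set B : ℝ := (L + 1) * (1 / (2 * (N : ℝ))) with hB
  have hBpos : 0 < B := by positivity
  -- `B` is the largest possible contribution of one walk. With θ = -1/B the exponent becomes
  -- -(p/B)(1/2 - e⁻¹), and p/B = 2Np/(L+1) is at least K L log n; the 8 in `ha` comes from 1/2 -
  -- e⁻¹ ≥ 1/8.
  have h1 := wp_stageOne_exp_le hG A hN hε hJ u h hs v (-(1 / B))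
  have hsum : ∑ k ∈ Finset.range (L + 1), 1 / (2 * (N : ℝ)) * (lazyMatrix G ^ k) v u = p / N := by
    rw [← Finset.mul_sum, hpdef, pVec_apply]
    field_simp
  rw [hsum, ← hB, neg_mul, one_div_mul_cancel hBpos.ne'] at h1
  have h2 := wp_indicator_le (stageOne A L ε u N) s
    (fun s' => ε < p ∧ s'.real (.visit v) ≤ p / 2) (fun s' => s'.real (.visit v)) (-(1 / B))
    (p / 2 / B) _ (fun s' hs' => by
      have : 0 ≤ (p / 2 - s'.real (.visit v)) / B := div_nonneg (by linarith [hs'.2]) hBpos.le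
      calc 0 ≤ (p / 2 - s'.real (.visit v)) / B := this
        _ = _ := by ring) h1
  refine h2.trans ?_
  have hpos : 0 < p := hε.trans hp
  have hx : p / 2 / B + N * (p / N * ((Real.exp (-1) - 1) / B))
      = -(p / B * (1 / 2 - Real.exp (-1))) := by
    field_simp
    ring
  rw [hx]
  refine ofReal_exp_neg_le hn ?_
  have he : 1 / 8 ≤ 1 / 2 - Real.exp (-1) := by
    have := Real.exp_neg_one_lt_d9
    linarith
  have hpB : K * L * Real.log n ≤ p / B := by
    rw [hB, le_div_iff₀ (by positivity)]
    have h3 : K * (L : ℝ) ^ 2 * Real.log n ≤ ε * N := by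
      rw [div_le_iff₀ hε] at hNK
      linarith
    have h4 : ε * N ≤ p * N := by gcongr
    have h5 : K * L * Real.log n * ((L + 1) * (1 / (2 * (N : ℝ))))
        = (K * L * Real.log n * (L + 1) / 2) / N := by
      field_simp
    rw [h5, div_le_iff₀ hN']
    by_cases hKL : 0 ≤ K * L * Real.log n
    · nlinarith
    · push Not at hKL
      nlinarith [mul_pos hpos hN']
  have h6 : 0 ≤ p / B := by positivity
  calc a * Real.log n = 1 / 8 * ((8 * a) * Real.log n) := by ring
    _ ≤ 1 / 8 * (K * L * Real.log n) := by gcongr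
    _ ≤ 1 / 8 * (p / B) := by gcongr
    _ ≤ p / B * (1 / 2 - Real.exp (-1)) := by nlinarith

/-- Here 2 rmax/p is the range of one walk and τ is θ times the range. As |τ| ≤ 1, the second-order
part of exp τ is at most τ². The mean bound d μ ≤ 2p and |τ| = ε/(4p) make the variance term at most
half of the deviation term. The remaining half is Nε²/(16 rmax d), from which `p` has cancelled. -/
theorem tail_exponent_le {N μ d p rmax ε τ : ℝ} (hN : 0 ≤ N) (hμ : 0 ≤ μ) (hd : 0 < d)
    (hr : 0 < rmax) (hε : 0 < ε) (hp : ε / 2 < p) (hμp : d * μ ≤ 2 * p) (hτ : |τ| = ε / (4 * p)) :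
    -(N * μ * τ + |τ| * (N * ε / d)) / (2 * rmax / p) +
      N * (μ * ((Real.exp τ - 1) / (2 * rmax / p))) ≤ -(N * ε ^ 2 / (16 * rmax * d)) := by
  have hp0 : 0 < p := (half_pos hε).trans hp
  have hτ1 : |τ| ≤ 1 := by
    rw [hτ, div_le_one (by positivity)]
    linarith
  have h1 : Real.exp τ - 1 - τ ≤ |τ| ^ 2 := by
    rw [sq_abs]
    exact (abs_le.1 (Real.abs_exp_sub_one_sub_id_le hτ1)).2
  have h2 : μ * |τ| ≤ ε / (2 * d) := by
    rw [hτ, le_div_iff₀ (by positivity)]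
    calc μ * (ε / (4 * p)) * (2 * d) = d * μ * (ε / (2 * p)) := by
          field_simp
          ring
      _ ≤ 2 * p * (ε / (2 * p)) := by gcongr
      _ = ε := by field_simp
  have h3 : μ * (Real.exp τ - 1 - τ) ≤ |τ| * (ε / (2 * d)) := by
    calc μ * (Real.exp τ - 1 - τ) ≤ μ * |τ| ^ 2 := by gcongr
      _ = |τ| * (μ * |τ|) := by ring
      _ ≤ _ := by gcongr
  have h4 : N * (p / (2 * rmax)) * (μ * (Real.exp τ - 1 - τ)) ≤
      N * (p / (2 * rmax)) * (|τ| * (ε / (2 * d))) := by gcongr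
  have h5 : N * (p / (2 * rmax)) * (|τ| * (ε / (2 * d))) = N * ε ^ 2 / (16 * rmax * d) := by
    rw [hτ]
    field_simp
    ring
  have h6 : -(N * μ * τ + |τ| * (N * ε / d)) / (2 * rmax / p) +
      N * (μ * ((Real.exp τ - 1) / (2 * rmax / p)))
      = N * (p / (2 * rmax)) * (μ * (Real.exp τ - 1 - τ))
        - 2 * (N * (p / (2 * rmax)) * (|τ| * (ε / (2 * d)))) := by
    field_simp
    ring
  rw [h6]
  linarith

/-- The sign of τ selects the upper or the lower tail. The number of walks is set by the degree of
`u`, and `hv` transfers it to `v`. -/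
theorem wp_stageThree_tail_le (hG : ∀ v, 0 < G.degree v) (A : AdjList G) (hL : 1 ≤ L)
    (hε : 0 < ε) (hr : 0 < rmax) (hn : 0 < n) {u v : Fin n} (hv : G.degree v ≤ G.degree u)
    {K a p : ℝ} {N₃ : ℕ}
    (hNK : K * (L : ℝ) / ε ^ 2 * rmax * (G.degree u : ℝ) * Real.log n ≤ N₃)
    (ha : 16 * a ≤ K * L) (ha0 : 0 ≤ a)
    (hp : ε / 2 < p) {d : CgdData n} (hd : CgdDone G L v (rmax / (2 * p)) d)
    (hpp : pVec G L u v ≤ 2 * p)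
    (hc : ∀ k w, s.word (.count k w) = 0) (hl : s.word .hitLen = 0) (hs : s.used ⊆ cells n L J)
    {τ : ℝ} (hτ : |τ| = ε / (4 * p)) :
    wp (stageThree A L u N₃) (fun _ s' => ind (|τ| * (N₃ * ε / G.degree v) <
        τ * (countSum L (weight G L d) s' - N₃ * meanWeight G L u d))) s
      ≤ ENNReal.ofReal ((n : ℝ) ^ (-a)) := by
  have hL' : (0 : ℝ) < (L : ℝ) + 1 := by positivity
  have hp0 : 0 < p := (half_pos hε).trans hp
  have hdv : (0 : ℝ) < G.degree v := by have := hG v; positivity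
  have hR : 0 < rmax / (2 * p) := by positivity
  -- The bound of `weight_le` for one visit, with R = rmax/(2p).
  set b : ℝ := 4 * (rmax / (2 * p)) / (L + 1) with hb
  have hbpos : 0 < b := by positivity
  have hB : ((L : ℝ) + 1) * b = 2 * rmax / p := by
    rw [hb]
    field_simp
    norm_num
  set μ := meanWeight G L u d with hμ
  have hμ0 : 0 ≤ μ := meanWeight_nonneg hd.toCgdInv u
  have hμp : (G.degree v : ℝ) * μ ≤ 2 * p := by
    have h1 := hd.pVec_eq hG u
    have h2 : 0 ≤ d.approx u * G.degree v / G.degree u :=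
      div_nonneg (mul_nonneg (hd.approx_nonneg u) hdv.le) (Nat.cast_nonneg _)
    linarith
  have h1 := wp_stageThree_exp_le hG A N₃ u hc hl hs (weight G L d) b hbpos
    (fun k _ w => weight_nonneg hd.toCgdInv k w) (fun k _ w => weight_le hG hL hR hd k w)
    (τ / (2 * rmax / p))
  have hB0 : (2 * rmax / p) ≠ 0 := by positivity
  rw [hB, div_mul_cancel₀ _ hB0] at h1
  have h2 := wp_indicator_le (stageThree A L u N₃) s (fun s' => |τ| * (N₃ * ε / G.degree v) <
        τ * (countSum L (weight G L d) s' - N₃ * μ)) (countSum L (weight G L d))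
    (τ / (2 * rmax / p)) (-(N₃ * μ * τ + |τ| * (N₃ * ε / G.degree v)) / (2 * rmax / p)) _
    (fun s' hs' => by
      rw [div_mul_eq_mul_div, ← add_div]
      exact div_nonneg (by linarith) (by positivity)) h1
  refine h2.trans ?_
  have h3 := tail_exponent_le (N := N₃) (Nat.cast_nonneg _) hμ0 hdv hr hε hp hμp hτ
  have h4 : a * Real.log n ≤ N₃ * ε ^ 2 / (16 * rmax * G.degree v) := by
    have hlog : 0 ≤ Real.log n := Real.log_natCast_nonneg n
    rw [le_div_iff₀ (by positivity)]
    have h5 : K * (L : ℝ) * rmax * (G.degree u : ℝ) * Real.log n ≤ N₃ * ε ^ 2 := by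
      have h6 := mul_le_mul_of_nonneg_right hNK (sq_nonneg ε)
      calc K * (L : ℝ) * rmax * (G.degree u : ℝ) * Real.log n
          = K * (L : ℝ) / ε ^ 2 * rmax * (G.degree u : ℝ) * Real.log n * ε ^ 2 := by field_simp
        _ ≤ _ := h6
    calc a * Real.log n * (16 * rmax * G.degree v)
        = (16 * a) * (rmax * G.degree v * Real.log n) := by ring
      _ ≤ (16 * a) * (rmax * G.degree u * Real.log n) := by gcongr
      _ ≤ (K * L) * (rmax * G.degree u * Real.log n) := by gcongr
      _ = K * (L : ℝ) * rmax * (G.degree u : ℝ) * Real.log n := by ring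
      _ ≤ _ := h5
  refine le_trans (ENNReal.ofReal_le_ofReal (Real.exp_le_exp.2 h3)) (ofReal_exp_neg_le hn h4)

theorem exists_tail_of_not_goodThree (hG : ∀ v, 0 < G.degree v) {u v : Fin n} {d : CgdData n}
    {τ : ℝ} (hτ : 0 < τ) {N₃ : ℕ} (hN : 0 < N₃) (h : ¬ GoodThree G L ε u N₃ d v s) :
    |τ| * (N₃ * ε / G.degree v) <
        τ * (countSum L (weight G L d) s - N₃ * meanWeight G L u d) ∨
    |(-τ)| * (N₃ * ε / G.degree v) <
        (-τ) * (countSum L (weight G L d) s - N₃ * meanWeight G L u d) := by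
  have hdv : (0 : ℝ) < G.degree v := by have := hG v; positivity
  have hN' : (0 : ℝ) < N₃ := by exact_mod_cast hN
  unfold GoodThree at h
  set Y := countSum L (weight G L d) s
  set μ := meanWeight G L u d
  have h1 : (G.degree v : ℝ) / N₃ * Y - G.degree v * μ = (Y - N₃ * μ) * (G.degree v / N₃) := by
    field_simp
  rw [h1, abs_mul, abs_of_pos (div_pos hdv hN'), not_le] at h
  have h2 : N₃ * ε / G.degree v < |Y - N₃ * μ| := by
    rw [div_lt_iff₀ hdv]
    calc N₃ * ε < N₃ * (|Y - N₃ * μ| * (G.degree v / N₃)) := by gcongr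
      _ = _ := by field_simp
  rw [abs_neg, abs_of_pos hτ]
  rcases lt_abs.1 h2 with h3 | h3
  · left
    gcongr
  · right
    rw [neg_mul, ← mul_neg]
    gcongr

theorem wp_stageThree_bad_le (hG : ∀ v, 0 < G.degree v) (A : AdjList G) (hL : 1 ≤ L)
    (hε : 0 < ε) (hr : 0 < rmax) (hn : 0 < n) {u : Fin n}
    {K a : ℝ} {N₃ : ℕ} (hN₃ : 0 < N₃)
    (hNK : K * (L : ℝ) / ε ^ 2 * rmax * (G.degree u : ℝ) * Real.log n ≤ N₃)
    (ha : 16 * a ≤ K * L) (ha0 : 0 ≤ a) (h : Ready G L J N ε rmax s₀ s) (h1 : GoodOne G L ε u s)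
    (hc : ∀ k w, s.word (.count k w) = 0) (hl : s.word .hitLen = 0) :
    wp (stageThree A L u N₃) (fun _ s' => ind (¬ ∀ j < s.word .candLen,
        G.degree (s.vert (.cand j)) ≤ G.degree u →
        GoodThree G L ε u N₃ (s.data j) (s.vert (.cand j)) s')) s
      ≤ n * (2 * ENNReal.ofReal ((n : ℝ) ^ (-a))) := by
  refine le_trans (wp_mono (Q' := fun _ s' => ind (∃ j ∈ Finset.range (s.word .candLen),
    (G.degree (s.vert (.cand j)) ≤ G.degree u ∧
      ¬ GoodThree G L ε u N₃ (s.data j) (s.vert (.cand j)) s')))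
      fun _ s' => ind_mono fun h => ?_) ?_
  · push Not at h
    simpa using h
  refine (wp_exists_le _ _ s _ (2 * ENNReal.ofReal ((n : ℝ) ^ (-a))) fun j hj => ?_).trans ?_
  · have hj' := Finset.mem_range.1 hj
    by_cases hdeg : G.degree (s.vert (.cand j)) ≤ G.degree u
    swap
    · exact wp_le_of_sat fun x _ => (ind_neg fun h => hdeg h.1).trans_le zero_le
    have hp : ε / 2 < s.real (.visit (s.vert (.cand j))) := h.cand.mem_of_lt hj'
    -- For entries above ε this is the good first stage; a smaller entry is below twice the value of
    -- any candidate, which exceeds ε/2.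
    have hpp : pVec G L u (s.vert (.cand j)) ≤ 2 * s.real (.visit (s.vert (.cand j))) := by
      by_cases h2 : ε < pVec G L u (s.vert (.cand j))
      · have := h1 _ h2
        linarith
      · linarith
    have hτ0 : 0 < ε / (4 * s.real (.visit (s.vert (.cand j)))) := by
      have := (half_pos hε).trans hp
      positivity
    have h2 := wp_stageThree_tail_le hG A hL hε hr hn hdeg hNK ha ha0 hp (h.done j hj') hpp hc hl
      h.used (abs_of_pos hτ0)
    have h3 := wp_stageThree_tail_le hG A hL hε hr hn hdeg hNK ha ha0 hp (h.done j hj') hpp hc hl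
      h.used ((abs_neg _).trans (abs_of_pos hτ0))
    rw [two_mul]
    refine le_trans (le_trans (wp_mono fun _ s' => ind_le fun h4 => ?_)
      (wp_add _ _ _ _).le) (add_le_add h2 h3)
    rcases exists_tail_of_not_goodThree hG hτ0 hN₃ h4.2 with h5 | h5
    · exact le_add_right (ind_pos h5).ge
    · exact le_add_left (ind_pos h5).ge
  · rw [Finset.card_range]
    gcongr
    exact le_of_inj h.cand.inj

end Accuracy

end ERSketch

end

noncomputable section

namespace ERSketch

open scoped ENNReal

/-! ## The main loop -/

section Main

variable {n : ℕ} {G : SimpleGraph (Fin n)} [DecidableRel G.Adj] {L J N : ℕ} {K ε rmax : ℝ}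
  {s₀ s : Config n}

theorem sat_stageTwo_of_afterOne (hG : ∀ v, 0 < G.degree v) (A : AdjList G) (hL : 1 ≤ L)
    (hε : 0 < ε) (hr : 0 < rmax) (hJ : ∀ c : ℕ, c * ε ≤ L + 1 → c ≤ J) (h₀ : Clean s₀)
    (h : AfterOne L J N ε s₀ s) :
    Sat (stageTwo A L rmax) s.step fun _ s' => Ready G L J N ε rmax s₀ s' ∧
      (∀ w, s'.real (.visit w) = s.real (.visit w)) ∧
      (∀ k w, s'.word (.count k w) = 0) ∧ s'.word .hitLen = 0 ∧
      (s'.time : ℝ) ≤ s.time + 2 + ∑ j ∈ Finset.range (s'.word .candLen),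
        (16 + 2 * (L + 1) + 31 * (L + 1) *
          levelCost L (rmax / (2 * s'.real (.visit (s'.vert (.cand j)))))) := by
  have hc : s.step.word .candLen ≤ J :=
    candidates_le h.nonneg h.sum hJ h.cand.inj fun i hi => h.cand.mem_of_lt hi
  have hp : ∀ j < s.step.word .candLen, 0 < s.step.real (.visit (s.step.vert (.cand j))) :=
    fun j hj => (half_pos hε).trans (h.cand.mem_of_lt hj)
  have hd : ∀ j, (s.step.data j).Empty := fun j => by
    have hdj : s.step.data j = s₀.data j := h.frame.data_eq j (fun _ h => h) (fun _ _ h => h)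
      (fun _ _ h => h) fun _ h => h
    rw [hdj]
    exact ⟨h₀.approx j, h₀.resid j, h₀.levelLen j⟩
  refine (sat_stageTwo hG A hL hr hc hp hd h.used).mono ?_
  rintro _ s' ⟨h2, ht⟩
  have hf := h2.frame
  have hv : ∀ w, s'.real (.visit w) = s.real (.visit w) := fun w => hf.real _ fun h => h
  have hcand : ∀ t, s'.vert (.cand t) = s.vert (.cand t) := fun t => hf.vert _ fun h => h
  have hcl : s'.word .candLen = s.word .candLen := hf.word _ fun h => h
  refine ⟨h.ready hJ ⟨⟨hf.real, hf.vert, hf.word⟩, h2.done, h2.empty, h2.used⟩, hv,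
    fun k w => ?_, ?_, ?_⟩
  · rw [hf.word (.count k w) fun h => h]
    exact (h.frame.word (.count k w) fun h => h).trans (h₀.count k w)
  · rw [hf.word .hitLen fun h => h]
    exact (h.frame.word .hitLen fun h => h).trans h₀.hitLen
  · simp only [hv, hcand, hcl]
    refine ht.trans (le_of_eq ?_)
    simp only [Config.step_time, Config.step_word, Config.step_real, Config.step_vert]
    push_cast
    ring

theorem Between.step {t : ℕ} (h : Between L J t s) : Between L J t s.step :=
  ⟨⟨h.clean.visit, h.clean.seenLen, h.clean.candLen, h.clean.approx, h.clean.resid,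
    h.clean.levelLen, h.clean.count, h.clean.hitLen⟩, h.used, h.outLen, h.offset, h.offset_le⟩

variable [NeZero n]

theorem sat_round (hG : ∀ v, 0 < G.degree v) (A : AdjList G) (hL : 1 ≤ L) (hε : 0 < ε)
    (hJ : ∀ c : ℕ, c * ε ≤ L + 1 → c ≤ J) (hJ' : (J : ℝ) ≤ (L + 1) / ε) {m : ℝ}
    (hr : 0 < residMax n L ε m) (hN : 0 < walksOne n L K ε) (u : Fin n) (h : Between L J u s) :
    Sat (round A L K ε m u) s fun _ s' => Between L J (u + 1) s' ∧ Kept u s s' ∧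
      (s'.time : ℝ) ≤ s.time + roundCost L ε (residMax n L ε m) (walksOne n L K ε)
        (walksThree n L K ε (residMax n L ε m) (G.degree u)) := by
  unfold round
  rw [Fin.ofNat_val_eq_self, sat_bind, sat_arith, sat_bind, sat_arith, sat_bind]
  refine (sat_stageOne A hN hε hJ u h.step.step.clean h.used).mono ?_
  rintro _ s₁ ⟨ht₁, h₁⟩
  rw [sat_bind, sat_arith, sat_bind]
  refine (sat_stageTwo_of_afterOne hG A hL hε hr hJ h.step.step.clean h₁).mono ?_
  rintro _ s₂ ⟨h₂, -, hc, hl, ht₂⟩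
  rw [sat_bind, sat_deg, sat_bind, sat_arith, sat_bind, A.length_nbrs]
  refine (sat_stageThree A (walksThree n L K ε (residMax n L ε m) (G.degree u)) u
    (s := s₂.step.step) hc hl h₂.used).mono ?_
  rintro _ s₃ ⟨ht₃, h₃⟩
  have h₂₃ := h₂.step.step.stageThree h₃.frame h₃.used
  refine (sat_finish A h.step.step h₂₃ h₃).mono ?_
  rintro _ s₄ ⟨b1, b2, -, b4⟩
  refine ⟨b1, ⟨b2.offset, b2.vert, b2.value⟩, ?_⟩
  have hreal : s₃.real = s₂.real := funext fun a => h₃.frame.real a fun h => h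
  have hcand : ∀ t, s₃.vert (.cand t) = s₂.vert (.cand t) := fun t => h₃.frame.vert _ fun h => h
  have hcl : s₃.word .candLen = s₂.word .candLen := h₃.frame.word _ fun h => h
  have hcost := h₂₃.cost_le hL hε hr hJ'
  have hsl := h₂₃.seenLen
  have hhl := h₃.len
  rw [hreal] at hcost
  simp only [hcand, hcl] at hcost b4
  simp only [Config.step_time] at ht₁ ht₃
  set N₁ := walksOne n L K ε
  set N₃ := walksThree n L K ε (residMax n L ε m) (G.degree u)
  have e4 : (s₄.time : ℝ) ≤ s₂.time + 2 + 15 * (N₃ * (L + 1)) + 10 + 3 * (N₁ * (L + 1)) +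
      4 * (N₃ * (L + 1)) + ((∑ j ∈ Finset.range (s₂.word .candLen), (13 + 2 * (L + 1) +
        3 * (L + 2) + (7 * (L + 1) + 4) * ∑ i ∈ Finset.range (L + 2), (s₃.data j).len i) : ℕ) : ℝ)
      := by
    have : s₄.time ≤ s₂.time + 2 + 15 * (N₃ * (L + 1)) + 10 + 3 * (N₁ * (L + 1)) +
      4 * (N₃ * (L + 1)) + ∑ j ∈ Finset.range (s₂.word .candLen), (13 + 2 * (L + 1) +
        3 * (L + 2) + (7 * (L + 1) + 4) * ∑ i ∈ Finset.range (L + 2), (s₃.data j).len i) := by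
      omega
    exact_mod_cast this
  have e1 : (s₁.time : ℝ) ≤ s.time + 2 + 23 * (N₁ * (L + 1)) := by
    have : s₁.time ≤ s.time + 2 + 23 * (N₁ * (L + 1)) := by omega
    exact_mod_cast this
  -- The coefficients add the clean-up to the walks: 26 = 23 + 3 for the first stage and 19 = 15 + 4
  -- for the third.
  unfold roundCost
  linarith

/-- Conditioning on the outcome of the first two stages, which fix candidates, residuals and
weights: the tail bound of the third stage then holds from each such state with a good first stage.
-/
theorem wp_round_bad_le (hG : ∀ v, 0 < G.degree v) (A : AdjList G) (hL : 1 ≤ L) (hK : 0 < K)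
    (hε : 0 < ε) (hJ : ∀ c : ℕ, c * ε ≤ L + 1 → c ≤ J) (hn : 2 ≤ n) {m a : ℝ}
    (hr : 0 < residMax n L ε m) (ha : 16 * a ≤ K * L) (ha0 : 0 ≤ a)
    (u : Fin n) (h : Between L J u s) :
    wp (round A L K ε m u) (fun _ s' => ind (¬ ∀ v, G.degree v ≤ G.degree u →
        |s'.pHat u v - pVec G L u v| ≤ ε)) s ≤
      n * ENNReal.ofReal ((n : ℝ) ^ (-a)) + n * (2 * ENNReal.ofReal ((n : ℝ) ^ (-a))) := by
  have hn0 : 0 < n := by omega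
  have hlog : 0 < Real.log n := Real.log_pos (by exact_mod_cast hn)
  have hL' : (0 : ℝ) < L := by exact_mod_cast hL
  have hd : (0 : ℝ) < G.degree u := by exact_mod_cast hG u
  have hN₁ : 0 < walksOne n L K ε := Nat.ceil_pos.2 (by positivity)
  have hN₃ : 0 < walksThree n L K ε (residMax n L ε m) (G.degree u) :=
    Nat.ceil_pos.2 (by positivity)
  unfold round
  rw [Fin.ofNat_val_eq_self, wp_bind, wp_arith, wp_bind, wp_arith, wp_bind]
  have hc₀ := h.step.step.clean
  refine le_trans (wp_mono_of_sat (Q' := fun _ s₁ => ind (¬ GoodOne G L ε u s₁) +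
    n * (2 * ENNReal.ofReal ((n : ℝ) ^ (-a)))) (sat_stageOne A hN₁ hε hJ u hc₀ h.used) ?_) ?_
  · rintro _ s₁ ⟨-, h₁⟩
    by_cases hg : GoodOne G L ε u s₁
    swap
    · rw [ind_pos hg]
      exact le_add_right (wp_le_of_sat fun x _ => ind_le_one _)
    refine le_add_left ?_
    rw [wp_bind, wp_arith, wp_bind]
    refine wp_le_of_sat ((sat_stageTwo_of_afterOne hG A hL hε hr hJ hc₀ h₁).mono ?_)
    rintro _ s₂ ⟨h₂, hv, hc, hl, -⟩
    have hg₂ : GoodOne G L ε u s₂.step.step := fun v hp => (hg v hp).trans_eq (hv v).symm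
    rw [wp_bind, wp_deg, wp_bind, wp_arith, wp_bind, A.length_nbrs]
    refine le_trans (wp_mono_of_sat (sat_stageThree A
      (walksThree n L K ε (residMax n L ε m) (G.degree u)) u (s := s₂.step.step) hc hl h₂.used) ?_)
      (wp_stageThree_bad_le hG A hL hε hr hn0 hN₃ (Nat.le_ceil _) ha ha0 h₂.step.step hg₂ hc hl)
    rintro _ s₃ ⟨-, h₃⟩
    by_cases hb : ∀ j < s₂.step.step.word .candLen,
        G.degree (s₂.step.step.vert (.cand j)) ≤ G.degree u →
        GoodThree G L ε u (walksThree n L K ε (residMax n L ε m) (G.degree u))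
          (s₂.step.step.data j) (s₂.step.step.vert (.cand j)) s₃
    swap
    · exact le_trans (wp_le_of_sat fun x _ => ind_le_one _) (ind_pos hb).ge
    have h₂₃ := h₂.step.step.stageThree h₃.frame h₃.used
    refine wp_le_of_sat ((sat_finish A h.step.step h₂₃ h₃).mono ?_)
    rintro _ s₄ ⟨-, -, b3, -⟩
    refine ind_le fun h4 => absurd (fun v hv => ?_) h4
    rw [b3]
    have hcand : ∀ t, s₃.vert (.cand t) = s₂.step.step.vert (.cand t) :=
      fun t => h₃.frame.vert _ fun h => h
    have hcl : s₃.word .candLen = s₂.step.step.word .candLen := h₃.frame.word _ fun h => h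
    have hdata : ∀ j, s₃.data j = s₂.step.step.data j := fun j =>
      h₃.frame.data_eq j (fun _ h => h) (fun _ _ h => h) (fun _ _ h => h) (fun _ h => h)
    refine h₂₃.answer_accurate (N₃ := walksThree n L K ε (residMax n L ε m) (G.degree u)) hG
      (fun v hp => ?_) ?_ v hv
    · rw [h₃.frame.real (.visit v) fun h => h]
      exact hg₂ v hp
    · intro j hj
      rw [hcand, hdata]
      exact hb j (hcl ▸ hj)
  · rw [wp_add, wp_const]
    gcongr
    exact wp_stageOne_bad_le hG A hL hε hJ hn0 hN₁ (Nat.le_ceil _) (by linarith) hc₀ h.used u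

omit [NeZero n] in
-- Union bound over the iterations: each raises the expected potential by at most δ, from every
-- state that satisfies the invariant.
theorem wp_loop_le {β : Type} {k : ℕ} {b : β} {body : ℕ → β → M n β} (I : ℕ → β → Config n → Prop)
    (Φ : ℕ → β → Config n → ℝ≥0∞) (δ : ℝ≥0∞) (h0 : I 0 b s)
    (hsat : ∀ i < k, ∀ c s, I i c s → Sat (body i c) s.step (I (i + 1)))
    (hwp : ∀ i < k, ∀ c s, I i c s → wp (body i c) (Φ (i + 1)) s.step ≤ Φ i c s + δ) :
    wp (loop k b body) (Φ k) s ≤ Φ 0 b s + k * δ := by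
  induction k with
  | zero => simp [loop, wp_pure]
  | succ k ih =>
    unfold loop
    rw [wp_bind]
    refine le_trans (wp_mono_of_sat (sat_loop I h0 fun i hi => hsat i (by omega))
      (Q' := fun c s' => Φ k c s' + δ) fun c s' h => ?_) ?_
    · rw [wp_bind, wp_tick]
      exact hwp k (by omega) c s' h
    · rw [wp_add, wp_const]
      refine (add_le_add_left (ih (fun i hi => hsat i (by omega)) fun i hi => hwp i (by omega))
        δ).trans (le_of_eq ?_)
      push_cast
      ring

theorem sat_degreeSum (A : AdjList G) (h : Between L J 0 s) :
    Sat (loop n 0 fun t e => deg A (Fin.ofNat n t) >>= fun d => arith (e + d)) s fun e s' =>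
      e = 2 * G.edgeFinset.card ∧ Between L J 0 s' ∧ s'.time = s.time + 3 * n := by
  refine (sat_loop (fun t e s' => e = ∑ i ∈ Finset.range t, G.degree (Fin.ofNat n i) ∧
    Between L J 0 s' ∧ s'.time = s.time + 3 * t) ⟨by simp, h, by simp⟩ ?_).mono ?_
  · rintro i hi e s' ⟨he, h', ht⟩
    rw [sat_bind, sat_deg, sat_arith, A.length_nbrs, Finset.sum_range_succ, he]
    refine ⟨rfl, h'.step.step.step, ?_⟩
    simp only [Config.step_time]
    omega
  · rintro e s' ⟨he, h'⟩
    refine ⟨?_, h'⟩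
    rw [he, Finset.sum_range, ← G.sum_degrees_eq_twice_card_edges]
    exact Finset.sum_congr rfl fun u _ => by rw [Fin.ofNat_val_eq_self]

/-- Memory starts at 0, so `offset 0` is correct although no round writes it. -/
theorem between_init : Between L J 0 (Config.init n) := by
  refine ⟨⟨?_, ?_, ?_, ?_, ?_, ?_, ?_, ?_⟩, ?_, ?_, ?_, ?_⟩ <;> simp [Config.init]

theorem sat_buildIndex (hG : ∀ v, 0 < G.degree v) (A : AdjList G) (hL : 1 ≤ L) (hε : 0 < ε)
    (hJ : ∀ c : ℕ, c * ε ≤ L + 1 → c ≤ J) (hJ' : (J : ℝ) ≤ (L + 1) / ε)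
    (hr : 0 < residMax n L ε G.edgeFinset.card) (hN : 0 < walksOne n L K ε) :
    Sat (buildIndex A L K ε) (Config.init n) fun _ s' => s'.used ⊆ cells n L J ∧
      (s'.time : ℝ) ≤ 3 * n + 1 + ∑ u : Fin n, (1 + roundCost L ε
        (residMax n L ε G.edgeFinset.card) (walksOne n L K ε)
        (walksThree n L K ε (residMax n L ε G.edgeFinset.card) (G.degree u))) := by
  rw [buildIndex_eq, sat_bind]
  refine (sat_degreeSum A (between_init (L := L) (J := J))).mono ?_
  rintro _ s ⟨rfl, h, ht⟩
  rw [sat_bind, sat_arith]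
  have hm : (((2 * G.edgeFinset.card : ℕ) : ℝ)) / 2 = G.edgeFinset.card := by
    push_cast
    ring
  rw [hm]
  refine (sat_loop (fun t _ s' => Between L J t s' ∧ (s'.time : ℝ) ≤ 3 * n + 1 +
    ∑ i ∈ Finset.range t, (1 + roundCost L ε
        (residMax n L ε G.edgeFinset.card) (walksOne n L K ε)
        (walksThree n L K ε (residMax n L ε G.edgeFinset.card) (G.degree (Fin.ofNat n i)))))
    ⟨h.step, ?_⟩ ?_).mono ?_
  · simp only [Config.step_time, ht]
    simp [Config.init]
  · rintro i hi - s' ⟨h', ht'⟩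
    have hi' : Fin.ofNat n i = ⟨i, hi⟩ := Fin.ext (Nat.mod_eq_of_lt hi)
    refine (sat_round hG A hL hε hJ hJ' hr hN ⟨i, hi⟩ h'.step).mono ?_
    rintro _ s'' ⟨a1, -, a3⟩
    refine ⟨a1, ?_⟩
    rw [Finset.sum_range_succ, hi']
    simp only [Config.step_time] at a3
    push_cast at a3
    linarith
  · rintro _ s' ⟨h', ht'⟩
    refine ⟨h'.used, ht'.trans_eq ?_⟩
    rw [Finset.sum_range]
    exact congrArg _ (Finset.sum_congr rfl fun u _ => by rw [Fin.ofNat_val_eq_self])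

theorem wp_buildIndex_bad_le (hG : ∀ v, 0 < G.degree v) (A : AdjList G) (hL : 1 ≤ L) (hK : 0 < K)
    (hε : 0 < ε) (hJ : ∀ c : ℕ, c * ε ≤ L + 1 → c ≤ J) (hJ' : (J : ℝ) ≤ (L + 1) / ε) (hn : 2 ≤ n)
    (hr : 0 < residMax n L ε G.edgeFinset.card) {a : ℝ} (ha : 16 * a ≤ K * L) (ha0 : 0 ≤ a) :
    wp (buildIndex A L K ε) (fun _ s' => ind (¬ ∀ u v : Fin n, G.degree v ≤ G.degree u →
        |s'.pHat u v - pVec G L u v| ≤ ε)) (Config.init n) ≤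
      n * (n * ENNReal.ofReal ((n : ℝ) ^ (-a)) + n * (2 * ENNReal.ofReal ((n : ℝ) ^ (-a)))) := by
  have hlog : 0 < Real.log n := Real.log_pos (by exact_mod_cast hn)
  have hL' : (0 : ℝ) < L := by exact_mod_cast hL
  have hN₁ : 0 < walksOne n L K ε := Nat.ceil_pos.2 (by positivity)
  rw [buildIndex_eq, wp_bind]
  refine wp_le_of_sat ((sat_degreeSum A (between_init (L := L) (J := J))).mono ?_)
  rintro _ s ⟨rfl, h, -⟩
  rw [wp_bind, wp_arith]
  have hm : (((2 * G.edgeFinset.card : ℕ) : ℝ)) / 2 = G.edgeFinset.card := by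
    push_cast
    ring
  rw [hm]
  set bad : Fin n → Config n → Prop := fun u s' => ¬ ∀ v, G.degree v ≤ G.degree u →
        |s'.pHat u v - pVec G L u v| ≤ ε with hbad
  refine (wp_mono (Q' := fun _ s' => ind (∃ u : Fin n, (u : ℕ) < n ∧ bad u s'))
    fun _ s' => ind_mono fun h => ?_).trans ?_
  · obtain ⟨u, hu⟩ := not_forall.1 h
    exact ⟨u, u.2, hu⟩
  refine (wp_loop_le (fun t _ s' => Between L J t s')
    -- The potential indicates an error among the vertices already treated. It is inherited by later
    -- rounds since their outputs are kept.
    (fun t _ s' => ind (∃ u : Fin n, (u : ℕ) < t ∧ bad u s')) _ h.step ?_ ?_).trans_eq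
    (by rw [ind_neg (by simp), zero_add])
  · rintro i hi - s' h'
    exact (sat_round hG A hL hε hJ hJ' hr hN₁ ⟨i, hi⟩ h'.step).mono fun _ _ h => h.1
  · rintro i hi - s' h'
    refine le_trans (wp_mono_of_sat (Q' := fun _ s'' => ind (∃ u : Fin n, (u : ℕ) < i ∧ bad u s') +
      ind (bad ⟨i, hi⟩ s'')) (sat_round hG A hL hε hJ hJ' hr hN₁ ⟨i, hi⟩ h'.step) ?_) ?_
    · rintro _ s'' ⟨-, a2, -⟩
      refine ind_le ?_
      rintro ⟨u, hu, hb⟩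
      rcases Nat.lt_succ_iff_lt_or_eq.1 hu with hu | hu
      · refine le_add_right (ind_pos ⟨u, hu, fun hg => hb fun v hv => ?_⟩).ge
        rw [a2.pHat_eq h'.step hu v]
        exact hg v hv
      · obtain rfl : u = ⟨i, hi⟩ := Fin.ext hu
        exact le_add_left (ind_pos hb).ge
    · rw [wp_add, wp_const]
      gcongr
      exact wp_round_bad_le hG A hL hK hε hJ hn hr ha ha0 ⟨i, hi⟩ h'.step

omit [DecidableRel G.Adj] in
theorem toOuterMeasure_run_eq (A : AdjList G) (E : Config n → Prop) :
    (run A L K ε).toOuterMeasure {s | E s}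
      = wp (buildIndex A L K ε) (fun _ s' => ind (E s')) (Config.init n) := by
  unfold run wp
  rw [PMF.toOuterMeasure_map_apply, PMF.toOuterMeasure_apply]
  refine tsum_congr fun x => ?_
  beta_reduce
  by_cases h : E x.2
  · rw [ind_pos h, mul_one, Set.indicator_of_mem]
    exact h
  · rw [ind_neg h, mul_zero, Set.indicator_of_notMem]
    exact h

omit [NeZero n] in
-- The union over `u`, `v` and the three tail events costs 3n² ≤ n⁴, which is why the exponent is c
-- + 4.
theorem failure_le (hn : 2 ≤ n) (c : ℝ) :
    (n : ℝ≥0∞) * (n * ENNReal.ofReal ((n : ℝ) ^ (-(c + 4))) +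
      n * (2 * ENNReal.ofReal ((n : ℝ) ^ (-(c + 4))))) ≤ ENNReal.ofReal ((n : ℝ) ^ (-c)) := by
  have hn' : (2 : ℝ) ≤ n := by exact_mod_cast hn
  have hn0 : (0 : ℝ) < n := by linarith
  have h1 : (n : ℝ≥0∞) * (n * ENNReal.ofReal ((n : ℝ) ^ (-(c + 4))) +
      n * (2 * ENNReal.ofReal ((n : ℝ) ^ (-(c + 4)))))
      = ENNReal.ofReal (3 * (n : ℝ) ^ 2 * (n : ℝ) ^ (-(c + 4))) := by
    rw [ENNReal.ofReal_mul (by positivity), ENNReal.ofReal_mul (by positivity),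
      ENNReal.ofReal_pow hn0.le, ENNReal.ofReal_natCast, ENNReal.ofReal_ofNat]
    ring
  rw [h1]
  refine ENNReal.ofReal_le_ofReal ?_
  have h2 : (n : ℝ) ^ (-c) = (n : ℝ) ^ 4 * (n : ℝ) ^ (-(c + 4)) := by
    rw [← Real.rpow_natCast (n : ℝ) 4, ← Real.rpow_add hn0]
    congr 1
    push_cast
    ring
  rw [h2]
  have h3 : 3 * (n : ℝ) ^ 2 ≤ (n : ℝ) ^ 4 := by
    have h4 : (3 : ℝ) ≤ (n : ℝ) ^ 2 := by nlinarith
    calc 3 * (n : ℝ) ^ 2 ≤ (n : ℝ) ^ 2 * (n : ℝ) ^ 2 := by gcongr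
      _ = (n : ℝ) ^ 4 := by ring
  gcongr

end Main

end ERSketch

end

noncomputable section

namespace ERSketch

/-! ## The resource bounds -/

section Resources

variable {n : ℕ}

theorem two_le_of_degree_pos [NeZero n] {G : SimpleGraph (Fin n)} [DecidableRel G.Adj]
    (hG : ∀ v, 0 < G.degree v) : 2 ≤ n := by
  have h1 := G.degree_lt_card_verts 0
  rw [Fintype.card_fin] at h1
  have h2 := hG 0
  omega

theorem le_two_mul_card_edgeFinset {G : SimpleGraph (Fin n)} [DecidableRel G.Adj]
    (hG : ∀ v, 0 < G.degree v) : n ≤ 2 * G.edgeFinset.card := by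
  rw [← G.sum_degrees_eq_twice_card_edges]
  calc n = ∑ v : Fin n, 1 := by simp
    _ ≤ _ := Finset.sum_le_sum fun v _ => hG v

theorem card_cells_le_real {L J : ℕ} {ε : ℝ} (hn : 1 ≤ n) (hL : 1 ≤ L) (hε : 0 < ε) (hε1 : ε < 1)
    (hJ : (J : ℝ) ≤ (L + 1) / ε) : ((cells n L J).card : ℝ) ≤ 100 * (L : ℝ) ^ 2 * (n / ε) := by
  have hn' : (1 : ℝ) ≤ n := by exact_mod_cast hn
  have hL' : (1 : ℝ) ≤ L := by exact_mod_cast hL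
  have h1 : ((cells n L J).card : ℝ) ≤ n + J * n + J * ((L + 2) * n) + n * J
      + (n + J + J * ((L + 2) * n) + (L + 1) * n + n * J
      + (4 + J * (L + 2) + (L + 1) * n + (L + 1) * n + (n + 1))) := by
    exact_mod_cast card_cells_le n L J
  set y : ℝ := 1 / ε with hy
  have hy1 : 1 ≤ y := by
    rw [hy, le_div_iff₀ hε]
    linarith
  have hJy : (J : ℝ) ≤ 2 * L * y := by
    refine hJ.trans ?_
    rw [div_eq_mul_one_div, ← hy]
    gcongr
    linarith
  have hJ0 : (0 : ℝ) ≤ J := Nat.cast_nonneg J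
  have hny : (n : ℝ) / ε = n * y := by rw [hy]; ring
  rw [hny]
  have a1 : (L : ℝ) ≤ L ^ 2 := by nlinarith
  have a2 : (L : ℝ) * n ≤ L ^ 2 * (n * y) := by
    calc (L : ℝ) * n = L * (n * 1) := by ring
      _ ≤ L ^ 2 * (n * y) := by gcongr
  have a3 : (n : ℝ) ≤ L * n := by nlinarith
  have a4 : (J : ℝ) * n * L ≤ 2 * (L ^ 2 * (n * y)) := by
    calc (J : ℝ) * n * L ≤ 2 * L * y * n * L := by gcongr
      _ = _ := by ring
  have a5 : (J : ℝ) * n ≤ J * n * L := le_mul_of_one_le_right (by positivity) hL'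
  have a6 : (J : ℝ) ≤ J * n := le_mul_of_one_le_right hJ0 hn'
  have a7 : (J : ℝ) * L ≤ J * n * L := by gcongr
  nlinarith

/-- With S = √(nm), the definition of r_max gives r m = LεS and n/r = S/(Lε). Hence the descents and
the third-stage walks both cost a power of L times S/ε, up to K log n. All terms are compared with Y
= L⁴ S/ε. -/
theorem total_cost_le {L m : ℕ} {K ε : ℝ} {d : Fin n → ℕ} (hn : 2 ≤ n) (hL : 1 ≤ L) (hK : 0 < K)
    (hε : 0 < ε) (hε1 : ε < 1) (hm : n ≤ 2 * m) (hd : ∑ u, d u = 2 * m) :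
    3 * (n : ℝ) + 1 + ∑ u, (1 + roundCost L ε (residMax n L ε m) (walksOne n L K ε)
      (walksThree n L K ε (residMax n L ε m) (d u))) ≤
      2000 * (1 + K) * (L : ℝ) ^ 4 * Real.log n * (Real.sqrt (n * m) / ε) := by
  have hn' : (2 : ℝ) ≤ n := by exact_mod_cast hn
  have hL' : (1 : ℝ) ≤ L := by exact_mod_cast hL
  have hm' : (n : ℝ) ≤ 2 * m := by exact_mod_cast hm
  have hm0 : (0 : ℝ) < m := by linarith
  have hn0 : (0 : ℝ) < n := by linarith
  set ℓ := Real.log n with hℓ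
  -- Terms without a logarithm are absorbed with log n ≥ log 2 > 1/2.
  have hℓ1 : 1 ≤ 2 * ℓ := by
    have h1 : Real.log 2 ≤ ℓ := Real.log_le_log (by norm_num) hn'
    have := Real.log_two_gt_d9
    linarith
  have hℓ0 : 0 < ℓ := by linarith
  set S := Real.sqrt (n * m) with hS
  have hS2 : S ^ 2 = n * m := Real.sq_sqrt (by positivity)
  have hS0 : 0 < S := Real.sqrt_pos.2 (by positivity)
  -- Without isolated vertices n ≤ 2m, so n² ≤ 2S².
  have hnS : (n : ℝ) ≤ 2 * S := by
    refine le_of_sq_le_sq ?_ (by positivity)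
    nlinarith
  set r := residMax n L ε m with hr
  have hrm : r * m = L * ε * S := by
    have h1 : Real.sqrt ((n : ℝ) / m) * m = S := by
      have h2 : (n : ℝ) * m = n / m * (m * m) := by field_simp
      rw [hS, h2, Real.sqrt_mul (by positivity), Real.sqrt_mul_self hm0.le]
    rw [hr, residMax, mul_assoc, h1]
  have hr0 : 0 < r := by
    have : 0 < r * m := by rw [hrm]; positivity
    exact pos_of_mul_pos_left this hm0.le
  have hnr : (n : ℝ) / r = S / (L * ε) := by
    rw [div_eq_div_iff hr0.ne' (by positivity)]
    have h1 : n * (L * ε) * m = S * r * m := by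
      rw [mul_assoc S, hrm]
      calc (n : ℝ) * (L * ε) * m = (L * ε) * (n * m) := by ring
        _ = (L * ε) * S ^ 2 := by rw [hS2]
        _ = _ := by ring
    exact mul_right_cancel₀ hm0.ne' h1
  have hN₁ : (walksOne n L K ε : ℝ) ≤ K * L ^ 2 * ℓ / ε + 1 :=
    (Nat.ceil_lt_add_one (by positivity)).le
  have hN₃ : ∀ u, (walksThree n L K ε r (d u) : ℝ) ≤ K * L / ε ^ 2 * r * d u * ℓ + 1 := fun u =>
    (Nat.ceil_lt_add_one (by positivity)).le
  have hterm : ∀ u ∈ Finset.univ, 1 + roundCost L ε r (walksOne n L K ε)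
      (walksThree n L K ε r (d u)) ≤ (17 + 26 * ((K * L ^ 2 * ℓ / ε + 1) * (L + 1)) + 19 * (L + 1) +
        32 * (L + 1) ^ 2 / ε + 17 * (L + 1) ^ 3 * L ^ 2 / r) +
        19 * (K * L / ε ^ 2 * r * ℓ * (L + 1)) * d u := by
    intro u _
    have h1 : (walksOne n L K ε : ℝ) * (L + 1) ≤ (K * L ^ 2 * ℓ / ε + 1) * (L + 1) := by
      gcongr
    have h2 : (walksThree n L K ε r (d u) : ℝ) * (L + 1) ≤
        (K * L / ε ^ 2 * r * d u * ℓ + 1) * (L + 1) := by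
      gcongr
      exact hN₃ u
    unfold roundCost
    linarith
  have hsum := (Finset.sum_le_sum hterm).trans_eq Finset.sum_add_distrib
  have hd' : ∑ u, (d u : ℝ) = 2 * m := by exact_mod_cast hd
  rw [← Finset.mul_sum, hd', Finset.sum_const, Finset.card_univ,
    Fintype.card_fin, nsmul_eq_mul] at hsum
  have hL2 : (L : ℝ) + 1 ≤ 2 * L := by linarith
  have hL12 : (L : ℝ) ≤ L ^ 2 := by nlinarith
  have hL24 : (L : ℝ) ^ 2 ≤ L ^ 4 := pow_le_pow_right₀ hL' (by norm_num)
  have hL34 : (L : ℝ) ^ 3 ≤ L ^ 4 := pow_le_pow_right₀ hL' (by norm_num)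
  have hL14 : (1 : ℝ) ≤ L ^ 4 := one_le_pow₀ hL'
  have hSε : S ≤ S / ε := by
    rw [le_div_iff₀ hε]
    nlinarith
  set Y := (L : ℝ) ^ 4 * (S / ε) with hY
  have hY0 : 0 < Y := by positivity
  have hYℓ : Y ≤ 2 * (ℓ * Y) := by nlinarith
  have hnY : (n : ℝ) ≤ 2 * Y := by
    calc (n : ℝ) ≤ 2 * (1 * S) := by linarith
      _ ≤ 2 * Y := by rw [hY]; gcongr
  have hnLY : (n : ℝ) * (L + 1) ≤ 4 * Y := by
    calc (n : ℝ) * (L + 1) ≤ (2 * S) * (2 * L) := by gcongr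
      _ = 4 * (L * S) := by ring
      _ ≤ 4 * Y := by
        rw [hY]
        gcongr
        exact hL12.trans hL24
  have hnLL : (n : ℝ) * (L + 1) ^ 2 / ε ≤ 8 * Y := by
    calc (n : ℝ) * (L + 1) ^ 2 / ε ≤ (2 * S) * (2 * L) ^ 2 / ε := by gcongr
      _ = 8 * (L ^ 2 * (S / ε)) := by ring
      _ ≤ 8 * Y := by rw [hY]; gcongr
  have hcgd : (n : ℝ) * ((L + 1) ^ 3 * L ^ 2 / r) ≤ 8 * Y := by
    calc (n : ℝ) * ((L + 1) ^ 3 * L ^ 2 / r) = (L + 1) ^ 3 * L ^ 2 * (n / r) := by ring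
      _ ≤ (2 * L) ^ 3 * L ^ 2 * (n / r) := by gcongr
      _ = 8 * Y := by
        rw [hnr, hY]
        field_simp
        ring
  have hfirst : (n : ℝ) * (K * L ^ 2 * ℓ / ε * (L + 1)) ≤ 4 * (K * (ℓ * Y)) := by
    calc (n : ℝ) * (K * L ^ 2 * ℓ / ε * (L + 1)) ≤ (2 * S) * (K * L ^ 2 * ℓ / ε * (2 * L)) := by
          gcongr
      _ = 4 * (K * (ℓ * (L ^ 3 * (S / ε)))) := by ring
      _ ≤ 4 * (K * (ℓ * Y)) := by rw [hY]; gcongr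
  have hthird : K * L / ε ^ 2 * r * ℓ * (L + 1) * (2 * m) ≤ 4 * (K * (ℓ * Y)) := by
    calc K * L / ε ^ 2 * r * ℓ * (L + 1) * (2 * m)
        = 2 * (K * L / ε ^ 2 * (r * m) * ℓ) * (L + 1) := by ring
      _ = 2 * (K * ℓ * (L ^ 2 * (S / ε))) * (L + 1) := by
        rw [hrm]
        field_simp
      _ ≤ 2 * (K * ℓ * (L ^ 2 * (S / ε))) * (2 * L) := by gcongr
      _ = 4 * (K * (ℓ * (L ^ 3 * (S / ε)))) := by ring
      _ ≤ 4 * (K * (ℓ * Y)) := by rw [hY]; gcongr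
  have hgoal : 2000 * (1 + K) * (L : ℝ) ^ 4 * ℓ * (S / ε) = 2000 * (ℓ * Y) + 2000 * (K * (ℓ * Y)) := by
    rw [hY]
    ring
  have hsplit : (n : ℝ) * (17 + 26 * ((K * L ^ 2 * ℓ / ε + 1) * (L + 1)) + 19 * (L + 1) +
        32 * (L + 1) ^ 2 / ε + 17 * (L + 1) ^ 3 * L ^ 2 / r) =
      17 * n + 26 * (n * (K * L ^ 2 * ℓ / ε * (L + 1))) + 45 * (n * (L + 1)) +
        32 * (n * (L + 1) ^ 2 / ε) + 17 * (n * ((L + 1) ^ 3 * L ^ 2 / r)) := by ring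
  rw [hsplit] at hsum
  rw [hgoal]
  have hKY : 0 < K * (ℓ * Y) := by positivity
  linarith

end Resources

end ERSketch

end

/-! ### The theorem and the choice of the constants. -/

theorem theorem5 :
    (∀ c : ℝ, 0 < c → ∃ K₀ : ℝ, 0 < K₀ ∧
      ∀ (n : ℕ) [NeZero n] (G : SimpleGraph (Fin n)) [DecidableRel G.Adj]
        (A : ERSketch.AdjList G) (L : ℕ) (K ε : ℝ),
        (∀ v, 0 < G.degree v) → 1 ≤ L → 0 < K → 0 < ε → ε < 1 → K₀ ≤ K * (L : ℝ) →
        (ERSketch.run A L K ε).toOuterMeasure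
            {s | ¬ ∀ u v : Fin n, G.degree v ≤ G.degree u →
              |s.pHat u v - ERSketch.pVec G L u v| ≤ ε}
          ≤ ENNReal.ofReal ((n : ℝ) ^ (-c))) ∧
    (∃ C : ℝ, 0 < C ∧
      ∀ (n : ℕ) [NeZero n] (G : SimpleGraph (Fin n)) [DecidableRel G.Adj]
        (A : ERSketch.AdjList G) (L : ℕ) (K ε : ℝ),
        (∀ v, 0 < G.degree v) → 1 ≤ L → 0 < K → 0 < ε → ε < 1 →
        ∀ s ∈ (ERSketch.run A L K ε).support,
          (s.time : ℝ) ≤ C * (1 + K) * (L : ℝ) ^ 4 * Real.log (n : ℝ)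
              * (Real.sqrt ((n : ℝ) * (G.edgeFinset.card : ℝ)) / ε) ∧
          (s.space : ℝ) ≤ C * (L : ℝ) ^ 2 * ((n : ℝ) / ε)) := by
  have aux : ∀ (n : ℕ) [NeZero n] (G : SimpleGraph (Fin n)) [DecidableRel G.Adj] (L : ℕ) (ε : ℝ),
      (∀ v, 0 < G.degree v) → 1 ≤ L → 0 < ε →
      2 ≤ n ∧ 0 < ERSketch.residMax n L ε G.edgeFinset.card ∧
      (∀ c : ℕ, (c : ℝ) * ε ≤ L + 1 → c ≤ ⌊((L : ℝ) + 1) / ε⌋₊) ∧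
      ((⌊((L : ℝ) + 1) / ε⌋₊ : ℕ) : ℝ) ≤ (L + 1) / ε := by
    intro n _ G _ L ε hG hL hε
    have hn := ERSketch.two_le_of_degree_pos hG
    have hm : 0 < G.edgeFinset.card := by
      have := ERSketch.le_two_mul_card_edgeFinset hG
      omega
    have hL' : (0 : ℝ) < L := by exact_mod_cast hL
    have hm' : (0 : ℝ) < G.edgeFinset.card := by exact_mod_cast hm
    have hn' : (0 : ℝ) < n := by exact_mod_cast (by omega : 0 < n)
    refine ⟨hn, ?_, fun c hc => Nat.le_floor ((le_div_iff₀ hε).2 hc),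
      Nat.floor_le (by positivity)⟩
    unfold ERSketch.residMax
    positivity
  -- The 16 is that of the third-stage tail and c + 4 that of `failure_le`; 2000 is the time
  -- constant, which also exceeds the 100 of the space bound.
  refine ⟨fun c hc => ⟨16 * (c + 4), by linarith, ?_⟩, 2000, by norm_num, ?_⟩
  · intro n _ G _ A L K ε hG hL hK hε hε1 hKL
    obtain ⟨hn, hr, hJ, hJ'⟩ := aux n G L ε hG hL hε
    rw [ERSketch.toOuterMeasure_run_eq]
    exact (ERSketch.wp_buildIndex_bad_le hG A hL hK hε hJ hJ' hn hr hKL (by linarith)).trans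
      (ERSketch.failure_le hn c)
  · intro n _ G _ A L K ε hG hL hK hε hε1 s hs
    obtain ⟨hn, hr, hJ, hJ'⟩ := aux n G L ε hG hL hε
    have hL' : (0 : ℝ) < L := by exact_mod_cast hL
    have hlog : 0 < Real.log n := Real.log_pos (by exact_mod_cast hn)
    have hN : 0 < ERSketch.walksOne n L K ε := Nat.ceil_pos.2 (by positivity)
    unfold ERSketch.run at hs
    rw [PMF.mem_support_map_iff] at hs
    obtain ⟨x, hx, rfl⟩ := hs
    obtain ⟨hu, ht⟩ := ERSketch.sat_buildIndex hG A hL hε hJ hJ' hr hN x hx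
    refine ⟨ht.trans (ERSketch.total_cost_le hn hL hK hε hε1
      (ERSketch.le_two_mul_card_edgeFinset hG) G.sum_degrees_eq_twice_card_edges), ?_⟩
    have h1 : (x.2.space : ℝ) ≤ ((ERSketch.cells n L ⌊((L : ℝ) + 1) / ε⌋₊).card : ℝ) :=
      Nat.cast_le.2 (Finset.card_le_card hu)
    have h2 := ERSketch.card_cells_le_real (n := n) (by omega) hL hε hε1 hJ'
    have h3 : (100 : ℝ) * (L : ℝ) ^ 2 * (n / ε) ≤ 2000 * (L : ℝ) ^ 2 * (n / ε) := by
      gcongr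
      norm_num
    linarith
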